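/- Fix real numbers $\delta>0$, $\mu$, $B>0$ and $y_0<1$, and put $\varkappa=\frac{\delta}{2(4+\delta)}$. There is a constant $\tau_0>0$, depending only on $\delta,\mu,B,y_0$, such that the following holds. Let $n=n(N)$ be a sequence of integers with $n(N)/N\to y_0$ as $N\to\infty$. For every $Q\ge 1$ and $A>0$ there is a constant $C>0$, depending only on $Q,A,\delta,\mu,B$ and the sequence $n(\cdot)$, such that, for every $N$ with $1\le n=n(N)<N$, for every $p=p_N$ with $$Np\ \ge\ B\,(\ln N)^{\frac{3}{2\varkappa}},$$ for all i.i.d. real random variables $X_{jk}$ ($1\le j\le N$, $1\le k\le n$; their distribution may depend on $N$) with $$\mathbb E X_{jk}=0,\qquad \mathbb E X_{jk}^2=1,\qquad \mathbb E|X_{jk}|^{4+\delta}\le\mu,$$ for all independent Bernoulli ($\{0,1\}$-valued) random variables $\xi_{jk}$ with $\mathbb E\xi_{jk}=p$ that are independent of the family $(X_{jk})$, and for every $\tau\le\tau_0$, $$\Pr\{s_n\le\tau\sqrt{Np}\}\ \le\ C N^{-Q}+N^2p\,\Pr\bigl\{|X_{11}|>A(Np)^{\frac12-\varkappa}\ln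 N\bigr\},$$ where $s_1\ge\dots\ge s_n$ are the singular values of the $N\times n$ matrix $\mathbf X=(\xi_{jk}X_{jk})$. -/

import Mathlib

open MeasureTheory ProbabilityTheory Filter Topology

noncomputable section

/-- The exponent `ϰ = δ / (2 (4 + δ))`. -/
def kappa (δ : ℝ) : ℝ := δ / (2 * (4 + δ))

/-- The sparse random matrix with entries `ξ j k * X j k`, at the outcome `ω`. -/
def sparseMatrix {Ω : Type*} {N n : ℕ} (X ξ : Fin N → Fin n → Ω → ℝ) (ω : Ω) :
    Matrix (Fin N) (Fin n) ℝ :=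
  Matrix.of fun j k => ξ j k ω * X j k ω

/-- The `n`-th largest singular value `s_n` of an `N × n` matrix, counted with multiplicity.
Mathlib numbers the singular values in decreasing order starting from `0`. -/
def sLast {N n : ℕ} (M : Matrix (Fin N) (Fin n) ℝ) : ℝ :=
  (Matrix.toEuclideanLin M).singularValues (n - 1)

/-- `X` is an `N × n` array of i.i.d. random variables with mean zero, variance one and
`E |X_jk|^(4+δ) ≤ m`, and `ξ` is an array, independent of `X`, of independent Bernoulli random
variables with mean `p`. -/
structure IsSparseModel {Ω : Type*} [MeasurableSpace Ω] (P : Measure Ω) {N n : ℕ}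
    (δ m p : ℝ) (X ξ : Fin N → Fin n → Ω → ℝ) : Prop where
  measurable_X : ∀ j k, Measurable (X j k)
  measurable_ξ : ∀ j k, Measurable (ξ j k)
  indep_X : iIndepFun (fun i : Fin N × Fin n => X i.1 i.2) P
  identDistrib_X : ∀ j k j' k', IdentDistrib (X j k) (X j' k') P P
  mean_X : ∀ j k, ∫ ω, X j k ω ∂P = 0
  variance_X : ∀ j k, ∫ ω, (X j k ω) ^ 2 ∂P = 1
  integrable_moment : ∀ j k, Integrable (fun ω => |X j k ω| ^ (4 + δ)) P
  moment_le : ∀ j k, ∫ ω, |X j k ω| ^ (4 + δ) ∂P ≤ m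
  bernoulli_ξ : ∀ j k, ∀ᵐ ω ∂P, ξ j k ω = 0 ∨ ξ j k ω = 1
  mean_ξ : ∀ j k, ∫ ω, ξ j k ω ∂P = p
  indep_ξ : iIndepFun (fun i : Fin N × Fin n => ξ i.1 i.2) P
  indep_X_ξ : IndepFun (fun ω (i : Fin N × Fin n) => X i.1 i.2 ω)
    (fun ω (i : Fin N × Fin n) => ξ i.1 i.2 ω) P

end

/-! ### Laplace transform of the norm of a projected random vector -/

section ProjectionSmallBall

variable {ι : Type*} [Fintype ι]

/-! Write D = Np. The claim is that |Ax|² ≥ τD for all unit x at once, with probability 1 −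
O(N^{-Q}). The matrix is tall: eventually it has at least 2ηN more rows than columns, with η
depending on y₀ only.

Small balls. Suppose x is spread out over a set J of coordinates and arbitrary elsewhere. Projecting
onto the orthogonal complement of the columns outside J removes the arbitrary part, and because the
matrix is tall this complement has dimension of order N. By
`lintegral_exp_neg_sq_norm_starProjection_le` the Laplace transform of the squared norm of a
projection is at most a product of one-row factors, one for each spare dimension. A row factor is
estimated through characteristic functions, and flatness on J keeps these under control in a wide
range of frequencies. The outcome `matMeasure_dist_lt_le` is strong enough for a union bound over a
net on J and over J: `exists_matMeasure_flat_union_le` treats the J of size up to N / (λ log N), and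
`matMeasure_flat_last_union_le` the J that omit few coordinates. Here λ = D^{1/16}.

Localization. Sort the coordinates of a unit vector x into levels x_k² ≈ λ^{-i}; on one level x is
flat. A single level may carry only a fraction 1 / log N of the mass, so applying the flat bound to
x directly would lose a logarithm. Instead x is multiplied by slowly varying tent functions of the
level, each of bounded width. Since A is sparse, a row is dominated by the few levels just after the
lowest one that it meets, so the tent nearly commutes with A. Summing over all tents,
`le_sum_sq_of_flatBound` shows that the loss is a constant.

Operator norm. Nets and localization both need |Ax|² ≤ K²D|x|². The moments of A are compared with
those of a dense sign matrix restricted to random rows and columns (`integral_trace_pow_le`), for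
which a net argument suffices. This gives `matMeasure_opNorm_gt_le`.

Heavy entries. The above is for entries bounded by b with b^{4+δ} = D². A row containing a larger
entry is deleted. Deleting rows only decreases |Ax|, and with overwhelming probability at most ηN
rows are lost, so the matrix stays tall. Conditionally on the set of deleted rows, the others are
independent with truncated entries (`pi_le_of_cond_le`, `HeavyLaw.sparseLaw_cond`). -/

theorem sum_sq_norm_starProjection_single [DecidableEq ι] (W : Submodule ℝ (EuclideanSpace ℝ ι)) :
    ∑ j, ‖W.starProjection (EuclideanSpace.single j (1 : ℝ))‖ ^ 2 = Module.finrank ℝ W := by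
  set b := stdOrthonormalBasis ℝ W
  have h1 : ∀ x : EuclideanSpace ℝ ι, ‖W.starProjection x‖ ^ 2 =
      ∑ i, (inner ℝ (b i : EuclideanSpace ℝ ι) x) ^ 2 := by
    intro x
    have : ‖W.starProjection x‖ = ‖W.orthogonalProjectionOnto x‖ := by simp
    rw [this, ← b.sum_sq_norm_inner_right]
    refine Finset.sum_congr rfl fun i _ => ?_
    rw [Real.norm_eq_abs, sq_abs]
    congr 1
    rw [Submodule.coe_inner, ← Submodule.starProjection_apply,
      ← Submodule.inner_starProjection_left_eq_right,
      Submodule.starProjection_eq_self_iff.2 (b i).2]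
  simp_rw [h1]
  rw [Finset.sum_comm]
  have h2 : ∀ i, ∑ j, (inner ℝ (b i : EuclideanSpace ℝ ι) (EuclideanSpace.single j (1 : ℝ))) ^ 2
      = 1 := by
    intro i
    have : ‖(b i : EuclideanSpace ℝ ι)‖ = 1 := b.orthonormal.1 i
    have h3 := EuclideanSpace.norm_sq_eq (b i : EuclideanSpace ℝ ι)
    rw [this] at h3
    simp only [Real.norm_eq_abs, sq_abs] at h3
    simp [EuclideanSpace.inner_single_right, ← h3]
  simp [h2]

theorem exists_le_sq_norm_starProjection_single [DecidableEq ι] (W : Submodule ℝ (EuclideanSpace ℝ ι)) {a : ℝ}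
    (hW : a * Fintype.card ι ≤ Module.finrank ℝ W) (h0 : 0 < Module.finrank ℝ W) :
    ∃ j, a ≤ ‖W.starProjection (EuclideanSpace.single j (1 : ℝ))‖ ^ 2 := by
  by_contra! h
  have h1 := sum_sq_norm_starProjection_single W
  have hne : (Finset.univ : Finset ι).Nonempty := by
    by_contra hne
    rw [Finset.not_nonempty_iff_eq_empty] at hne
    rw [hne, Finset.sum_empty] at h1
    have : (0 : ℝ) < Module.finrank ℝ W := by exact_mod_cast h0
    linarith
  have h2 := Finset.sum_lt_sum_of_nonempty hne fun j _ => h j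
  simp only [Finset.sum_const, Finset.card_univ, nsmul_eq_mul] at h2
  linarith

/-- Bessel's inequality for the orthogonal pieces ℝf and `W'` of `W`. In the induction below, f is
the only direction that involves the chosen coordinate. -/
theorem sq_norm_starProjection_ge (W W' : Submodule ℝ (EuclideanSpace ℝ ι)) (hW : W' ≤ W)
    (f : EuclideanSpace ℝ ι) (hf : f ∈ W) (hf' : ∀ w ∈ W', inner ℝ f w = 0) (hf0 : f ≠ 0)
    (z : EuclideanSpace ℝ ι) :
    (inner ℝ f z) ^ 2 / ‖f‖ ^ 2 + ‖W'.starProjection z‖ ^ 2 ≤ ‖W.starProjection z‖ ^ 2 := by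
  set y := W.starProjection z with hy
  have h1 : W'.starProjection z = W'.starProjection y := by
    rw [hy]
    have := Submodule.starProjection_comp_starProjection_of_le hW
    exact (DFunLike.congr_fun this z).symm
  have h2 : inner ℝ f z = inner ℝ f y := by
    rw [hy, ← Submodule.inner_starProjection_left_eq_right,
      Submodule.starProjection_eq_self_iff.2 hf]
  have h3 : inner ℝ f y = inner ℝ f (y - W'.starProjection y) := by
    rw [inner_sub_right, hf' _ (Submodule.starProjection_apply_mem _ _), sub_zero]
  have h4 : ‖y‖ ^ 2 = ‖W'.starProjection y‖ ^ 2 + ‖y - W'.starProjection y‖ ^ 2 := by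
    have h5 : inner ℝ (W'.starProjection y) (y - W'.starProjection y) = 0 := by
      rw [real_inner_comm]
      exact Submodule.starProjection_inner_eq_zero _ _ (Submodule.starProjection_apply_mem _ _)
    have h6 := norm_add_sq_real (W'.starProjection y) (y - W'.starProjection y)
    rw [h5] at h6
    simpa using h6
  have h7 := real_inner_mul_inner_self_le f (y - W'.starProjection y)
  rw [real_inner_self_eq_norm_sq, real_inner_self_eq_norm_sq] at h7
  have h8 : 0 < ‖f‖ ^ 2 := by positivity
  rw [h1, h2, h3, h4]
  have : (inner ℝ f (y - W'.starProjection y)) ^ 2 / ‖f‖ ^ 2 ≤ ‖y - W'.starProjection y‖ ^ 2 := by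
    rw [div_le_iff₀ h8]
    nlinarith
  linarith

/-- Coordinates are peeled off one at a time. The numbers ‖P_W e_j‖² sum to dim W, so some j has
‖P_W e_j‖² ≥ a as long as dim W ≥ a · card ι. Then W is the orthogonal sum of the line of f = P_W
e_j and a subspace of vectors vanishing at j. The projection to the latter does not depend on z_j,
while the component along f has length ‖f‖ · |z_j + u| with u a function of the other coordinates.
Integrating z_j gains a factor q and costs one dimension. -/
theorem lintegral_exp_neg_sq_norm_starProjection_le [DecidableEq ι] {μ : ι → Measure ℝ}
    [∀ i, IsProbabilityMeasure (μ i)] {θ a : ℝ} (ha : 0 < a) (hθ : 0 ≤ θ) {q : ENNReal}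
    (hq : ∀ j u, ∫⁻ x, ENNReal.ofReal (Real.exp (-(θ * (x + u) ^ 2))) ∂(μ j) ≤ q) (t : ℕ)
    (W : Submodule ℝ (EuclideanSpace ℝ ι))
    (hW : t + a * Fintype.card ι ≤ Module.finrank ℝ W) :
    ∫⁻ z, ENNReal.ofReal (Real.exp (-(θ / a * ‖W.starProjection (WithLp.toLp 2 z)‖ ^ 2)))
      ∂(Measure.pi μ) ≤ q ^ t := by
  induction t generalizing W with
  | zero =>
    rw [pow_zero]
    calc _ ≤ ∫⁻ z, 1 ∂(Measure.pi μ) := by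
          refine lintegral_mono fun z => ?_
          rw [← ENNReal.ofReal_one]
          refine ENNReal.ofReal_le_ofReal ?_
          rw [Real.exp_le_one_iff]
          have : 0 ≤ θ / a * ‖W.starProjection (WithLp.toLp 2 z)‖ ^ 2 := by positivity
          linarith
      _ = 1 := by simp
  | succ t ih =>
    push_cast at hW
    have hpos : 0 < Module.finrank ℝ W := by
      have : (0 : ℝ) < Module.finrank ℝ W := by
        have : 0 ≤ a * Fintype.card ι := by positivity
        have : (0 : ℝ) ≤ t := by positivity
        linarith
      exact_mod_cast this
    have ht0 : (0 : ℝ) ≤ t := by positivity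
    obtain ⟨j, hj⟩ := exists_le_sq_norm_starProjection_single W (a := a) (by linarith) hpos
    set e : EuclideanSpace ℝ ι := EuclideanSpace.single j (1 : ℝ) with he
    set f := W.starProjection e with hf
    have hfW : f ∈ W := Submodule.starProjection_apply_mem _ _
    have hf0 : f ≠ 0 := by
      intro h0
      rw [h0] at hj
      simp at hj
      linarith
    have hfn : 0 < ‖f‖ ^ 2 := by positivity
    -- On W the vector f represents the j-th coordinate functional, so being orthogonal to f means
    -- vanishing at j.
    have hinner : ∀ w ∈ W, inner ℝ f w = w j := by
      intro w hw
      rw [hf, Submodule.inner_starProjection_left_eq_right,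
        Submodule.starProjection_eq_self_iff.2 hw, he, EuclideanSpace.inner_single_left]
      simp
    have hfj : f j = ‖f‖ ^ 2 := by rw [← hinner f hfW, real_inner_self_eq_norm_sq]
    set W' : Submodule ℝ (EuclideanSpace ℝ ι) := W ⊓ (ℝ ∙ f)ᗮ with hW'
    have hW'j : ∀ w ∈ W', w j = 0 := by
      intro w hw
      rw [← hinner w hw.1]
      exact Submodule.mem_orthogonal_singleton_iff_inner_right.1 hw.2
    have hrank : (t : ℝ) + a * Fintype.card ι ≤ Module.finrank ℝ W' := by
      have h1 : Module.finrank ℝ (ℝ ∙ f) + Module.finrank ℝ W' = Module.finrank ℝ W := by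
        rw [hW', inf_comm]
        exact Submodule.finrank_add_inf_finrank_orthogonal
          (by rwa [Submodule.span_singleton_le_iff_mem])
      rw [finrank_span_singleton hf0] at h1
      have h2 : (1 : ℝ) + Module.finrank ℝ W' = Module.finrank ℝ W := by exact_mod_cast h1
      linarith
    have hcoord : ∀ (x : ι → ℝ) (s : ℝ), inner ℝ f (WithLp.toLp 2 (Function.update x j s)) =
        ‖f‖ ^ 2 * (s + (inner ℝ f (WithLp.toLp 2 (Function.update x j 0))) / ‖f‖ ^ 2) := by
      intro x s
      have h1 : WithLp.toLp 2 (Function.update x j s) =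
          s • e + WithLp.toLp 2 (Function.update x j 0) := by
        ext i
        by_cases hi : i = j
        · subst hi; simp [he]
        · simp [he, hi]
      rw [h1, inner_add_right, inner_smul_right]
      have h2 : inner ℝ f e = ‖f‖ ^ 2 := by
        rw [he, EuclideanSpace.inner_single_right]; simp [hfj]
      rw [h2]
      field_simp
    have hproj : ∀ (x : ι → ℝ) (s : ℝ),
        W'.starProjection (WithLp.toLp 2 (Function.update x j s)) =
        W'.starProjection (WithLp.toLp 2 x) := by
      intro x s
      have h1 : WithLp.toLp 2 (Function.update x j s) = (s - x j) • e + WithLp.toLp 2 x := by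
        ext i
        by_cases hi : i = j
        · subst hi; simp [he]
        · simp [he, hi]
      have h2 : W'.starProjection e = 0 := by
        rw [Submodule.starProjection_apply_eq_zero_iff, Submodule.mem_orthogonal]
        intro w hw
        rw [he, EuclideanSpace.inner_single_right]
        simp [hW'j w hw]
      rw [h1, map_add, map_smul, h2]
      simp
    set G : (ι → ℝ) → ENNReal := fun z =>
      ENNReal.ofReal (Real.exp (-(θ / a * ‖W'.starProjection (WithLp.toLp 2 z)‖ ^ 2))) with hG
    have hGm : Measurable G := by
      refine ENNReal.measurable_ofReal.comp (Continuous.measurable ?_)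
      fun_prop
    have hkey : ∀ z : ι → ℝ,
        ENNReal.ofReal (Real.exp (-(θ / a * ‖W.starProjection (WithLp.toLp 2 z)‖ ^ 2))) ≤
        G z * ENNReal.ofReal (Real.exp (-(θ *
          (z j + (inner ℝ f (WithLp.toLp 2 (Function.update z j 0))) / ‖f‖ ^ 2) ^ 2))) := by
      intro z
      rw [hG, ← ENNReal.ofReal_mul (by positivity), ← Real.exp_add]
      refine ENNReal.ofReal_le_ofReal (Real.exp_le_exp.2 ?_)
      have h1 := sq_norm_starProjection_ge W W' inf_le_left f hfW
        (fun w hw => Submodule.mem_orthogonal_singleton_iff_inner_right.1 hw.2) hf0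
        (WithLp.toLp 2 z)
      have h2 := hcoord z (z j)
      rw [Function.update_eq_self] at h2
      set v := z j + (inner ℝ f (WithLp.toLp 2 (Function.update z j 0))) / ‖f‖ ^ 2
      rw [h2] at h1
      have h3 : (‖f‖ ^ 2 * v) ^ 2 / ‖f‖ ^ 2 = ‖f‖ ^ 2 * v ^ 2 := by field_simp
      rw [h3] at h1
      have h4 : a * v ^ 2 ≤ ‖f‖ ^ 2 * v ^ 2 := by gcongr
      have h5 : θ / a * (a * v ^ 2 + ‖W'.starProjection (WithLp.toLp 2 z)‖ ^ 2) ≤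
          θ / a * ‖W.starProjection (WithLp.toLp 2 z)‖ ^ 2 := by
        refine mul_le_mul_of_nonneg_left (by linarith) (by positivity)
      have h6 : θ / a * (a * v ^ 2) = θ * v ^ 2 := by field_simp
      nlinarith
    calc _ ≤ ∫⁻ z, G z * ENNReal.ofReal (Real.exp (-(θ *
          (z j + (inner ℝ f (WithLp.toLp 2 (Function.update z j 0))) / ‖f‖ ^ 2) ^ 2)))
          ∂(Measure.pi μ) := lintegral_mono hkey
      _ ≤ ∫⁻ z, G z * q ∂(Measure.pi μ) := by
          -- Fubini in the coordinate j alone: `G` and the shift do not depend on it.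
          refine lintegral_le_of_lmarginal_le {j} ?_ (hGm.mul_const _) ?_
          · refine hGm.mul (ENNReal.measurable_ofReal.comp (Continuous.measurable ?_))
            have : Continuous fun z : ι → ℝ => Function.update z j (0 : ℝ) :=
              continuous_id.update j continuous_const
            fun_prop
          · rw [lmarginal_singleton, lmarginal_singleton]
            intro x
            have hGu : ∀ s, G (Function.update x j s) = G x := by
              intro s; simp only [hG, hproj]
            simp only [hGu, Function.update_self, Function.update_idem, lintegral_const,
              measure_univ, mul_one]
            rw [lintegral_const_mul _ (by fun_prop)]
            gcongr
            exact hq j _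
      _ = (∫⁻ z, G z ∂(Measure.pi μ)) * q := lintegral_mul_const _ hGm
      _ ≤ q ^ t * q := by gcongr; exact ih W' hrank
      _ = q ^ (t + 1) := (pow_succ q t).symm

end ProjectionSmallBall

/-! ### Characteristic functions of sparse laws -/

section CharacteristicFunctions

/-- The function exp(-v(x+u)²/2) is the characteristic function of N(0, v) at x + u. After Fubini
the shift u is a phase of modulus one, so the bound is uniform in u. -/
theorem lintegral_exp_neg_sq_le_charFun (ρ : Measure ℝ) [IsProbabilityMeasure ρ] (v : NNReal)
    (u : ℝ) :
    ∫⁻ x, ENNReal.ofReal (Real.exp (-(v / 2 * (x + u) ^ 2))) ∂ρ ≤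
      ∫⁻ g, ENNReal.ofReal ‖charFun ρ g‖ ∂(gaussianReal 0 v) := by
  have hint : Integrable (fun x => Real.exp (-(v / 2 * (x + u) ^ 2))) ρ := by
    refine Integrable.of_bound (C := 1) (by fun_prop) (ae_of_all _ fun x => ?_)
    rw [Real.norm_eq_abs, abs_of_pos (Real.exp_pos _), Real.exp_le_one_iff]
    have : 0 ≤ (v : ℝ) / 2 * (x + u) ^ 2 := by positivity
    linarith
  have hint2 : Integrable (fun g => ‖charFun ρ g‖) (gaussianReal 0 v) := by
    refine Integrable.of_bound (C := 1) measurable_charFun.norm.aestronglyMeasurable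
      (ae_of_all _ fun x => ?_)
    rw [norm_norm]
    exact norm_charFun_le_one _
  rw [← ofReal_integral_eq_lintegral_ofReal hint (ae_of_all _ fun x => (Real.exp_pos _).le),
    ← ofReal_integral_eq_lintegral_ofReal hint2 (ae_of_all _ fun x => norm_nonneg _)]
  refine ENNReal.ofReal_le_ofReal ?_
  have h1 : ∀ x : ℝ, ((Real.exp (-(v / 2 * (x + u) ^ 2)) : ℝ) : ℂ) =
      ∫ g, Complex.exp ((x + u : ℝ) * g * Complex.I) ∂(gaussianReal 0 v) := by
    intro x
    rw [← charFun_apply_real, charFun_gaussianReal, Complex.ofReal_exp]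
    congr 1
    push_cast
    ring
  have h2 : ((∫ x, Real.exp (-(v / 2 * (x + u) ^ 2)) ∂ρ : ℝ) : ℂ) =
      ∫ g, Complex.exp (u * g * Complex.I) * charFun ρ g ∂(gaussianReal 0 v) := by
    rw [← integral_complex_ofReal]
    simp_rw [h1]
    rw [integral_integral_swap]
    · refine integral_congr_ae (ae_of_all _ fun g => ?_)
      simp only
      rw [charFun_apply_real, ← integral_const_mul]
      refine integral_congr_ae (ae_of_all _ fun x => ?_)
      simp only
      rw [← Complex.exp_add]
      congr 1
      push_cast
      ring
    · refine Integrable.of_bound (C := 1)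
        (Continuous.aestronglyMeasurable (by simp only [Function.uncurry_def]; fun_prop))
        (ae_of_all _ fun z => ?_)
      simp only [Function.uncurry_def]
      rw [← Complex.ofReal_mul, Complex.norm_exp_ofReal_mul_I]
  have h3 : ‖((∫ x, Real.exp (-(v / 2 * (x + u) ^ 2)) ∂ρ : ℝ) : ℂ)‖ ≤
      ∫ g, ‖charFun ρ g‖ ∂(gaussianReal 0 v) := by
    rw [h2]
    refine (norm_integral_le_integral_norm _).trans (le_of_eq ?_)
    refine integral_congr_ae (ae_of_all _ fun g => ?_)
    simp only
    rw [norm_mul, ← Complex.ofReal_mul, Complex.norm_exp_ofReal_mul_I, one_mul]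
  rw [Complex.norm_real] at h3
  exact (le_abs_self _).trans h3

theorem cos_le_one_sub_add_pow (x : ℝ) : Real.cos x ≤ 1 - x ^ 2 / 2 + x ^ 4 := by
  rcases le_or_gt |x| 1 with h | h
  · have h1 := (abs_le.1 (Real.cos_bound h)).2
    have h2 : |x| ^ 4 = x ^ 4 := by
      rw [show (4 : ℕ) = 2 * 2 by norm_num, pow_mul, pow_mul, sq_abs]
    rw [h2] at h1
    have : 0 ≤ x ^ 4 := by positivity
    linarith
  · have h1 : 1 < x ^ 2 := by
      rw [← sq_abs]; nlinarith
    nlinarith [Real.cos_le_one x]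

/-- |φ|² is the characteristic function of the difference of two independent copies, hence an
integral of cosines. -/
theorem sq_norm_charFun_eq (ν : Measure ℝ) [IsProbabilityMeasure ν] (t : ℝ) :
    ‖charFun ν t‖ ^ 2 = ∫ z : ℝ × ℝ, Real.cos (t * (z.1 - z.2)) ∂(ν.prod ν) := by
  have hi : Integrable (fun x : ℝ => Complex.exp (t * x * Complex.I)) ν := by
    refine Integrable.of_bound (C := 1) (by fun_prop) (ae_of_all _ fun x => ?_)
    rw [← Complex.ofReal_mul, Complex.norm_exp_ofReal_mul_I]
  have h1 : (charFun ν t).re = ∫ x, Real.cos (t * x) ∂ν := by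
    rw [charFun_apply_real]
    have := integral_re hi
    simp only [RCLike.re_eq_complex_re] at this
    rw [← this]
    refine integral_congr_ae (ae_of_all _ fun x => ?_)
    simp only
    rw [← Complex.ofReal_mul, Complex.exp_ofReal_mul_I_re]
  have h2 : (charFun ν t).im = ∫ x, Real.sin (t * x) ∂ν := by
    rw [charFun_apply_real]
    have := integral_im hi
    simp only [RCLike.im_eq_complex_im] at this
    rw [← this]
    refine integral_congr_ae (ae_of_all _ fun x => ?_)
    simp only
    rw [← Complex.ofReal_mul, Complex.exp_ofReal_mul_I_im]
  rw [← Complex.normSq_eq_norm_sq, Complex.normSq_apply, h1, h2, ← integral_prod_mul,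
    ← integral_prod_mul, ← integral_add]
  · refine integral_congr_ae (ae_of_all _ fun z => ?_)
    simp only
    rw [mul_sub, Real.cos_sub]
  · refine Integrable.of_bound (C := 1) (by fun_prop) (ae_of_all _ fun x => ?_)
    rw [norm_mul]
    exact mul_le_one₀ (Real.abs_cos_le_one _) (abs_nonneg _) (Real.abs_cos_le_one _)
  · refine Integrable.of_bound (C := 1) (by fun_prop) (ae_of_all _ fun x => ?_)
    rw [norm_mul]
    exact mul_le_one₀ (Real.abs_sin_le_one _) (abs_nonneg _) (Real.abs_sin_le_one _)

/-- The law of an entry of a sparse matrix with sparsity `p`, truncated at `b` and nearly centred: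
`M` bounds the normalized fourth moment and `N` is the size of the matrix. -/
structure SparseLaw (ν : Measure ℝ) (N p b M : ℝ) : Prop where
  abs_le : ∀ᵐ u ∂ν, |u| ≤ b
  measure_ne_zero : ν.real {u | u ≠ 0} ≤ 2 * p
  sq_mean_le : (∫ u, u ∂ν) ^ 2 * N ≤ p
  le_variance : p / 2 ≤ ∫ u, u ^ 2 ∂ν - (∫ u, u ∂ν) ^ 2
  second_moment_le : ∫ u, u ^ 2 ∂ν ≤ 2 * p
  fourth_moment_le : ∫ u, u ^ 4 ∂ν ≤ M * p

theorem SparseLaw.integrable_pow {ν : Measure ℝ} [IsProbabilityMeasure ν] {N p b M : ℝ}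
    (h : SparseLaw ν N p b M) (m : ℕ) : Integrable (fun u => u ^ m) ν := by
  refine Integrable.of_bound (C := b ^ m) (by fun_prop) ?_
  filter_upwards [h.abs_le] with u hu
  rw [norm_pow]
  gcongr
  exact hu

/-- After symmetrization the quadratic term is t² times the variance, which is at least p/2. The
restriction on t lets the quartic term, at most 16Mpt⁴, absorb only half of it. -/
theorem norm_charFun_le {ν : Measure ℝ} [IsProbabilityMeasure ν] {N p b M : ℝ}
    (h : SparseLaw ν N p b M) (hp : 0 ≤ p) {t : ℝ} (ht : 64 * M * t ^ 2 ≤ 1) :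
    ‖charFun ν t‖ ≤ Real.exp (-(p * t ^ 2 / 8)) := by
  have i1 : Integrable (fun u : ℝ => u) ν := by simpa using h.integrable_pow 1
  have i2 := h.integrable_pow 2
  have i4 := h.integrable_pow 4
  have k2 : Integrable (fun z : ℝ × ℝ => z.1 ^ 2 + z.2 ^ 2) (ν.prod ν) :=
    (i2.comp_fst ν).add (i2.comp_snd ν)
  have j2 : Integrable (fun z : ℝ × ℝ => z.1 ^ 2 + z.2 ^ 2 - 2 * (z.1 * z.2)) (ν.prod ν) :=
    (((i2.comp_fst ν).add (i2.comp_snd ν)).sub ((i1.mul_prod i1).const_mul 2))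
  have j4 : Integrable (fun z : ℝ × ℝ => 8 * (z.1 ^ 4 + z.2 ^ 4)) (ν.prod ν) :=
    ((i4.comp_fst ν).add (i4.comp_snd ν)).const_mul 8
  have e2 : ∫ z : ℝ × ℝ, (z.1 ^ 2 + z.2 ^ 2 - 2 * (z.1 * z.2)) ∂(ν.prod ν) =
      2 * (∫ u, u ^ 2 ∂ν - (∫ u, u ∂ν) ^ 2) := by
    rw [integral_sub k2 ((i1.mul_prod i1).const_mul 2),
      integral_add (i2.comp_fst ν) (i2.comp_snd ν), integral_const_mul,
      integral_prod_mul (fun u : ℝ => u) (fun u : ℝ => u),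
      integral_fun_fst (fun u : ℝ => u ^ 2), integral_fun_snd (fun u : ℝ => u ^ 2)]
    simp
    ring
  have e4 : ∫ z : ℝ × ℝ, 8 * (z.1 ^ 4 + z.2 ^ 4) ∂(ν.prod ν) = 16 * ∫ u, u ^ 4 ∂ν := by
    rw [integral_const_mul, integral_add (i4.comp_fst ν) (i4.comp_snd ν),
      integral_fun_fst (fun u : ℝ => u ^ 4), integral_fun_snd (fun u : ℝ => u ^ 4)]
    simp
    ring
  have l2 : Integrable (fun z : ℝ × ℝ =>
      1 - t ^ 2 / 2 * (z.1 ^ 2 + z.2 ^ 2 - 2 * (z.1 * z.2))) (ν.prod ν) :=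
    (integrable_const _).sub (j2.const_mul _)
  have h1 : ‖charFun ν t‖ ^ 2 ≤ 1 - p * t ^ 2 / 4 := by
    rw [sq_norm_charFun_eq]
    calc _ ≤ ∫ z : ℝ × ℝ, (1 - t ^ 2 / 2 * (z.1 ^ 2 + z.2 ^ 2 - 2 * (z.1 * z.2)) +
          t ^ 4 * (8 * (z.1 ^ 4 + z.2 ^ 4))) ∂(ν.prod ν) := by
          refine integral_mono ?_ ?_ fun z => ?_
          · refine Integrable.of_bound (C := 1) (by fun_prop) (ae_of_all _ fun x => ?_)
            exact Real.abs_cos_le_one _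
          · exact l2.add (j4.const_mul _)
          · refine (cos_le_one_sub_add_pow _).trans ?_
            have : (z.1 - z.2) ^ 4 ≤ 8 * (z.1 ^ 4 + z.2 ^ 4) := by
              nlinarith [sq_nonneg (z.1 ^ 2 - z.2 ^ 2), sq_nonneg ((z.1 + z.2) ^ 2),
                sq_nonneg (z.1 + z.2), sq_nonneg (z.1 * z.2), sq_nonneg (z.1 - z.2),
                mul_nonneg (sq_nonneg (z.1 + z.2)) (sq_nonneg (z.1 - z.2))]
            have h4 : (0 : ℝ) ≤ t ^ 4 := by positivity
            have := mul_le_mul_of_nonneg_left this h4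
            simp only [mul_pow]
            nlinarith
      _ = 1 - t ^ 2 / 2 * (2 * (∫ u, u ^ 2 ∂ν - (∫ u, u ∂ν) ^ 2)) +
          t ^ 4 * (16 * ∫ u, u ^ 4 ∂ν) := by
          rw [integral_add l2 (j4.const_mul _),
            integral_sub (integrable_const _) (j2.const_mul _), integral_const_mul,
            integral_const_mul, e2, e4]
          simp
      _ ≤ 1 - p * t ^ 2 / 4 := by
          have h4 := h.le_variance
          have h5 := h.fourth_moment_le
          have h6 : t ^ 4 * (16 * ∫ u, u ^ 4 ∂ν) ≤ t ^ 2 * p / 4 := by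
            calc t ^ 4 * (16 * ∫ u, u ^ 4 ∂ν) ≤ t ^ 4 * (16 * (M * p)) := by gcongr
              _ = (64 * M * t ^ 2) * (t ^ 2 * p / 4) := by ring
              _ ≤ 1 * (t ^ 2 * p / 4) := by gcongr
              _ = _ := by ring
          nlinarith [mul_le_mul_of_nonneg_left h4 (sq_nonneg t)]
  have h2 : ‖charFun ν t‖ ^ 2 ≤ Real.exp (-(p * t ^ 2 / 8)) ^ 2 := by
    rw [← Real.exp_nat_mul]
    refine h1.trans ?_
    have := Real.add_one_le_exp (-(p * t ^ 2 / 4))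
    refine le_trans (by linarith) (this.trans (Real.exp_le_exp.2 (le_of_eq ?_)))
    push_cast; ring
  exact le_of_sq_le_sq h2 (Real.exp_pos _).le

theorem measurableSet_sq_between (a b : ℝ) : MeasurableSet {g : ℝ | a ≤ g ^ 2 ∧ g ^ 2 ≤ b} := by
  have h1 : MeasurableSet {g : ℝ | a ≤ g ^ 2} := measurableSet_le measurable_const (by fun_prop)
  have h2 : MeasurableSet {g : ℝ | g ^ 2 ≤ b} := measurableSet_le (by fun_prop) measurable_const
  exact h1.inter h2

/-- The mass is independent of v by scaling, so c is its value for v = 1. -/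
theorem exists_gaussian_mass :
    ∃ c : ℝ, 0 < c ∧ ∀ v : NNReal, v ≠ 0 →
      c ≤ (gaussianReal 0 v).real {g | v / 4 ≤ g ^ 2 ∧ g ^ 2 ≤ 4 * v} := by
  set S : Set ℝ := {g | 1 / 4 ≤ g ^ 2 ∧ g ^ 2 ≤ 4} with hS
  refine ⟨(gaussianReal 0 1).real S, ?_, fun v hv => le_of_eq ?_⟩
  · rw [measureReal_def, ENNReal.toReal_pos_iff]
    refine ⟨pos_iff_ne_zero.2 fun h0 => ?_, measure_lt_top _ _⟩
    have h1 := gaussianReal_absolutelyContinuous' 0 one_ne_zero h0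
    have h2 : Set.Icc (1 : ℝ) 2 ⊆ S := by
      intro x hx
      constructor <;> nlinarith [hx.1, hx.2]
    have h3 := measure_mono_null h2 h1
    rw [Real.volume_Icc] at h3
    norm_num at h3
  · have h1 : gaussianReal 0 v = (gaussianReal 0 1).map (fun x => √(v : ℝ) * x) := by
      rw [gaussianReal_map_const_mul]
      congr 1
      · simp
      · ext; simp
    rw [h1, map_measureReal_apply (by fun_prop)]
    · congr 1
      ext x
      have hv' : 0 < (v : ℝ) := by positivity
      simp only [hS, Set.mem_ofPred_eq, Set.mem_preimage, mul_pow, Real.sq_sqrt hv'.le]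
      rw [div_eq_mul_one_div (v : ℝ), mul_le_mul_iff_right₀ hv', mul_comm (4 : ℝ),
        mul_le_mul_iff_right₀ hv']
    · exact measurableSet_sq_between _ _

theorem integral_exp_neg_mul_sq_gaussianReal_le {v : NNReal} (hv : v ≠ 0) {s : ℝ} (hs : 0 < s) :
    ∫ g, Real.exp (-(s * g ^ 2)) ∂(gaussianReal 0 v) ≤ 1 / √(2 * s * v) := by
  have hv' : 0 < (v : ℝ) := by positivity
  rw [integral_gaussianReal_eq_integral_smul hv]
  calc _ ≤ ∫ g, (√(2 * Real.pi * v))⁻¹ * Real.exp (-s * g ^ 2) := by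
        refine integral_mono_of_nonneg (ae_of_all _ fun g => ?_) ?_ (ae_of_all _ fun g => ?_)
        · exact smul_nonneg (gaussianPDFReal_nonneg _ _ _) (Real.exp_pos _).le
        · exact (integrable_exp_neg_mul_sq hs).const_mul _
        · simp only [smul_eq_mul]
          rw [← neg_mul]
          refine mul_le_mul_of_nonneg_right ?_ (Real.exp_pos _).le
          rw [gaussianPDFReal]
          refine mul_le_of_le_one_right (by positivity) ?_
          rw [Real.exp_le_one_iff]
          have : 0 ≤ (g - 0) ^ 2 / (2 * v) := by positivity
          rw [neg_div]
          linarith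
    _ = _ := by
        rw [integral_const_mul, integral_gaussian, ← Real.sqrt_inv, ← Real.sqrt_mul (by positivity),
          one_div, ← Real.sqrt_inv]
        congr 1
        have := Real.pi_pos
        field_simp

theorem gaussianReal_real_sq_gt_le (v : NNReal) {s : ℝ} (hs : 0 < s) :
    (gaussianReal 0 v).real {g | s ≤ g ^ 2} ≤ v / s := by
  have h1 : ∫ g, g ^ 2 ∂(gaussianReal 0 v) = v := by
    have := variance_id_gaussianReal (μ := 0) (v := v)
    rw [variance_of_integral_eq_zero (by fun_prop) (by simp)] at this
    simpa using this
  have h2 : Integrable (fun g : ℝ => g ^ 2) (gaussianReal 0 v) :=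
    (memLp_id_gaussianReal 2).integrable_sq
  have h3 := mul_meas_ge_le_integral_of_nonneg (ae_of_all _ fun g => sq_nonneg g) h2 s
  rw [h1] at h3
  rw [le_div_iff₀ hs, mul_comm]
  exact h3

end CharacteristicFunctions

/-! ### The Laplace transform of a single row -/

section RowSmallBall

variable {κ : Type*} [Fintype κ]

theorem norm_charFun_map_sum_le {ν : κ → Measure ℝ} [∀ k, IsProbabilityMeasure (ν k)]
    {N p b M : ℝ} (h : ∀ k, SparseLaw (ν k) N p b M) (hp : 0 ≤ p) {z : κ → ℝ} {g : ℝ}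
    (hg : ∀ k, 64 * M * (z k ^ 2 * g ^ 2) ≤ 1) :
    ‖charFun ((Measure.pi ν).map fun x => ∑ k, x k * z k) g‖ ≤
      Real.exp (-(p * (∑ k, z k ^ 2) / 8 * g ^ 2)) := by
  have h1 : charFun ((Measure.pi ν).map fun x => ∑ k, x k * z k) g =
      ∏ k, charFun (ν k) (z k * g) := by
    have hind : iIndepFun (fun k (x : κ → ℝ) => z k * x k) (Measure.pi ν) :=
      iIndepFun_pi (X := fun k (x : ℝ) => z k * x)
        (fun k => (measurable_const_mul (z k)).aemeasurable)
    have := iIndepFun.charFun_map_fun_sum_eq_prod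
      (fun k => ((measurable_pi_apply k).const_mul (z k)).aemeasurable) hind
    have h2 : (fun x : κ → ℝ => ∑ k, x k * z k) = fun x => ∑ k, z k * x k := by
      ext x; exact Finset.sum_congr rfl fun k _ => mul_comm _ _
    rw [h2, this, Finset.prod_apply]
    refine Finset.prod_congr rfl fun k _ => ?_
    have h3 : (Measure.pi ν).map (fun x => z k * x k) = (ν k).map (fun x => z k * x) := by
      have h4 := (measurePreserving_eval ν k).map_eq
      rw [← h4, Measure.map_map (measurable_const_mul (z k)) (measurable_pi_apply k)]
      rfl
    rw [h3, charFun_map_mul]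
  rw [h1, norm_prod]
  calc _ ≤ ∏ k, Real.exp (-(p * (z k * g) ^ 2 / 8)) := by
        refine Finset.prod_le_prod (fun k _ => norm_nonneg _) fun k _ => ?_
        refine norm_charFun_le (h k) hp ?_
        have := hg k
        rw [mul_pow]
        exact this
    _ = _ := by
        rw [← Real.exp_sum]
        congr 1
        rw [Finset.sum_neg_distrib, Finset.mul_sum, Finset.sum_div, Finset.sum_mul]
        congr 1
        refine Finset.sum_congr rfl fun k _ => ?_
        ring

instance isProbabilityMeasure_map_sum {ν : κ → Measure ℝ} [∀ k, IsProbabilityMeasure (ν k)]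
    (z : κ → ℝ) : IsProbabilityMeasure ((Measure.pi ν).map fun x => ∑ k, x k * z k) :=
  Measure.isProbabilityMeasure_map (Measurable.aemeasurable (by fun_prop))

/-- For small v only a gap below 1 can be expected. It comes from the frequencies with v/4 ≤ g² ≤
4v, whose Gaussian mass is bounded below; elsewhere |φ| ≤ 1 is used. -/
theorem exists_lintegral_exp_neg_sq_sum_le :
    ∃ c : ℝ, 0 < c ∧ ∀ {κ : Type*} [Fintype κ] {ν : κ → Measure ℝ}
      [∀ k, IsProbabilityMeasure (ν k)] {N p b M : ℝ}, (∀ k, SparseLaw (ν k) N p b M) →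
      0 ≤ p → 0 ≤ M → ∀ {z : κ → ℝ} {v : NNReal}, v ≠ 0 → p * (∑ k, z k ^ 2) * v ≤ 1 →
      (∀ k, 256 * M * z k ^ 2 * v ≤ 1) → ∀ u : ℝ,
      ∫⁻ x, ENNReal.ofReal (Real.exp (-(v / 2 * (x + u) ^ 2)))
        ∂((Measure.pi ν).map fun x => ∑ k, x k * z k) ≤
      ENNReal.ofReal (1 - c * (p * (∑ k, z k ^ 2) * v)) := by
  obtain ⟨c, hc, hmass⟩ := exists_gaussian_mass
  refine ⟨c / 64, by positivity, ?_⟩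
  intro κ _ ν _ N p b M h hp hM z v hv hpv hz u
  refine (lintegral_exp_neg_sq_le_charFun _ v u).trans ?_
  set ρ := (Measure.pi ν).map fun x => ∑ k, x k * z k
  set s := p * (∑ k, z k ^ 2) with hs
  have hs0 : 0 ≤ s := mul_nonneg hp (Finset.sum_nonneg fun k _ => sq_nonneg _)
  set S : Set ℝ := {g | v / 4 ≤ g ^ 2 ∧ g ^ 2 ≤ 4 * v} with hS
  have hSm : MeasurableSet S := measurableSet_sq_between _ _
  have hv' : 0 < (v : ℝ) := by positivity
  have hbound : ∀ g, ‖charFun ρ g‖ ≤ 1 - S.indicator (fun _ => s * v / 64) g := by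
    intro g
    by_cases hg : g ∈ S
    · rw [Set.indicator_of_mem hg]
      refine (norm_charFun_map_sum_le h hp fun k => ?_).trans ?_
      · calc 64 * M * (z k ^ 2 * g ^ 2) ≤ 64 * M * (z k ^ 2 * (4 * v)) := by
              gcongr
              exact hg.2
          _ = 256 * M * z k ^ 2 * v := by ring
          _ ≤ 1 := hz k
      · have h1 : s * v / 32 ≤ s / 8 * g ^ 2 := by
          have := mul_le_mul_of_nonneg_left hg.1 (by positivity : 0 ≤ s / 8)
          linarith
        have h2 : Real.exp (-(s / 8 * g ^ 2)) ≤ Real.exp (-(s * v / 32)) :=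
          Real.exp_le_exp.2 (by linarith)
        have h3 : Real.exp (-(s * v / 32)) ≤ 1 - s * v / 64 := by
          set x := s * v / 32 with hx
          have hx0 : 0 ≤ x := by positivity
          have hx1 : x ≤ 1 / 2 := by linarith
          have := Real.abs_exp_sub_one_sub_id_le (x := -x)
            (by rw [abs_neg, abs_of_nonneg hx0]; linarith)
          have h4 := (abs_le.1 this).2
          have h5 : s * v / 64 = x / 2 := by rw [hx]; ring
          rw [h5]
          nlinarith
        exact h2.trans h3
    · rw [Set.indicator_of_notMem hg, sub_zero]
      exact norm_charFun_le_one _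
  have hi1 : Integrable (fun g => ‖charFun ρ g‖) (gaussianReal 0 v) := by
    refine Integrable.of_bound (C := 1) measurable_charFun.norm.aestronglyMeasurable
      (ae_of_all _ fun x => ?_)
    rw [norm_norm]
    exact norm_charFun_le_one _
  rw [← ofReal_integral_eq_lintegral_ofReal hi1 (ae_of_all _ fun x => norm_nonneg _)]
  refine ENNReal.ofReal_le_ofReal ?_
  have hi2 : Integrable (S.indicator (fun _ => s * v / 64)) (gaussianReal 0 v) :=
    (integrable_const _).indicator hSm
  calc _ ≤ ∫ g, (1 - S.indicator (fun _ => s * v / 64) g) ∂(gaussianReal 0 v) :=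
        integral_mono hi1 ((integrable_const _).sub hi2) hbound
    _ = 1 - (gaussianReal 0 v).real S * (s * v / 64) := by
        rw [integral_sub (integrable_const _) hi2, integral_indicator_const _ hSm]
        simp
    _ ≤ 1 - c / 64 * (s * v) := by
        have := mul_le_mul_of_nonneg_right (hmass v hv) (by positivity : 0 ≤ s * v / 64)
        linarith

/-- For large v the transform itself is small. The first term is the Gaussian integral of the decay
of φ; the second bounds, by Chebyshev, the mass of the frequencies g² ≥ 1/(64Mζ), where the decay is
not known. -/
theorem lintegral_exp_neg_sq_sum_le {ν : κ → Measure ℝ}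
    [∀ k, IsProbabilityMeasure (ν k)] {N p b M : ℝ} (h : ∀ k, SparseLaw (ν k) N p b M)
    (hp : 0 < p) (hM : 0 < M) {z : κ → ℝ} {v : NNReal} (hv : v ≠ 0) (hz : 0 < ∑ k, z k ^ 2)
    {ζ : ℝ} (hζ0 : 0 < ζ) (hζ : ∀ k, z k ^ 2 ≤ ζ) (u : ℝ) :
    ∫⁻ x, ENNReal.ofReal (Real.exp (-(v / 2 * (x + u) ^ 2)))
      ∂((Measure.pi ν).map fun x => ∑ k, x k * z k) ≤
    ENNReal.ofReal (2 / √(p * (∑ k, z k ^ 2) * v) + 64 * M * ζ * v) := by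
  refine (lintegral_exp_neg_sq_le_charFun _ v u).trans ?_
  set ρ := (Measure.pi ν).map fun x => ∑ k, x k * z k
  set s := p * (∑ k, z k ^ 2) with hs
  have hs0 : 0 < s := mul_pos hp hz
  have hv' : 0 < (v : ℝ) := by positivity
  set s₀ := 1 / (64 * M * ζ) with hs₀
  have hs₀' : 0 < s₀ := by positivity
  set S : Set ℝ := {g | s₀ ≤ g ^ 2} with hS
  have hSm : MeasurableSet S := measurableSet_le measurable_const (by fun_prop)
  have hbound : ∀ g, ‖charFun ρ g‖ ≤ Real.exp (-(s / 8 * g ^ 2)) + S.indicator (fun _ => 1) g := by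
    intro g
    by_cases hg : g ∈ S
    · rw [Set.indicator_of_mem hg]
      have := norm_charFun_le_one (μ := ρ) g
      have := Real.exp_pos (-(s / 8 * g ^ 2))
      linarith
    · rw [Set.indicator_of_notMem hg, add_zero]
      refine norm_charFun_map_sum_le h hp.le fun k => ?_
      have h1 : g ^ 2 ≤ s₀ := (not_le.1 hg).le
      calc 64 * M * (z k ^ 2 * g ^ 2) ≤ 64 * M * (ζ * s₀) := by
            gcongr
            exact hζ k
        _ = 1 := by rw [hs₀]; field_simp
  have hi1 : Integrable (fun g => ‖charFun ρ g‖) (gaussianReal 0 v) := by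
    refine Integrable.of_bound (C := 1) measurable_charFun.norm.aestronglyMeasurable
      (ae_of_all _ fun x => ?_)
    rw [norm_norm]
    exact norm_charFun_le_one _
  have hi3 : Integrable (fun g => Real.exp (-(s / 8 * g ^ 2))) (gaussianReal 0 v) := by
    refine Integrable.of_bound (C := 1) (by fun_prop) (ae_of_all _ fun x => ?_)
    rw [Real.norm_eq_abs, abs_of_pos (Real.exp_pos _), Real.exp_le_one_iff]
    have : 0 ≤ s / 8 * x ^ 2 := by positivity
    linarith
  rw [← ofReal_integral_eq_lintegral_ofReal hi1 (ae_of_all _ fun x => norm_nonneg _)]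
  refine ENNReal.ofReal_le_ofReal ?_
  have hi2 : Integrable (S.indicator (fun _ => (1 : ℝ))) (gaussianReal 0 v) :=
    (integrable_const _).indicator hSm
  calc _ ≤ ∫ g, (Real.exp (-(s / 8 * g ^ 2)) + S.indicator (fun _ => 1) g) ∂(gaussianReal 0 v) :=
        integral_mono hi1 (hi3.add hi2) hbound
    _ = ∫ g, Real.exp (-(s / 8 * g ^ 2)) ∂(gaussianReal 0 v) + (gaussianReal 0 v).real S := by
        rw [integral_add hi3 hi2, integral_indicator_const _ hSm]
        simp
    _ ≤ 1 / √(2 * (s / 8) * v) + v / s₀ :=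
        add_le_add (integral_exp_neg_mul_sq_gaussianReal_le hv (by positivity))
          (gaussianReal_real_sq_gt_le v hs₀')
    _ = 2 / √(s * v) + 64 * M * ζ * v := by
        congr 1
        · have : 2 * (s / 8) * v = s * v / 2 ^ 2 := by ring
          rw [this, Real.sqrt_div (by positivity), Real.sqrt_sq (by norm_num)]
          field_simp
        · rw [hs₀]; field_simp

end RowSmallBall

/-! ### Small ball estimate for the image of a partly prescribed vector -/

section MatrixSmallBall

variable {ι κ : Type*} [Fintype ι] [Fintype κ]

/-- The law of a matrix with independent entries, the `(j, k)` entry having the law `ν j k`. -/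
noncomputable def matMeasure (ν : ι → κ → Measure ℝ) : Measure (ι → κ → ℝ) :=
  Measure.pi fun j => Measure.pi fun k => ν j k

instance (ν : ι → κ → Measure ℝ) [∀ j k, IsProbabilityMeasure (ν j k)] :
    IsProbabilityMeasure (matMeasure ν) := by
  unfold matMeasure; infer_instance

theorem measurePreserving_splitColumns (ν : ι → κ → Measure ℝ)
    [∀ j k, IsProbabilityMeasure (ν j k)] (s : κ → Prop) [DecidablePred s] :
    MeasurePreserving (fun A : ι → κ → ℝ =>
      ((fun j (k : {k // s k}) => A j k, fun j (k : {k // ¬ s k}) => A j k) :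
        (ι → {k // s k} → ℝ) × (ι → {k // ¬ s k} → ℝ))) (matMeasure ν)
      ((matMeasure fun j (k : {k // s k}) => ν j k).prod
        (matMeasure fun j (k : {k // ¬ s k}) => ν j k)) := by
  have h1 := measurePreserving_pi (fun j => Measure.pi fun k => ν j k) _
    (fun j => measurePreserving_piEquivPiSubtypeProd (fun k => ν j k) s)
  have h2 := measurePreserving_arrowProdEquivProdArrow ({k // s k} → ℝ) ({k // ¬ s k} → ℝ) ι
    (fun j => Measure.pi fun k : {k // s k} => ν j k)
    (fun j => Measure.pi fun k : {k // ¬ s k} => ν j k)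
  exact h2.comp h1

/-- Freeze the columns outside s and let V be their span. Whatever y is, the image is at least as
long as the projection to Vᗮ of the combination of the columns in s, so the union over y costs
nothing beyond the dimension of V. Exponential Markov then applies to the projected vector. The
values of y are rational so that the event is a countable union and Fubini is available. -/
theorem matMeasure_dist_lt_le [DecidableEq ι] {ν : ι → κ → Measure ℝ}
    [∀ j k, IsProbabilityMeasure (ν j k)] {θ a T : ℝ} (ha : 0 < a) (hθ : 0 ≤ θ) {q : ENNReal}
    (s : κ → Prop) [DecidablePred s] (z : κ → ℝ)
    (hq : ∀ j u, ∫⁻ x, ENNReal.ofReal (Real.exp (-(θ * (x + u) ^ 2)))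
      ∂((Measure.pi fun k : {k // s k} => ν j k).map
        fun x => ∑ k : {k // s k}, x k * z k) ≤ q) (t : ℕ)
    (ht : t + a * Fintype.card ι + Fintype.card {k // ¬ s k} ≤ Fintype.card ι) :
    matMeasure ν {A | ∃ y : κ → ℚ, ∑ j, (∑ k, A j k * (if s k then z k else y k)) ^ 2 < T} ≤
      ENNReal.ofReal (Real.exp (θ / a * T)) * q ^ t := by
  set S : Set ((ι → {k // s k} → ℝ) × (ι → {k // ¬ s k} → ℝ)) :=
    {B | ∃ y : {k // ¬ s k} → ℚ,
      ∑ j, (∑ k : {k // s k}, B.1 j k * z k + ∑ k : {k // ¬ s k}, B.2 j k * (y k : ℝ)) ^ 2 < T} with hS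
  have hSm : MeasurableSet S := by
    have : S = ⋃ y : {k // ¬ s k} → ℚ,
        {B | ∑ j, (∑ k : {k // s k}, B.1 j k * z k + ∑ k : {k // ¬ s k}, B.2 j k * (y k : ℝ)) ^ 2 < T} := by
      ext B; simp [hS]
    rw [this]
    refine MeasurableSet.iUnion fun y => measurableSet_lt ?_ measurable_const
    fun_prop
  have hsub : {A : ι → κ → ℝ | ∃ y : κ → ℚ,
      ∑ j, (∑ k, A j k * (if s k then z k else y k)) ^ 2 < T} ⊆
      (fun A : ι → κ → ℝ => ((fun j (k : {k // s k}) => A j k,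
        fun j (k : {k // ¬ s k}) => A j k) :
        (ι → {k // s k} → ℝ) × (ι → {k // ¬ s k} → ℝ))) ⁻¹' S := by
    rintro A ⟨y, hy⟩
    refine ⟨fun k => y k, ?_⟩
    convert hy using 4 with j
    rw [← Fintype.sum_subtype_add_sum_subtype s
      (fun k => A j k * (if s k then z k else (y k : ℝ)))]
    congr 1
    · refine Finset.sum_congr rfl fun k _ => ?_
      simp [k.2]
    · refine Finset.sum_congr rfl fun k _ => ?_
      simp [k.2]
  refine (measure_mono hsub).trans ?_
  rw [(measurePreserving_splitColumns ν s).measure_preimage hSm.nullMeasurableSet,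
    Measure.prod_apply_symm hSm]
  set μ₁ := matMeasure fun j (k : {k // s k}) => ν j k
  have hB : ∀ B : ι → {k // ¬ s k} → ℝ, μ₁ ((fun x => (x, B)) ⁻¹' S) ≤
      ENNReal.ofReal (Real.exp (θ / a * T)) * q ^ t := by
    intro B
    set col : {k // ¬ s k} → EuclideanSpace ℝ ι := fun k => WithLp.toLp 2 fun j => B j k
    set V := Submodule.span ℝ (Set.range col)
    have hV : Module.finrank ℝ V ≤ Fintype.card {k // ¬ s k} := finrank_range_le_card col
    have hW : (t : ℝ) + a * Fintype.card ι ≤ Module.finrank ℝ Vᗮ := by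
      have h1 := Submodule.finrank_add_finrank_orthogonal V
      rw [finrank_euclideanSpace] at h1
      have h2 : (Module.finrank ℝ V : ℝ) + Module.finrank ℝ Vᗮ = Fintype.card ι := by
        exact_mod_cast h1
      have h3 : (Module.finrank ℝ V : ℝ) ≤ Fintype.card {k // ¬ s k} := by exact_mod_cast hV
      linarith
    set Z : (ι → {k // s k} → ℝ) → (ι → ℝ) := fun x j => ∑ k : {k // s k}, x j k * z k with hZ
    set F : (ι → ℝ) → ENNReal := fun w =>
      ENNReal.ofReal (Real.exp (-(θ / a * ‖Vᗮ.starProjection (WithLp.toLp 2 w)‖ ^ 2))) with hF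
    have hFm : Measurable F := by
      refine ENNReal.measurable_ofReal.comp (Continuous.measurable ?_)
      fun_prop
    have hZm : Measurable Z := by fun_prop
    have hmap : μ₁.map Z = Measure.pi fun j =>
        (Measure.pi fun k : {k // s k} => ν j k).map
          fun x => ∑ k : {k // s k}, x k * z k := by
      have : ∀ j, SigmaFinite ((Measure.pi fun k : {k // s k} => ν j k).map
          fun x => ∑ k : {k // s k}, x k * z k) := fun j => inferInstance
      exact Measure.pi_map_pi (f := fun _ (x : {k // s k} → ℝ) => ∑ k : {k // s k}, x k * z k)
        (fun j => Measurable.aemeasurable (by fun_prop))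
    have hAC := lintegral_exp_neg_sq_norm_starProjection_le ha hθ hq t Vᗮ hW
    rw [← hmap, lintegral_map hFm hZm] at hAC
    have hle : (fun x => (x, B)) ⁻¹' S ⊆
        {x | ENNReal.ofReal (Real.exp (-(θ / a * T))) ≤ F (Z x)} := by
      rintro x ⟨y, hy⟩
      refine ENNReal.ofReal_le_ofReal (Real.exp_le_exp.2 (neg_le_neg ?_))
      refine mul_le_mul_of_nonneg_left ?_ (by positivity)
      refine le_trans ?_ hy.le
      set w : EuclideanSpace ℝ ι := ∑ k, (y k : ℝ) • col k with hw
      have hwV : w ∈ V := Submodule.sum_mem _ fun k _ =>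
        Submodule.smul_mem _ _ (Submodule.subset_span ⟨k, rfl⟩)
      have h1 : Vᗮ.starProjection (WithLp.toLp 2 (Z x)) =
          Vᗮ.starProjection (WithLp.toLp 2 (Z x) + w) := by
        rw [map_add, (Submodule.starProjection_apply_eq_zero_iff _).2
          (Submodule.le_orthogonal_orthogonal V hwV), add_zero]
      rw [h1]
      have h2 : ‖Vᗮ.starProjection (WithLp.toLp 2 (Z x) + w)‖ ≤ ‖WithLp.toLp 2 (Z x) + w‖ :=
        Submodule.norm_starProjection_apply_le _ _
      refine (pow_le_pow_left₀ (norm_nonneg _) h2 2).trans ?_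
      rw [EuclideanSpace.norm_sq_eq]
      refine le_of_eq (Finset.sum_congr rfl fun j _ => ?_)
      rw [Real.norm_eq_abs, sq_abs]
      congr 1
      simp only [PiLp.add_apply, hZ, hw, col]
      congr 1
      rw [WithLp.ofLp_sum, Finset.sum_apply]
      refine Finset.sum_congr rfl fun k _ => ?_
      simp [mul_comm]
    have h3 := mul_meas_ge_le_lintegral₀ (μ := μ₁) (hFm.comp hZm).aemeasurable
      (ENNReal.ofReal (Real.exp (-(θ / a * T))))
    have h4 : ENNReal.ofReal (Real.exp (θ / a * T)) * ENNReal.ofReal (Real.exp (-(θ / a * T))) = 1 := by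
      rw [← ENNReal.ofReal_mul (Real.exp_pos _).le, ← Real.exp_add]
      simp
    calc μ₁ ((fun x => (x, B)) ⁻¹' S) ≤ μ₁ {x | ENNReal.ofReal (Real.exp (-(θ / a * T))) ≤ F (Z x)} :=
          measure_mono hle
      _ = ENNReal.ofReal (Real.exp (θ / a * T)) * (ENNReal.ofReal (Real.exp (-(θ / a * T))) *
          μ₁ {x | ENNReal.ofReal (Real.exp (-(θ / a * T))) ≤ F (Z x)}) := by
          rw [← mul_assoc, h4, one_mul]
      _ ≤ _ := by
          gcongr
          exact h3.trans hAC
  calc _ ≤ ∫⁻ B, ENNReal.ofReal (Real.exp (θ / a * T)) * q ^ t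
        ∂(matMeasure fun j (k : {k // ¬ s k}) => ν j k) := lintegral_mono hB
    _ = _ := by simp

end MatrixSmallBall

/-! ### Expansion of trace powers over walks -/

section Walks

open Matrix

variable {ι κ : Type*} [Fintype ι] [Fintype κ] [DecidableEq ι] [DecidableEq κ]

/-- The final vertex of the walk `j, l₁, j₁, …, l_k, j_k` in the complete bipartite graph. -/
def walkEnd : (k : ℕ) → ι → (Fin k → κ × ι) → ι
  | 0, j, _ => j
  | k + 1, _, s => walkEnd k (s 0).2 (Fin.tail s)

/-- How often the walk `j, l₁, j₁, …, l_k, j_k` uses the edge `(a, b)`. -/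
def walkExp : (k : ℕ) → ι → (Fin k → κ × ι) → ι → κ → ℕ
  | 0, _, _ => fun _ _ => 0
  | k + 1, j, s => fun a b => (if a = j ∧ b = (s 0).1 then 1 else 0) +
      (if a = (s 0).2 ∧ b = (s 0).1 then 1 else 0) + walkExp k (s 0).2 (Fin.tail s) a b

theorem prod_prod_pow_ite (A : Matrix ι κ ℝ) (j : ι) (l : κ) :
    ∏ a, ∏ b, A a b ^ (if a = j ∧ b = l then 1 else 0) = A j l := by
  rw [Finset.prod_eq_single j, Finset.prod_eq_single l]
  · simp
  · intro b _ hb; simp [hb]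
  · simp
  · intro a _ ha; simp [ha]
  · simp

/-- Each walk is recorded by its edge multiplicities, so that independence turns the expectation of
its weight into a product of moments of single entries. -/
theorem mul_transpose_pow_apply (A : Matrix ι κ ℝ) (k : ℕ) (j j' : ι) :
    ((A * Aᵀ) ^ k) j j' = ∑ s : Fin k → κ × ι,
      if walkEnd k j s = j' then ∏ a, ∏ b, A a b ^ walkExp k j s a b else 0 := by
  induction k generalizing j with
  | zero =>
    simp only [pow_zero, walkEnd, walkExp, Finset.prod_const_one]
    rw [Matrix.one_apply]
    simp
  | succ k ih =>
    rw [pow_succ', Matrix.mul_apply, ← (Fin.consEquiv fun _ : Fin (k + 1) => κ × ι).sum_comp,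
      Fintype.sum_prod_type, Fintype.sum_prod_type, Finset.sum_comm]
    refine Finset.sum_congr rfl fun j₁ _ => ?_
    rw [Matrix.mul_apply, Finset.sum_mul]
    refine Finset.sum_congr rfl fun l _ => ?_
    rw [ih, Finset.mul_sum]
    refine Finset.sum_congr rfl fun s _ => ?_
    simp only [Fin.consEquiv_apply, walkEnd, walkExp, Fin.cons_zero, mul_ite,
      mul_zero]
    congr 1
    simp only [pow_add, Finset.prod_mul_distrib, prod_prod_pow_ite, Matrix.transpose_apply]
    rfl

theorem sum_walkExp (k : ℕ) (j : ι) (s : Fin k → κ × ι) :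
    ∑ a, ∑ b, walkExp k j s a b = 2 * k := by
  induction k generalizing j with
  | zero => simp [walkExp]
  | succ k ih =>
    simp only [walkExp, Finset.sum_add_distrib, ih]
    have : ∀ (j : ι) (l : κ), ∑ a, ∑ b, (if a = j ∧ b = l then 1 else 0) = 1 := by
      intro j l
      rw [Finset.sum_eq_single j, Finset.sum_eq_single l]
      · simp
      · intro b _ hb; simp [hb]
      · simp
      · intro a _ ha; simp [ha]
      · simp
    rw [this, this]
    ring

/-- The edges of a walk form a connected graph, which has at most one more vertex than edges. In the
induction the edges (j, l) and (j₁, l) are put in front of a walk from j₁, and every new vertex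
comes with a new edge. -/
theorem exists_card_add_card_le_walk (k : ℕ) (j : ι) (s : Fin k → κ × ι) :
    ∃ (R : Finset ι) (C : Finset κ), j ∈ R ∧
      (∀ a b, walkExp k j s a b ≠ 0 → a ∈ R ∧ b ∈ C) ∧
      R.card + C.card ≤ (Finset.univ.filter fun e : ι × κ => walkExp k j s e.1 e.2 ≠ 0).card + 1 := by
  induction k generalizing j with
  | zero => exact ⟨{j}, ∅, by simp, by simp [walkExp], by simp⟩
  | succ k ih =>
    obtain ⟨R, C, hR, hE, hcard⟩ := ih (s 0).2 (Fin.tail s)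
    set j₁ := (s 0).2
    set l := (s 0).1
    set E := Finset.univ.filter fun e : ι × κ => walkExp k j₁ (Fin.tail s) e.1 e.2 ≠ 0 with hEdef
    have hE' : (Finset.univ.filter fun e : ι × κ => walkExp (k + 1) j s e.1 e.2 ≠ 0) =
        insert (j, l) (insert (j₁, l) E) := by
      ext ⟨a, b⟩
      rw [Finset.mem_filter_univ, Finset.mem_insert, Finset.mem_insert, hEdef,
        Finset.mem_filter_univ]
      simp only [walkExp, Prod.mk.injEq]
      split_ifs with h1 h2 h2 <;> simp_all [j₁, l] <;> tauto
    rw [hE']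
    refine ⟨insert j R, insert l C, Finset.mem_insert_self _ _, ?_, ?_⟩
    · intro a b hab
      have : (a, b) ∈ insert (j, l) (insert (j₁, l) E) := by
        rw [← hE']; simpa using hab
      simp only [Finset.mem_insert, Prod.mk.injEq] at this
      rcases this with ⟨rfl, rfl⟩ | ⟨rfl, rfl⟩ | h
      · simp
      · simp [hR]
      · have := hE a b (by simpa [hEdef] using h)
        simp [this.1, this.2]
    · have h1 : (insert l C).card ≤ C.card + ((insert (j₁, l) E).card - E.card) := by
        by_cases hl : l ∈ C
        · rw [Finset.insert_eq_of_mem hl]; omega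
        · rw [Finset.card_insert_of_notMem hl, Finset.card_insert_of_notMem]
          · omega
          · intro h
            exact hl (hE j₁ l (by simpa [hEdef] using h)).2
      have h2 : (insert j R).card ≤ R.card +
          ((insert (j, l) (insert (j₁, l) E)).card - (insert (j₁, l) E).card) := by
        by_cases hj : j ∈ R
        · rw [Finset.insert_eq_of_mem hj]; omega
        · rw [Finset.card_insert_of_notMem hj, Finset.card_insert_of_notMem]
          · omega
          · intro h
            rw [Finset.mem_insert] at h
            rcases h with h | h
            · have : j = j₁ := congrArg Prod.fst h
              exact hj (this ▸ hR)
            · exact hj (hE j l (by simpa [hEdef] using h)).1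
      have h3 : E.card ≤ (insert (j₁, l) E).card := Finset.card_le_card (Finset.subset_insert _ _)
      have h4 : (insert (j₁, l) E).card ≤ (insert (j, l) (insert (j₁, l) E)).card :=
        Finset.card_le_card (Finset.subset_insert _ _)
      omega

end Walks

/-! ### Comparison of moments with a masked sign matrix -/

section MomentComparison

open Matrix

variable {ι κ : Type*} [Fintype ι] [Fintype κ] [DecidableEq ι] [DecidableEq κ]

/-- The weight of a Bernoulli variable with mean `q`. -/
def bernWeight (q : ℝ) (c : Bool) : ℝ := if c then q else 1 - q

/-- A centred two-point variable: the value `2` has probability `1 / 3`, the value `-1` has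
probability `2 / 3`. -/
def skewValue (y : Bool) : ℝ := if y then 2 else -1

/-- The average over independent masks of the rows and columns, with parameter `q`, and over
independent centred two-point signs. -/
noncomputable def maskedAverage (q : ℝ) (f : (ι → Bool) → (κ → Bool) → (ι → κ → Bool) → ℝ) : ℝ :=
  ∑ c : ι → Bool, ∑ d : κ → Bool, (∏ a, bernWeight q (c a)) * (∏ b, bernWeight q (d b)) *
    ∑ Y : ι → κ → Bool, (∏ a, ∏ b, bernWeight (1 / 3) (Y a b)) * f c d Y

/-- The matrix of two-point signs, restricted to the masked rows and columns. -/
def maskedMatrix (c : ι → Bool) (d : κ → Bool) (Y : ι → κ → Bool) : Matrix ι κ ℝ :=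
  Matrix.of fun a b => if c a ∧ d b then skewValue (Y a b) else 0

theorem sum_prod_prod_bernWeight_mul (q : ℝ) (f : ι → κ → Bool → ℝ) :
    ∑ Y : ι → κ → Bool, (∏ a, ∏ b, bernWeight q (Y a b)) * ∏ a, ∏ b, f a b (Y a b) =
      ∏ a, ∏ b, (q * f a b true + (1 - q) * f a b false) := by
  have h1 : ∀ a b, q * f a b true + (1 - q) * f a b false =
      ∑ y : Bool, bernWeight q y * f a b y := by
    intro a b; simp [bernWeight]
  simp_rw [h1]
  have h2 : ∀ a, ∏ b, ∑ y : Bool, bernWeight q y * f a b y =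
      ∑ Y : κ → Bool, ∏ b, bernWeight q (Y b) * f a b (Y b) := by
    intro a
    rw [Finset.prod_univ_sum, Fintype.piFinset_univ]
  simp_rw [h2]
  rw [Finset.prod_univ_sum, Fintype.piFinset_univ]
  refine Finset.sum_congr rfl fun Y _ => ?_
  simp only [Finset.prod_mul_distrib]

theorem sum_prod_bernWeight_mul (q : ℝ) (f : ι → Bool → ℝ) :
    ∑ c : ι → Bool, (∏ a, bernWeight q (c a)) * ∏ a, f a (c a) =
      ∏ a, (q * f a true + (1 - q) * f a false) := by
  have h1 : ∀ a, q * f a true + (1 - q) * f a false =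
      ∑ y : Bool, bernWeight q y * f a y := by
    intro a; simp [bernWeight]
  simp_rw [h1]
  rw [Finset.prod_univ_sum, Fintype.piFinset_univ]
  refine Finset.sum_congr rfl fun Y _ => ?_
  simp only [Finset.prod_mul_distrib]

theorem bernWeight_nonneg {q : ℝ} (h0 : 0 ≤ q) (h1 : q ≤ 1) (c : Bool) : 0 ≤ bernWeight q c := by
  cases c <;> simp [bernWeight] <;> linarith

theorem maskedAverage_sum {τ : Type*} (q : ℝ) (S : Finset τ)
    (g : τ → (ι → Bool) → (κ → Bool) → (ι → κ → Bool) → ℝ) :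
    maskedAverage q (fun c d Y => ∑ i ∈ S, g i c d Y) = ∑ i ∈ S, maskedAverage q (g i) := by
  unfold maskedAverage
  rw [Finset.sum_comm' (t' := Finset.univ) (s' := fun _ => S) (by simp)]
  refine Finset.sum_congr rfl fun c _ => ?_
  rw [Finset.sum_comm' (t' := Finset.univ) (s' := fun _ => S) (by simp)]
  refine Finset.sum_congr rfl fun d _ => ?_
  rw [← Finset.mul_sum, Finset.sum_comm' (t' := Finset.univ) (s' := fun _ => S) (by simp)]
  simp only [Finset.mul_sum]

/-- The moments of the centred two-point variable. -/
noncomputable def skewMoment (m : ℕ) : ℝ := 1 / 3 * 2 ^ m + (1 - 1 / 3) * (-1) ^ m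

/-- This is the reason for the skew values 2 and -1: a symmetric sign has vanishing odd moments,
which could not dominate the odd moments of the matrix entries. -/
theorem one_le_skewMoment {m : ℕ} (hm : m ≠ 1) : 1 ≤ skewMoment m := by
  unfold skewMoment
  rcases m with _ | _ | m
  · norm_num
  · simp at hm
  · rcases Nat.even_or_odd m with h | h
    · have h2 : (-1 : ℝ) ^ (m + 2) = 1 := Even.neg_one_pow (by simpa using h.add even_two)
      have h1 : (1 : ℝ) ≤ 2 ^ m := one_le_pow₀ (by norm_num)
      rw [show m + 1 + 1 = m + 2 by ring, h2, pow_add]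
      linarith
    · have h2 : (-1 : ℝ) ^ (m + 2) = -1 := Odd.neg_one_pow (by simpa using h.add_even even_two)
      have h1 : (2 : ℝ) ^ 1 ≤ 2 ^ m := pow_le_pow_right₀ (by norm_num) h.pos
      rw [show m + 1 + 1 = m + 2 by ring, h2, pow_add]
      linarith

theorem skewMoment_nonneg (m : ℕ) : 0 ≤ skewMoment m := by
  by_cases hm : m = 1
  · subst hm; norm_num [skewMoment]
  · linarith [one_le_skewMoment hm]

/-- The moments of the signs are nonnegative, so it is enough to keep the event that all masks in R
and C are on, whose probability is q^(|R| + |C|). On that event no factor is masked. -/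
theorem maskedAverage_prod_ge {q : ℝ} (h0 : 0 ≤ q) (h1 : q ≤ 1) (α : ι → κ → ℕ)
    (R : Finset ι) (C : Finset κ) (hα : ∀ a b, α a b ≠ 0 → a ∈ R ∧ b ∈ C) :
    q ^ (R.card + C.card) * ∏ a, ∏ b, skewMoment (α a b) ≤
      maskedAverage q fun c d Y => ∏ a, ∏ b, (maskedMatrix c d Y) a b ^ α a b := by
  have hY : ∀ c d, ∑ Y : ι → κ → Bool, (∏ a, ∏ b, bernWeight (1 / 3) (Y a b)) *
      ∏ a, ∏ b, (maskedMatrix c d Y) a b ^ α a b =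
      ∏ a, ∏ b, ((if c a ∧ d b then 1 else 0) ^ α a b * skewMoment (α a b)) := by
    intro c d
    have := sum_prod_prod_bernWeight_mul (1 / 3)
      (fun a b y => (if c a ∧ d b then skewValue y else 0) ^ α a b)
    simp only [maskedMatrix, Matrix.of_apply]
    rw [this]
    refine Finset.prod_congr rfl fun a _ => Finset.prod_congr rfl fun b _ => ?_
    by_cases h : c a ∧ d b
    · simp only [h, and_self, if_true, skewMoment, skewValue]
      simp
    · simp only [h, if_false, skewMoment]
      by_cases h2 : α a b = 0
      · simp [h2]
      · simp [h2]
  unfold maskedAverage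
  simp_rw [hY]
  have hlow : ∀ (c : ι → Bool) (d : κ → Bool),
      (∏ a, if a ∈ R then (if c a then (1 : ℝ) else 0) else 1) *
      (∏ b, if b ∈ C then (if d b then (1 : ℝ) else 0) else 1) * ∏ a, ∏ b, skewMoment (α a b) ≤
      ∏ a, ∏ b, ((if c a ∧ d b then 1 else 0) ^ α a b * skewMoment (α a b)) := by
    intro c d
    have hnn : 0 ≤ ∏ a, ∏ b, (((if c a ∧ d b then (1 : ℝ) else 0)) ^ α a b * skewMoment (α a b)) :=
      Finset.prod_nonneg fun a _ => Finset.prod_nonneg fun b _ =>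
        mul_nonneg (pow_nonneg (by split_ifs <;> norm_num) _) (skewMoment_nonneg _)
    by_cases hc : ∀ a ∈ R, c a = true
    · by_cases hd : ∀ b ∈ C, d b = true
      · refine le_of_eq ?_
        rw [Finset.prod_eq_one, Finset.prod_eq_one, one_mul, one_mul]
        · refine Finset.prod_congr rfl fun a _ => Finset.prod_congr rfl fun b _ => ?_
          by_cases h2 : α a b = 0
          · simp [h2]
          · have h3 := hα a b h2
            simp [hc a h3.1, hd b h3.2]
        · intro b _
          by_cases hb : b ∈ C
          · simp [hb, hd b hb]
          · simp [hb]
        · intro a _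
          by_cases ha : a ∈ R
          · simp [ha, hc a ha]
          · simp [ha]
      · push Not at hd
        obtain ⟨b, hb, hdb⟩ := hd
        rw [Finset.prod_eq_zero (i := b) (s := Finset.univ) (Finset.mem_univ _)
          (f := fun b => if b ∈ C then (if d b then (1 : ℝ) else 0) else 1) (by simp [hb, hdb])]
        simpa using hnn
    · push Not at hc
      obtain ⟨a, ha, hca⟩ := hc
      rw [Finset.prod_eq_zero (i := a) (s := Finset.univ) (Finset.mem_univ _)
        (f := fun a => if a ∈ R then (if c a then (1 : ℝ) else 0) else 1) (by simp [ha, hca])]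
      simpa using hnn
  calc q ^ (R.card + C.card) * ∏ a, ∏ b, skewMoment (α a b)
      = ∑ c : ι → Bool, ∑ d : κ → Bool, (∏ a, bernWeight q (c a)) * (∏ b, bernWeight q (d b)) *
        ((∏ a, if a ∈ R then (if c a then (1 : ℝ) else 0) else 1) *
        (∏ b, if b ∈ C then (if d b then (1 : ℝ) else 0) else 1) *
          ∏ a, ∏ b, skewMoment (α a b)) := by
        have e1 := sum_prod_bernWeight_mul q
          (fun (a : ι) c => if a ∈ R then (if c then (1 : ℝ) else 0) else 1)
        have e2 := sum_prod_bernWeight_mul q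
          (fun (b : κ) c => if b ∈ C then (if c then (1 : ℝ) else 0) else 1)
        have e3 : ∏ a : ι, (q * (if a ∈ R then (if true = true then (1 : ℝ) else 0) else 1) +
            (1 - q) * (if a ∈ R then (if false = true then (1 : ℝ) else 0) else 1)) =
            q ^ R.card := by
          rw [← Finset.prod_const, ← Finset.prod_ite_mem_eq R]
          refine Finset.prod_congr rfl fun a _ => ?_
          by_cases ha : a ∈ R <;> simp [ha]
        have e4 : ∏ a : κ, (q * (if a ∈ C then (if true = true then (1 : ℝ) else 0) else 1) +
            (1 - q) * (if a ∈ C then (if false = true then (1 : ℝ) else 0) else 1)) =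
            q ^ C.card := by
          rw [← Finset.prod_const, ← Finset.prod_ite_mem_eq C]
          refine Finset.prod_congr rfl fun a _ => ?_
          by_cases ha : a ∈ C <;> simp [ha]
        rw [e3] at e1
        rw [e4] at e2
        rw [pow_add, ← e1, ← e2, Finset.sum_mul_sum, Finset.sum_mul]
        refine Finset.sum_congr rfl fun c _ => ?_
        rw [Finset.sum_mul]
        refine Finset.sum_congr rfl fun d _ => ?_
        ring
    _ ≤ _ := by
        refine Finset.sum_le_sum fun c _ => Finset.sum_le_sum fun d _ => ?_
        refine mul_le_mul_of_nonneg_left (hlow c d) ?_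
        exact mul_nonneg (Finset.prod_nonneg fun a _ => bernWeight_nonneg h0 h1 _)
          (Finset.prod_nonneg fun a _ => bernWeight_nonneg h0 h1 _)

/-- The moments of a random matrix with independent centred entries are dominated by those of a
masked matrix of two-point signs. -/
theorem integral_trace_pow_le {ν : ι → κ → Measure ℝ} [∀ j k, IsProbabilityMeasure (ν j k)]
    {q β : ℝ} (h0 : 0 < q) (h1 : q ≤ 1) (hβ : 0 ≤ β)
    (hint : ∀ j k (m : ℕ), Integrable (fun u => u ^ m) (ν j k))
    (hmean : ∀ j k, ∫ u, u ∂(ν j k) = 0)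
    (hmom : ∀ j k (m : ℕ), 2 ≤ m → ∫ u, u ^ m ∂(ν j k) ≤ β ^ m * q)
    (hmom' : ∀ j k (m : ℕ), 2 ≤ m → -(β ^ m * q) ≤ ∫ u, u ^ m ∂(ν j k)) (k : ℕ) :
    ∫ A, ((Matrix.of A * (Matrix.of A)ᵀ) ^ k).trace ∂(matMeasure ν) ≤
      β ^ (2 * k) * q⁻¹ * maskedAverage q fun c d (Y : ι → κ → Bool) =>
        ((maskedMatrix c d Y * (maskedMatrix c d Y)ᵀ) ^ k).trace := by
  have hprodint : ∀ α : ι → κ → ℕ,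
      Integrable (fun A : ι → κ → ℝ => ∏ a, ∏ b, A a b ^ α a b) (matMeasure ν) := by
    intro α
    refine Integrable.fintype_prod (f := fun a (x : κ → ℝ) => ∏ b, x b ^ α a b) fun a => ?_
    exact Integrable.fintype_prod (f := fun b (x : ℝ) => x ^ α a b) fun b => hint a b _
  have hprod : ∀ α : ι → κ → ℕ, ∫ A, ∏ a, ∏ b, A a b ^ α a b ∂(matMeasure ν) =
      ∏ a, ∏ b, ∫ u, u ^ α a b ∂(ν a b) := by
    intro α
    unfold matMeasure
    rw [integral_fintype_prod_eq_prod (fun a (x : κ → ℝ) => ∏ b, x b ^ α a b)]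
    refine Finset.prod_congr rfl fun a _ => ?_
    rw [integral_fintype_prod_eq_prod (fun b (x : ℝ) => x ^ α a b)]
  have hentry : ∀ (a : ι) (b : κ) (m : ℕ), |∫ u, u ^ m ∂(ν a b)| ≤
      β ^ m * (if m ≠ 0 then q else 1) * skewMoment m := by
    intro a b m
    rcases m with _ | _ | m
    · simp [skewMoment]
    · norm_num [hmean, skewMoment]
    · have h2 : |∫ u, u ^ (m + 2) ∂(ν a b)| ≤ β ^ (m + 2) * q :=
        abs_le.2 ⟨hmom' a b _ (by omega), hmom a b _ (by omega)⟩
      have h3 : 1 ≤ skewMoment (m + 2) := one_le_skewMoment (by omega)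
      have h4 : 0 ≤ β ^ (m + 2) * q := by positivity
      rw [if_pos (by omega)]
      nlinarith
  have hwalk : ∀ (j : ι) (s : Fin k → κ × ι),
      ∫ A, ∏ a, ∏ b, A a b ^ walkExp k j s a b ∂(matMeasure ν) ≤
      β ^ (2 * k) * q⁻¹ * maskedAverage q fun c d (Y : ι → κ → Bool) =>
        ∏ a, ∏ b, (maskedMatrix c d Y) a b ^ walkExp k j s a b := by
    intro j s
    obtain ⟨R, C, -, hα, hcard⟩ := exists_card_add_card_le_walk k j s
    set α := walkExp k j s with hαdef
    rw [hprod]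
    calc _ ≤ |∏ a, ∏ b, ∫ u, u ^ α a b ∂(ν a b)| := le_abs_self _
      _ = ∏ a, ∏ b, |∫ u, u ^ α a b ∂(ν a b)| := by simp_rw [Finset.abs_prod]
      _ ≤ ∏ a, ∏ b, (β ^ α a b * (if α a b ≠ 0 then q else 1) * skewMoment (α a b)) :=
          Finset.prod_le_prod (fun a _ => Finset.prod_nonneg fun b _ => abs_nonneg _) fun a _ =>
            Finset.prod_le_prod (fun b _ => abs_nonneg _) fun b _ => hentry a b _
      _ = β ^ (2 * k) * (q ^ (Finset.univ.filter fun e : ι × κ => α e.1 e.2 ≠ 0).card *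
            ∏ a, ∏ b, skewMoment (α a b)) := by
          simp only [Finset.prod_mul_distrib]
          rw [mul_assoc]
          congr 1
          · simp only [Finset.prod_pow_eq_pow_sum]
            rw [hαdef, sum_walkExp]
          · congr 1
            rw [← Finset.prod_const, Finset.prod_filter, Fintype.prod_prod_type]
      -- A walk with E distinct edges contributes q^E, the masks contribute q^V for its V vertices,
      -- and V ≤ E + 1. So the comparison loses one factor q⁻¹, whatever the length of the walk.
      _ ≤ β ^ (2 * k) * (q⁻¹ * q ^ (R.card + C.card) * ∏ a, ∏ b, skewMoment (α a b)) := by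
          refine mul_le_mul_of_nonneg_left ?_ (by positivity)
          refine mul_le_mul_of_nonneg_right ?_ (Finset.prod_nonneg fun a _ =>
            Finset.prod_nonneg fun b _ => skewMoment_nonneg _)
          have h5 : q ^ ((Finset.univ.filter fun e : ι × κ => α e.1 e.2 ≠ 0).card + 1) ≤
              q ^ (R.card + C.card) := pow_le_pow_of_le_one h0.le h1 hcard
          rw [pow_succ] at h5
          rw [inv_mul_eq_div, le_div_iff₀ h0]
          exact h5
      _ = β ^ (2 * k) * q⁻¹ * (q ^ (R.card + C.card) * ∏ a, ∏ b, skewMoment (α a b)) := by ring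
      _ ≤ _ := by
          refine mul_le_mul_of_nonneg_left (maskedAverage_prod_ge h0.le h1 α R C hα) ?_
          positivity
  have htrace : ∀ A : Matrix ι κ ℝ, ((A * Aᵀ) ^ k).trace = ∑ j, ∑ s : Fin k → κ × ι,
      if walkEnd k j s = j then ∏ a, ∏ b, A a b ^ walkExp k j s a b else 0 := by
    intro A
    simp only [Matrix.trace, Matrix.diag_apply, mul_transpose_pow_apply]
  simp_rw [htrace]
  have hlin : maskedAverage q (fun c d (Y : ι → κ → Bool) => ∑ j, ∑ s : Fin k → κ × ι,
      if walkEnd k j s = j then ∏ a, ∏ b, (maskedMatrix c d Y) a b ^ walkExp k j s a b else 0) =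
      ∑ j, ∑ s : Fin k → κ × ι, if walkEnd k j s = j then
        maskedAverage q (fun c d (Y : ι → κ → Bool) =>
          ∏ a, ∏ b, (maskedMatrix c d Y) a b ^ walkExp k j s a b) else 0 := by
    rw [maskedAverage_sum]
    refine Finset.sum_congr rfl fun j _ => ?_
    rw [maskedAverage_sum]
    refine Finset.sum_congr rfl fun s _ => ?_
    by_cases h : walkEnd k j s = j
    · simp only [h, if_true]
    · simp [h, maskedAverage]
  rw [hlin, integral_finsetSum]
  · rw [Finset.mul_sum]
    refine Finset.sum_le_sum fun j _ => ?_
    rw [integral_finsetSum]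
    · rw [Finset.mul_sum]
      refine Finset.sum_le_sum fun s _ => ?_
      by_cases h : walkEnd k j s = j
      · simp only [h, if_true]
        exact hwalk j s
      · simp [h]
    · intro s _
      by_cases h : walkEnd k j s = j
      · simp only [h, if_true]
        exact hprodint _
      · simp [h]
  · intro j _
    refine integrable_finsetSum _ fun s _ => ?_
    by_cases h : walkEnd k j s = j
    · simp only [h, if_true]
      exact hprodint _
    · simp [h]

end MomentComparison

/-! ### Counting integer points in balls -/

section Lattice

variable {κ : Type*} [Fintype κ] [DecidableEq κ]

theorem sum_range_exp_neg_mul_le {ε : ℝ} (hε : 0 < ε) (m : ℕ) :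
    ∑ i ∈ Finset.range m, Real.exp (-(2 * ε * (i + 1))) ≤ 1 / (2 * ε) := by
  have h1 : ∀ i : ℕ, Real.exp (-(2 * ε * (i + 1))) * (2 * ε) ≤
      Real.exp (-(2 * ε * i)) - Real.exp (-(2 * ε * (i + 1))) := by
    intro i
    have h2 : Real.exp (-(2 * ε * i)) = Real.exp (-(2 * ε * (i + 1))) * Real.exp (2 * ε) := by
      rw [← Real.exp_add]; ring_nf
    rw [h2]
    nlinarith [Real.add_one_le_exp (2 * ε), Real.exp_pos (-(2 * ε * (i + 1)))]
  rw [le_div_iff₀ (by positivity), Finset.sum_mul]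
  refine (Finset.sum_le_sum fun i _ => h1 i).trans ?_
  have h3 := Finset.sum_range_sub' (fun i : ℕ => Real.exp (-(2 * ε * i))) m
  push_cast at h3
  rw [h3]
  simp only [mul_zero, neg_zero, Real.exp_zero]
  linarith [Real.exp_pos (-(2 * ε * m))]

theorem sum_Icc_exp_neg_sq_le {ε : ℝ} (hε : 0 < ε) (m : ℕ) :
    ∑ r ∈ Finset.Icc (-(m : ℤ)) m, Real.exp (-(ε ^ 2 * (r : ℝ) ^ 2)) ≤ 1 + 3 / ε := by
  have h1 : Finset.Icc (-(m : ℤ)) m ⊆ insert 0 ((Finset.range m).image (fun i : ℕ => (i : ℤ) + 1) ∪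
      (Finset.range m).image (fun i : ℕ => -((i : ℤ) + 1))) := by
    intro r hr
    rw [Finset.mem_Icc] at hr
    simp only [Finset.mem_insert, Finset.mem_union, Finset.mem_image, Finset.mem_range]
    rcases lt_trichotomy r 0 with h | h | h
    · exact Or.inr (Or.inr ⟨(-r - 1).toNat, by omega, by omega⟩)
    · exact Or.inl h
    · exact Or.inr (Or.inl ⟨(r - 1).toNat, by omega, by omega⟩)
  -- From (ε(i + 1) − 1)² ≥ 0; the Gaussian sum becomes a geometric one.
  have h2 : ∀ i : ℕ, Real.exp (-(ε ^ 2 * ((i : ℝ) + 1) ^ 2)) ≤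
      Real.exp 1 * Real.exp (-(2 * ε * (i + 1))) := by
    intro i
    rw [← Real.exp_add]
    refine Real.exp_le_exp.2 ?_
    nlinarith [sq_nonneg (ε * ((i : ℝ) + 1) - 1)]
  have h3 : ∑ i ∈ Finset.range m, Real.exp (-(ε ^ 2 * ((i : ℝ) + 1) ^ 2)) ≤
      Real.exp 1 * (1 / (2 * ε)) := by
    refine (Finset.sum_le_sum fun i _ => h2 i).trans ?_
    rw [← Finset.mul_sum]
    exact mul_le_mul_of_nonneg_left (sum_range_exp_neg_mul_le hε m) (Real.exp_pos _).le
  calc _ ≤ ∑ r ∈ insert 0 ((Finset.range m).image (fun i : ℕ => (i : ℤ) + 1) ∪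
      (Finset.range m).image (fun i : ℕ => -((i : ℤ) + 1))),
        Real.exp (-(ε ^ 2 * (r : ℝ) ^ 2)) :=
        Finset.sum_le_sum_of_subset_of_nonneg h1 fun _ _ _ => (Real.exp_pos _).le
    _ = 1 + (∑ i ∈ Finset.range m, Real.exp (-(ε ^ 2 * ((i : ℝ) + 1) ^ 2)) +
          ∑ i ∈ Finset.range m, Real.exp (-(ε ^ 2 * ((i : ℝ) + 1) ^ 2))) := by
        rw [Finset.sum_insert, Finset.sum_union, Finset.sum_image, Finset.sum_image]
        · push_cast
          simp only [neg_sq]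
          simp
        · intro a _ b _ h; simpa using h
        · intro a _ b _ h; simpa using h
        · rw [Finset.disjoint_left]
          intro r h h'
          simp only [Finset.mem_image, Finset.mem_range] at h h'
          obtain ⟨a, -, rfl⟩ := h
          obtain ⟨b, -, hb⟩ := h'
          omega
        · simp only [Finset.mem_union, Finset.mem_image, Finset.mem_range, not_or, not_exists,
            not_and]
          exact ⟨fun i _ => by omega, fun i _ => by omega⟩
    _ ≤ 1 + (Real.exp 1 * (1 / (2 * ε)) + Real.exp 1 * (1 / (2 * ε))) := by gcongr
    _ ≤ 1 + 3 / ε := by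
        have h4 : Real.exp 1 ≤ 3 := (Real.exp_one_lt_d9.trans (by norm_num)).le
        have h5 : Real.exp 1 * (1 / (2 * ε)) + Real.exp 1 * (1 / (2 * ε)) = Real.exp 1 / ε := by
          field_simp; ring
        rw [h5]
        gcongr

/-- The number of integer points of a ball in a coordinate subspace. -/
theorem exists_finset_lattice_points (J : Finset κ) {ε ρ : ℝ} (hε : 0 < ε) :
    ∃ S : Finset (κ → ℤ),
      (∀ r, r ∈ S ↔ (∀ k ∉ J, r k = 0) ∧ ∑ k, (r k : ℝ) ^ 2 ≤ ρ) ∧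
      (S.card : ℝ) ≤ Real.exp (ε ^ 2 * ρ) * (1 + 3 / ε) ^ J.card := by
  set m := ⌈ρ⌉₊
  set T : Finset (κ → ℤ) := Fintype.piFinset fun k =>
    if k ∈ J then Finset.Icc (-(m : ℤ)) m else {0} with hT
  refine ⟨T.filter fun r => ∑ k, (r k : ℝ) ^ 2 ≤ ρ, ?_, ?_⟩
  · intro r
    rw [Finset.mem_filter, hT, Fintype.mem_piFinset]
    constructor
    · rintro ⟨h, h'⟩
      refine ⟨fun k hk => ?_, h'⟩
      simpa [hk] using h k
    · rintro ⟨h, h'⟩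
      refine ⟨fun k => ?_, h'⟩
      split_ifs with hk
      · have h1 : (r k : ℝ) ^ 2 ≤ ρ :=
          (Finset.single_le_sum (f := fun k => (r k : ℝ) ^ 2) (fun k _ => sq_nonneg _)
            (Finset.mem_univ k)).trans h'
        have h2 : ((r k ^ 2 : ℤ) : ℝ) ≤ m := by push_cast; exact h1.trans (Nat.le_ceil ρ)
        have h3 : r k ^ 2 ≤ (m : ℤ) := by exact_mod_cast h2
        rw [Finset.mem_Icc]
        constructor <;> nlinarith
      · simp [h k hk]
  · calc ((T.filter fun r => ∑ k, (r k : ℝ) ^ 2 ≤ ρ).card : ℝ)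
        = ∑ r ∈ T.filter fun r => ∑ k, (r k : ℝ) ^ 2 ≤ ρ, 1 := by simp
      -- Points of the ball have Gaussian weight at least exp(-ε²ρ), and the total weight factors
      -- over the coordinates.
      _ ≤ ∑ r ∈ T.filter fun r => ∑ k, (r k : ℝ) ^ 2 ≤ ρ,
          Real.exp (ε ^ 2 * ρ) * ∏ k, Real.exp (-(ε ^ 2 * (r k : ℝ) ^ 2)) := by
          refine Finset.sum_le_sum fun r hr => ?_
          rw [← Real.exp_sum, ← Real.exp_add, Finset.sum_neg_distrib, ← Finset.mul_sum]
          refine Real.one_le_exp ?_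
          have := (Finset.mem_filter.1 hr).2
          nlinarith [sq_nonneg ε]
      _ ≤ ∑ r ∈ T, Real.exp (ε ^ 2 * ρ) * ∏ k, Real.exp (-(ε ^ 2 * (r k : ℝ) ^ 2)) :=
          Finset.sum_le_sum_of_subset_of_nonneg (Finset.filter_subset _ _) fun r _ _ => by positivity
      _ = Real.exp (ε ^ 2 * ρ) * ∏ k, ∑ i ∈ (if k ∈ J then Finset.Icc (-(m : ℤ)) m else {0}),
            Real.exp (-(ε ^ 2 * (i : ℝ) ^ 2)) := by
          rw [← Finset.mul_sum, Finset.prod_univ_sum]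
      _ ≤ Real.exp (ε ^ 2 * ρ) * ∏ k, (if k ∈ J then 1 + 3 / ε else 1) := by
          gcongr with k _
          split_ifs
          · exact sum_Icc_exp_neg_sq_le hε m
          · simp
      _ = _ := by
          rw [Finset.prod_ite_mem_eq, Finset.prod_const]

end Lattice

/-! ### Rounding -/

section TruncateTowardZero

/-- Rounding toward zero. -/
noncomputable def roundZero (t : ℝ) : ℤ := if 0 ≤ t then ⌊t⌋ else ⌈t⌉

theorem abs_sub_roundZero_le (t : ℝ) : |t - roundZero t| ≤ 1 := by
  unfold roundZero
  split_ifs with h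
  · rw [abs_le]
    constructor <;> linarith [Int.floor_le t, Int.lt_floor_add_one t]
  · rw [abs_le]
    constructor <;> linarith [Int.le_ceil t, Int.ceil_lt_add_one t]

/-- Because of this, rounding to a net keeps a vector in its ball and preserves upper bounds on its
coordinates. -/
theorem abs_roundZero_le (t : ℝ) : |(roundZero t : ℝ)| ≤ |t| := by
  unfold roundZero
  split_ifs with h
  · rw [abs_of_nonneg h, abs_of_nonneg (by exact_mod_cast Int.floor_nonneg.2 h)]
    exact Int.floor_le t
  · push Not at h
    have : ⌈t⌉ ≤ 0 := Int.ceil_le.2 (by exact_mod_cast h.le)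
    rw [abs_of_neg h, abs_of_nonpos (by exact_mod_cast this)]
    linarith [Int.le_ceil t]

end TruncateTowardZero

/-! ### Operator norm, bilinear forms and traces -/

section OperatorNorm

open Matrix
open scoped Matrix.Norms.L2Operator

variable {ι κ : Type*} [Fintype ι] [Fintype κ] [DecidableEq ι] [DecidableEq κ]

theorem sum_sq_sum_mul_le_sq_norm (A : Matrix ι κ ℝ) (x : κ → ℝ) :
    ∑ j, (∑ k, A j k * x k) ^ 2 ≤ ‖A‖ ^ 2 * ∑ k, x k ^ 2 := by
  have h := A.l2_opNorm_mulVec (WithLp.toLp 2 x)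
  have h1 := pow_le_pow_left₀ (norm_nonneg _) h 2
  rw [mul_pow, EuclideanSpace.norm_sq_eq, EuclideanSpace.norm_sq_eq] at h1
  simpa [Matrix.mulVec, dotProduct] using h1

theorem sum_mul_sum_mul_le_norm (A : Matrix ι κ ℝ) (x : κ → ℝ) (y : ι → ℝ) :
    ∑ j, ∑ k, y j * A j k * x k ≤ ‖A‖ * √(∑ j, y j ^ 2) * √(∑ k, x k ^ 2) := by
  have h1 : ∑ j, ∑ k, y j * A j k * x k = ∑ j, y j * ∑ k, A j k * x k := by
    simp only [Finset.mul_sum, mul_assoc]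
  rw [h1]
  refine (Real.sum_mul_le_sqrt_mul_sqrt _ _ _).trans ?_
  have h2 : √(∑ j, (∑ k, A j k * x k) ^ 2) ≤ ‖A‖ * √(∑ k, x k ^ 2) := by
    rw [← Real.sqrt_sq (norm_nonneg A), ← Real.sqrt_mul (sq_nonneg _)]
    exact Real.sqrt_le_sqrt (sum_sq_sum_mul_le_sq_norm A x)
  calc _ ≤ √(∑ j, y j ^ 2) * (‖A‖ * √(∑ k, x k ^ 2)) := by gcongr
    _ = _ := by ring

theorem norm_le_of_sum_mul_sum_mul_le (A : Matrix ι κ ℝ) {s : ℝ} (hs : 0 ≤ s)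
    (h : ∀ (x : κ → ℝ) (y : ι → ℝ), ∑ k, x k ^ 2 ≤ 1 → ∑ j, y j ^ 2 ≤ 1 →
      ∑ j, ∑ k, y j * A j k * x k ≤ s) : ‖A‖ ≤ s := by
  rw [Matrix.l2_opNorm_def]
  refine ContinuousLinearMap.opNorm_le_of_unit_norm hs fun x hx => ?_
  set z := (LinearMap.toContinuousLinearMap (Matrix.toEuclideanLin A)) x with hz
  by_cases h0 : ‖z‖ = 0
  · exact h0.le.trans hs
  have hz2 : ‖z‖ ^ 2 = ∑ j, z j ^ 2 := by rw [EuclideanSpace.norm_sq_eq]; simp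
  have hx2 : ∑ k, x k ^ 2 = 1 := by
    have := EuclideanSpace.norm_sq_eq x
    rw [hx] at this
    simpa using this.symm
  have h1 := h x (fun j => z j / ‖z‖) hx2.le (by
    simp only [div_pow]
    rw [← Finset.sum_div, ← hz2, div_self (by positivity)])
  have h2 : ∑ j, ∑ k, z j / ‖z‖ * A j k * x k = ‖z‖ := by
    have h3 : ∀ j, ∑ k, z j / ‖z‖ * A j k * x k = z j ^ 2 / ‖z‖ := by
      intro j
      have h4 : z j = ∑ k, A j k * x k := by
        simp [hz, Matrix.mulVec, dotProduct]
      simp only [mul_assoc]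
      rw [← Finset.mul_sum, ← h4]
      ring
    simp only [h3]
    rw [← Finset.sum_div, ← hz2]
    field_simp
  rw [h2] at h1
  exact h1

theorem trace_mul_transpose_pow_le (A : Matrix ι κ ℝ) (k : ℕ) :
    ((A * Aᵀ) ^ k).trace ≤ Fintype.card ι * ‖A‖ ^ (2 * k) := by
  by_cases hι : IsEmpty ι
  · simp [Matrix.trace]
  rw [not_isEmpty_iff] at hι
  have hn : ‖(A * Aᵀ) ^ k‖ ≤ ‖A‖ ^ (2 * k) := by
    refine (norm_pow_le _ k).trans ?_
    rw [pow_mul]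
    refine pow_le_pow_left₀ (norm_nonneg _) ?_ k
    refine (Matrix.l2_opNorm_mul _ _).trans ?_
    have : ‖Aᵀ‖ = ‖A‖ := by simpa using Matrix.l2_opNorm_conjTranspose A
    rw [this, sq]
  have h : ∀ j, ((A * Aᵀ) ^ k) j j ≤ ‖A‖ ^ (2 * k) := by
    intro j
    refine le_trans ?_ hn
    have := sum_mul_sum_mul_le_norm ((A * Aᵀ) ^ k) (Pi.single j 1) (Pi.single j 1)
    simpa [Pi.single_apply, Finset.sum_ite_eq] using this
  calc ((A * Aᵀ) ^ k).trace = ∑ j, ((A * Aᵀ) ^ k) j j := rfl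
    _ ≤ ∑ j : ι, ‖A‖ ^ (2 * k) := Finset.sum_le_sum fun j _ => h j
    _ = _ := by simp

/-- For H = (AAᵀ)^(2^r), self-adjointness gives ‖H‖ = ‖A‖^(2·2^r), repeated squaring being the
reason for the power of two. The squared Hilbert–Schmidt norm of H, which dominates ‖H‖², is the
trace of H². -/
theorem norm_pow_le_trace (A : Matrix ι κ ℝ) (r : ℕ) :
    ‖A‖ ^ (2 * 2 ^ (r + 1)) ≤ ((A * Aᵀ) ^ (2 ^ (r + 1))).trace := by
  set H := (A * Aᵀ) ^ (2 ^ r) with hH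
  have hsa : IsSelfAdjoint (A * Aᵀ) := by
    rw [IsSelfAdjoint, Matrix.star_eq_conjTranspose]
    simp
  have h1 : ‖H‖ = ‖A‖ ^ (2 * 2 ^ r) := by
    rw [hH, hsa.norm_pow_two_pow, pow_mul]
    congr 1
    have h2 := Matrix.l2_opNorm_conjTranspose_mul_self (Aᵀ)
    have h3 : ‖Aᵀ‖ = ‖A‖ := by simpa using Matrix.l2_opNorm_conjTranspose A
    rw [h3] at h2
    simpa [sq] using h2
  have hHt : Hᵀ = H := by
    rw [hH, Matrix.transpose_pow, Matrix.transpose_mul, Matrix.transpose_transpose]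
  have h2 : ‖H‖ ≤ √(∑ i, ∑ j, H i j ^ 2) := by
    refine norm_le_of_sum_mul_sum_mul_le H (Real.sqrt_nonneg _) fun x y hx hy => ?_
    have h3 : ∑ i, ∑ j, y i * H i j * x j = ∑ e : ι × ι, H e.1 e.2 * (y e.1 * x e.2) := by
      rw [Fintype.sum_prod_type]
      refine Finset.sum_congr rfl fun i _ => Finset.sum_congr rfl fun j _ => by ring
    rw [h3]
    refine (Real.sum_mul_le_sqrt_mul_sqrt _ _ _).trans ?_
    rw [Fintype.sum_prod_type]
    have h4 : ∑ e : ι × ι, (y e.1 * x e.2) ^ 2 ≤ 1 := by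
      simp only [mul_pow]
      rw [Fintype.sum_prod_type]
      simp only
      rw [← Finset.sum_mul_sum]
      exact mul_le_one₀ hy (Finset.sum_nonneg fun _ _ => sq_nonneg _) hx
    calc _ ≤ √(∑ i, ∑ j, H i j ^ 2) * 1 := by
          gcongr
          exact Real.sqrt_le_one.2 h4
      _ = _ := mul_one _
  have h3 : ∑ i, ∑ j, H i j ^ 2 = ((A * Aᵀ) ^ (2 ^ (r + 1))).trace := by
    rw [pow_succ 2 r, pow_mul, ← hH, pow_two, Matrix.trace]
    refine Finset.sum_congr rfl fun i _ => ?_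
    rw [Matrix.diag_apply, Matrix.mul_apply]
    refine Finset.sum_congr rfl fun j _ => ?_
    rw [sq]
    congr 1
    exact congrFun (congrFun hHt j) i
  rw [← h3, show 2 * 2 ^ (r + 1) = 2 * 2 ^ r * 2 by ring, pow_mul, ← h1]
  calc ‖H‖ ^ 2 ≤ √(∑ i, ∑ j, H i j ^ 2) ^ 2 := by gcongr
    _ = _ := Real.sq_sqrt (Finset.sum_nonneg fun _ _ => Finset.sum_nonneg fun _ _ => sq_nonneg _)

end OperatorNorm

/-! ### Moments of the norm of the masked sign matrix -/

section SignMatrix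

open Matrix
open scoped Matrix.Norms.L2Operator

variable {ι κ : Type*} [Fintype ι] [Fintype κ] [DecidableEq ι] [DecidableEq κ]

theorem exp_le_self_add_exp_sq (x : ℝ) : Real.exp x ≤ x + Real.exp (x ^ 2) := by
  have h0 := Real.add_one_le_exp (x ^ 2)
  rcases le_or_gt |x| 1 with h | h
  · have := (abs_le.1 (Real.abs_exp_sub_one_sub_id_le h)).2
    linarith
  · rcases lt_abs.1 h with h1 | h1
    · have : Real.exp x ≤ Real.exp (x ^ 2) := Real.exp_le_exp.2 (by nlinarith)
      linarith
    · have : Real.exp x ≤ 1 := Real.exp_le_one_iff.2 (by linarith)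
      nlinarith

/-- The linear terms produced by `exp_le_self_add_exp_sq` cancel because the variable is centred. -/
theorem skew_mgf_le (t : ℝ) :
    1 / 3 * Real.exp (t * 2) + (1 - 1 / 3) * Real.exp (t * -1) ≤ Real.exp (4 * t ^ 2) := by
  have h1 := exp_le_self_add_exp_sq (t * 2)
  have h2 := exp_le_self_add_exp_sq (t * -1)
  have h3 : Real.exp ((t * -1) ^ 2) ≤ Real.exp (4 * t ^ 2) :=
    Real.exp_le_exp.2 (by nlinarith [sq_nonneg t])
  rw [show (t * 2) ^ 2 = 4 * t ^ 2 by ring] at h1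
  linarith

theorem sum_bernWeight_exp_le (c : ι → Bool) (d : κ → Bool) (y : ι → ℝ) (x : κ → ℝ) (t : ℝ)
    (hy : ∑ a, y a ^ 2 ≤ 1) (hx : ∑ b, x b ^ 2 ≤ 1) :
    ∑ Y : ι → κ → Bool, (∏ a, ∏ b, bernWeight (1 / 3) (Y a b)) *
      Real.exp (t * ∑ a, ∑ b, y a * maskedMatrix c d Y a b * x b) ≤ Real.exp (4 * t ^ 2) := by
  have h1 : ∀ Y : ι → κ → Bool,
      Real.exp (t * ∑ a, ∑ b, y a * maskedMatrix c d Y a b * x b) =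
      ∏ a, ∏ b, Real.exp (t * (y a * (if c a ∧ d b then skewValue (Y a b) else 0) * x b)) := by
    intro Y
    simp only [Finset.mul_sum, Real.exp_sum]
    rfl
  simp only [h1]
  rw [sum_prod_prod_bernWeight_mul (1 / 3) (fun a b z =>
    Real.exp (t * (y a * (if c a ∧ d b then skewValue z else 0) * x b)))]
  calc _ ≤ ∏ a, ∏ b, Real.exp (4 * t ^ 2 * (y a ^ 2 * x b ^ 2)) := by
        refine Finset.prod_le_prod (fun a _ => Finset.prod_nonneg fun b _ => by positivity)
          fun a _ => Finset.prod_le_prod (fun b _ => by positivity) fun b _ => ?_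
        by_cases h : c a ∧ d b
        · simp only [h, and_self, if_true, skewValue]
          have := skew_mgf_le (t * (y a * x b))
          refine le_trans (le_of_eq ?_) (this.trans (le_of_eq ?_))
          · simp only [Bool.false_eq_true, if_false]
            congr 3 <;> ring
          · congr 1; ring
        · simp only [h, if_false]
          simp only [mul_zero, zero_mul, Real.exp_zero]
          have : 1 ≤ Real.exp (4 * t ^ 2 * (y a ^ 2 * x b ^ 2)) := Real.one_le_exp (by positivity)
          linarith
    _ = Real.exp (4 * t ^ 2 * ((∑ a, y a ^ 2) * ∑ b, x b ^ 2)) := by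
        simp only [← Real.exp_sum]
        rw [Finset.sum_mul_sum]
        simp only [Finset.mul_sum]
    _ ≤ _ := by
        refine Real.exp_le_exp.2 ?_
        have := mul_le_one₀ hy (Finset.sum_nonneg fun b _ => sq_nonneg (x b)) hx
        nlinarith [sq_nonneg t]

/-- At most S coordinates move, each by at most 1/(3√S). -/
theorem sum_sq_sub_round_le {J : κ → Bool} {S : ℝ} (hS : 0 < S)
    (hJ : ((Finset.univ.filter fun b => J b = true).card : ℝ) ≤ S) (x : κ → ℝ) :
    ∑ b, ((if J b then x b else 0) -
      ((if J b then roundZero (3 * √S * x b) else 0 : ℤ) : ℝ) / (3 * √S)) ^ 2 ≤ 1 / 9 := by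
  have h1 : ∀ b, ((if J b then x b else 0) -
      ((if J b then roundZero (3 * √S * x b) else 0 : ℤ) : ℝ) / (3 * √S)) ^ 2 ≤
      if J b = true then 1 / (9 * S) else 0 := by
    intro b
    split_ifs with h
    · have h2 := abs_sub_roundZero_le (3 * √S * x b)
      have h3 : x b - (roundZero (3 * √S * x b) : ℝ) / (3 * √S) =
          (3 * √S * x b - roundZero (3 * √S * x b)) / (3 * √S) := by
        have : 0 < √S := Real.sqrt_pos.2 hS
        field_simp
      rw [h3, div_pow, mul_pow, Real.sq_sqrt hS.le, ← sq_abs]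
      norm_num
      rw [div_eq_mul_inv]
      have h4 : |3 * √S * x b - roundZero (3 * √S * x b)| ^ 2 ≤ 1 := by
        rw [sq_le_one_iff_abs_le_one, abs_abs]; exact h2
      have h5 : 0 ≤ (9 * S)⁻¹ := by positivity
      rw [sq_abs] at h4
      calc _ ≤ 1 * (9 * S)⁻¹ := by gcongr
        _ = _ := by rw [one_mul, mul_inv]; ring
    · simp
  refine (Finset.sum_le_sum fun b _ => h1 b).trans ?_
  rw [← Finset.sum_filter, Finset.sum_const, nsmul_eq_mul]
  calc _ ≤ S * (1 / (9 * S)) := by gcongr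
    _ = 1 / 9 := by field_simp

theorem sum_sq_round_le (J : κ → Bool) {S : ℝ} (hS : 0 < S) {x : κ → ℝ} (hx : ∑ b, x b ^ 2 ≤ 1) :
    ∑ b, ((if J b then roundZero (3 * √S * x b) else 0 : ℤ) : ℝ) ^ 2 ≤ 9 * S := by
  have h1 : ∀ b, ((if J b then roundZero (3 * √S * x b) else 0 : ℤ) : ℝ) ^ 2 ≤
      9 * S * x b ^ 2 := by
    intro b
    split_ifs with h
    · have := pow_le_pow_left₀ (abs_nonneg _) (abs_roundZero_le (3 * √S * x b)) 2
      rw [sq_abs, sq_abs, mul_pow, mul_pow, Real.sq_sqrt hS.le] at this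
      linarith
    · rw [Int.cast_zero, zero_pow two_ne_zero]; positivity
  refine (Finset.sum_le_sum fun b _ => h1 b).trans ?_
  rw [← Finset.mul_sum]
  nlinarith

/-- Two perturbations of norm 1/3 cost 2‖A‖/3. Taking the supremum over x and y and absorbing this,
‖A‖ is at most three times the maximum of the form over the net. -/
theorem sum_mul_sum_mul_le_of_near (A : Matrix ι κ ℝ) {y y' : ι → ℝ} {x x' : κ → ℝ}
    (hx : ∑ k, x k ^ 2 ≤ 1) (hy' : ∑ j, y' j ^ 2 ≤ 1)
    (hxx : ∑ k, (x k - x' k) ^ 2 ≤ 1 / 9) (hyy : ∑ j, (y j - y' j) ^ 2 ≤ 1 / 9) :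
    ∑ j, ∑ k, y j * A j k * x k ≤ ∑ j, ∑ k, y' j * A j k * x' k + 2 / 3 * ‖A‖ := by
  have e2 : ∑ j, ∑ k, y j * A j k * x k = ∑ j, ∑ k, (y j - y' j) * A j k * x k +
      ∑ j, ∑ k, y' j * A j k * (x k - x' k) + ∑ j, ∑ k, y' j * A j k * x' k := by
    simp only [← Finset.sum_add_distrib]
    refine Finset.sum_congr rfl fun j _ => Finset.sum_congr rfl fun k _ => ?_
    ring
  have hb1 : √(∑ j, (y j - y' j) ^ 2) ≤ 1 / 3 :=
    Real.sqrt_le_iff.2 ⟨by norm_num, hyy.trans (by norm_num)⟩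
  have hb2 : √(∑ j, (x j - x' j) ^ 2) ≤ 1 / 3 :=
    Real.sqrt_le_iff.2 ⟨by norm_num, hxx.trans (by norm_num)⟩
  have hb3 : √(∑ j, x j ^ 2) ≤ 1 := Real.sqrt_le_one.2 hx
  have hb4 : √(∑ j, y' j ^ 2) ≤ 1 := Real.sqrt_le_one.2 hy'
  have b1 := sum_mul_sum_mul_le_norm A x (fun j => y j - y' j)
  have b2 := sum_mul_sum_mul_le_norm A (fun k => x k - x' k) y'
  have b1' : ‖A‖ * √(∑ j, (y j - y' j) ^ 2) * √(∑ j, x j ^ 2) ≤ ‖A‖ * (1 / 3) * 1 := by gcongr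
  have b2' : ‖A‖ * √(∑ j, y' j ^ 2) * √(∑ j, (x j - x' j) ^ 2) ≤ ‖A‖ * 1 * (1 / 3) := by gcongr
  rw [e2]
  linarith

theorem prod_ite_exp_eq {σ : Type*} [Fintype σ] (c : σ → Bool) (h : ℝ) :
    (∏ a, if c a then Real.exp h else 1) =
      Real.exp (h * (Finset.univ.filter fun a => c a = true).card) := by
  rw [Finset.prod_ite]
  simp only [Finset.prod_const, one_pow, mul_one]
  rw [← Real.exp_nat_mul, mul_comm]

/-- Only the at most S unmasked rows and columns matter, so a net with e^{O(S)} points suffices, and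
on each point the bilinear form is subgaussian. -/
theorem sum_bernWeight_exp_norm_le (c : ι → Bool) (d : κ → Bool) {S : ℝ} (hS : 0 < S)
    (hcd : ((Finset.univ.filter fun a => c a = true).card : ℝ) +
      (Finset.univ.filter fun b => d b = true).card ≤ S) :
    ∑ Y : ι → κ → Bool, (∏ a, ∏ b, bernWeight (1 / 3) (Y a b)) *
      Real.exp (√S * ‖maskedMatrix c d Y‖ / 3) ≤ Real.exp (24 * S) := by
  obtain ⟨S1, hS1, hc1⟩ := exists_finset_lattice_points
    (Finset.univ.filter fun a => c a = true) (ρ := 9 * S) one_pos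
  obtain ⟨S2, hS2, hc2⟩ := exists_finset_lattice_points
    (Finset.univ.filter fun b => d b = true) (ρ := 9 * S) one_pos
  have hs : 0 < √S := Real.sqrt_pos.2 hS
  set g : (ι → κ → Bool) → (ι → ℤ) × (κ → ℤ) → ℝ := fun Y e =>
    ∑ a, ∑ b, ((e.1 a : ℝ) / (3 * √S)) * maskedMatrix c d Y a b * ((e.2 b : ℝ) / (3 * √S)) with hg
  have key : ∀ Y, ∃ e ∈ S1 ×ˢ S2, ‖maskedMatrix c d Y‖ / 3 ≤ g Y e := by
    intro Y
    have h0 : ((0 : ι → ℤ), (0 : κ → ℤ)) ∈ S1 ×ˢ S2 := by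
      rw [Finset.mem_product, hS1, hS2]
      simp [hS.le]
    obtain ⟨e, he, hmax⟩ := Finset.exists_max_image (S1 ×ˢ S2) (g Y) ⟨_, h0⟩
    refine ⟨e, he, ?_⟩
    have hge : 0 ≤ g Y e := by
      refine le_trans (le_of_eq ?_) (hmax _ h0)
      simp [hg]
    set A := maskedMatrix c d Y with hA
    have hn : ‖A‖ ≤ g Y e + 2 / 3 * ‖A‖ := by
      refine norm_le_of_sum_mul_sum_mul_le A (by positivity) fun x y hx hy => ?_
      set u : ι → ℤ := fun a => if c a then roundZero (3 * √S * y a) else 0 with hu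
      set v : κ → ℤ := fun b => if d b then roundZero (3 * √S * x b) else 0 with hv
      have huv : (u, v) ∈ S1 ×ˢ S2 := by
        rw [Finset.mem_product, hS1, hS2]
        refine ⟨⟨fun a ha => ?_, sum_sq_round_le c hS hy⟩, fun b hb => ?_, sum_sq_round_le d hS hx⟩
        · simp only [Finset.mem_filter_univ] at ha
          simp [hu, ha]
        · simp only [Finset.mem_filter_univ] at hb
          simp [hv, hb]
      have hcard1 : ((Finset.univ.filter fun a => c a = true).card : ℝ) ≤ S :=
        le_trans (le_add_of_nonneg_right (Nat.cast_nonneg _)) hcd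
      have hcard2 : ((Finset.univ.filter fun b => d b = true).card : ℝ) ≤ S :=
        le_trans (le_add_of_nonneg_left (Nat.cast_nonneg _)) hcd
      have e1 : ∑ j, ∑ k, y j * A j k * x k =
          ∑ j, ∑ k, (if c j then y j else 0) * A j k * (if d k then x k else 0) := by
        refine Finset.sum_congr rfl fun j _ => Finset.sum_congr rfl fun k _ => ?_
        by_cases h1 : c j = true <;> by_cases h2 : d k = true <;>
          simp [hA, maskedMatrix, h1, h2]
      have hb3 : ∑ k, (if d k then x k else 0) ^ 2 ≤ 1 := by
        refine le_trans (Finset.sum_le_sum fun k _ => ?_) hx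
        split_ifs
        · exact le_rfl
        · simpa using sq_nonneg (x k)
      have hb4 : ∑ j, ((u j : ℝ) / (3 * √S)) ^ 2 ≤ 1 := by
        simp only [div_pow]
        rw [← Finset.sum_div, div_le_one (by positivity), mul_pow, Real.sq_sqrt hS.le]
        have := sum_sq_round_le c hS hy
        linarith
      rw [e1]
      refine (sum_mul_sum_mul_le_of_near A hb3 hb4 (sum_sq_sub_round_le hS hcard2 x)
        (sum_sq_sub_round_le hS hcard1 y)).trans ?_
      have b3 : g Y (u, v) ≤ g Y e := hmax _ huv
      exact add_le_add b3 le_rfl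
    linarith
  have hexp : ∀ Y, Real.exp (√S * ‖maskedMatrix c d Y‖ / 3) ≤
      ∑ e ∈ S1 ×ˢ S2, Real.exp (√S * g Y e) := by
    intro Y
    obtain ⟨e, he, h⟩ := key Y
    refine le_trans ?_ (Finset.single_le_sum (f := fun e => Real.exp (√S * g Y e))
      (fun e _ => (Real.exp_pos _).le) he)
    refine Real.exp_le_exp.2 ?_
    rw [mul_div_assoc]
    gcongr
  have hw : ∀ Y : ι → κ → Bool, 0 ≤ ∏ a, ∏ b, bernWeight (1 / 3) (Y a b) := fun Y =>
    Finset.prod_nonneg fun a _ => Finset.prod_nonneg fun b _ =>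
      bernWeight_nonneg (by norm_num) (by norm_num) _
  calc _ ≤ ∑ Y : ι → κ → Bool, (∏ a, ∏ b, bernWeight (1 / 3) (Y a b)) *
        ∑ e ∈ S1 ×ˢ S2, Real.exp (√S * g Y e) :=
        Finset.sum_le_sum fun Y _ => mul_le_mul_of_nonneg_left (hexp Y) (hw Y)
    _ = ∑ e ∈ S1 ×ˢ S2, ∑ Y : ι → κ → Bool, (∏ a, ∏ b, bernWeight (1 / 3) (Y a b)) *
        Real.exp (√S * g Y e) := by
        simp only [Finset.mul_sum]
        exact Finset.sum_comm
    _ ≤ ∑ e ∈ S1 ×ˢ S2, Real.exp (4 * S) := by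
        refine Finset.sum_le_sum fun e he => ?_
        rw [Finset.mem_product, hS1, hS2] at he
        have hu : ∑ a, ((e.1 a : ℝ) / (3 * √S)) ^ 2 ≤ 1 := by
          simp only [div_pow]
          rw [← Finset.sum_div, div_le_one (by positivity), mul_pow, Real.sq_sqrt hS.le]
          linarith [he.1.2]
        have hv : ∑ a, ((e.2 a : ℝ) / (3 * √S)) ^ 2 ≤ 1 := by
          simp only [div_pow]
          rw [← Finset.sum_div, div_le_one (by positivity), mul_pow, Real.sq_sqrt hS.le]
          linarith [he.2.2]
        have := sum_bernWeight_exp_le c d _ _ (√S) hu hv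
        rwa [Real.sq_sqrt hS.le] at this
    _ = (S1.card * S2.card : ℝ) * Real.exp (4 * S) := by
        rw [Finset.sum_const, nsmul_eq_mul, Finset.card_product]; push_cast; rfl
    _ ≤ (Real.exp (1 ^ 2 * (9 * S)) * (1 + 3 / 1) ^
          (Finset.univ.filter fun a => c a = true).card) *
        (Real.exp (1 ^ 2 * (9 * S)) * (1 + 3 / 1) ^
          (Finset.univ.filter fun b => d b = true).card) * Real.exp (4 * S) := by gcongr
    -- 24 = 9 + 9 from the two balls, 2 from 4 ≤ e² for each of the at most S unmasked rows and
    -- columns, and 4 from the subgaussian bound.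
    _ ≤ Real.exp (24 * S) := by
        have h4 : ∀ n : ℕ, (1 + 3 / 1 : ℝ) ^ n ≤ Real.exp (2 * n) := by
          intro n
          have h5 : (1 + 3 / 1 : ℝ) ≤ Real.exp 2 := by
            have := Real.add_one_le_exp (1 : ℝ)
            rw [show (2 : ℝ) = 1 + 1 by norm_num, Real.exp_add]
            nlinarith
          rw [show (2 : ℝ) * n = n * 2 by ring, Real.exp_nat_mul]
          gcongr
        calc _ ≤ (Real.exp (1 ^ 2 * (9 * S)) *
              Real.exp (2 * (Finset.univ.filter fun a => c a = true).card)) *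
            (Real.exp (1 ^ 2 * (9 * S)) *
              Real.exp (2 * (Finset.univ.filter fun b => d b = true).card)) * Real.exp (4 * S) := by
              gcongr
              · exact h4 _
              · exact h4 _
          _ ≤ _ := by
              simp only [← Real.exp_add]
              refine Real.exp_le_exp.2 ?_
              linarith

theorem sum_bernWeight_norm_pow_le (c : ι → Bool) (d : κ → Bool) {S : ℝ} {k : ℕ} (hk : 0 < k)
    (hcd : ((Finset.univ.filter fun a => c a = true).card : ℝ) +
      (Finset.univ.filter fun b => d b = true).card + k ≤ S) :
    ∑ Y : ι → κ → Bool, (∏ a, ∏ b, bernWeight (1 / 3) (Y a b)) *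
      ‖maskedMatrix c d Y‖ ^ (2 * k) ≤ 2 * (5184 * S) ^ k := by
  have hk' : (1 : ℝ) ≤ k := by exact_mod_cast hk
  have hkS : (k : ℝ) ≤ S := le_trans (by
    have : (0:ℝ) ≤ ((Finset.univ.filter fun a => c a = true).card : ℝ) +
      (Finset.univ.filter fun b => d b = true).card := by positivity
    linarith) hcd
  have hS : 0 < S := by linarith
  have hs : 0 < √S := Real.sqrt_pos.2 hS
  -- With z = 72√S · y one has 72² = 5184 and √S · z / 3 = 24Sy. For y ≤ 1 the power y^(2k) is at
  -- most 1; for y > 1 it is at most exp(2k(y − 1)) ≤ exp(24S(y − 1)), since k ≤ S.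
  have hpt : ∀ z : ℝ, 0 ≤ z → z ^ (2 * k) ≤
      (5184 * S) ^ k * (1 + Real.exp (-(24 * S)) * Real.exp (√S * z / 3)) := by
    intro z hz
    set y := z / (72 * √S) with hy
    have hz' : z = 72 * √S * y := by rw [hy]; field_simp
    have hy0 : 0 ≤ y := by positivity
    have h1 : z ^ (2 * k) = (5184 * S) ^ k * y ^ (2 * k) := by
      rw [hz', mul_pow, pow_mul, pow_mul, mul_pow, Real.sq_sqrt hS.le]
      norm_num
    rw [h1]
    refine mul_le_mul_of_nonneg_left ?_ (by positivity)
    rcases le_or_gt y 1 with h | h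
    · have : y ^ (2 * k) ≤ 1 := pow_le_one₀ hy0 h
      have : 0 < Real.exp (-(24 * S)) * Real.exp (√S * z / 3) := by positivity
      linarith
    · have h2 : y ^ (2 * k) ≤ Real.exp ((2 * k : ℕ) * (y - 1)) := by
        rw [Real.exp_nat_mul]
        gcongr
        linarith [Real.add_one_le_exp (y - 1)]
      have h3 : Real.exp ((2 * k : ℕ) * (y - 1)) ≤
          Real.exp (-(24 * S)) * Real.exp (√S * z / 3) := by
        rw [← Real.exp_add]
        refine Real.exp_le_exp.2 ?_
        have h4 : √S * z / 3 = 24 * S * y := by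
          rw [hz']
          have := Real.mul_self_sqrt hS.le
          linear_combination 24 * y * this
        rw [h4]
        push_cast
        nlinarith
      linarith
  have hw : ∀ Y : ι → κ → Bool, 0 ≤ ∏ a, ∏ b, bernWeight (1 / 3) (Y a b) := fun Y =>
    Finset.prod_nonneg fun a _ => Finset.prod_nonneg fun b _ =>
      bernWeight_nonneg (by norm_num) (by norm_num) _
  have hone : ∑ Y : ι → κ → Bool, ∏ a, ∏ b, bernWeight (1 / 3) (Y a b) = 1 := by
    have := sum_prod_prod_bernWeight_mul (ι := ι) (κ := κ) (1 / 3) (fun _ _ _ => 1)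
    simpa using this
  have hE := sum_bernWeight_exp_norm_le c d hS (by linarith)
  calc _ ≤ ∑ Y : ι → κ → Bool, (∏ a, ∏ b, bernWeight (1 / 3) (Y a b)) * ((5184 * S) ^ k *
        (1 + Real.exp (-(24 * S)) * Real.exp (√S * ‖maskedMatrix c d Y‖ / 3))) :=
        Finset.sum_le_sum fun Y _ => mul_le_mul_of_nonneg_left (hpt _ (norm_nonneg _)) (hw Y)
    _ = (5184 * S) ^ k * (∑ Y : ι → κ → Bool, (∏ a, ∏ b, bernWeight (1 / 3) (Y a b)) +
        Real.exp (-(24 * S)) * ∑ Y : ι → κ → Bool, (∏ a, ∏ b, bernWeight (1 / 3) (Y a b)) *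
          Real.exp (√S * ‖maskedMatrix c d Y‖ / 3)) := by
        rw [Finset.mul_sum, ← Finset.sum_add_distrib, Finset.mul_sum]
        refine Finset.sum_congr rfl fun Y _ => by ring
    _ ≤ (5184 * S) ^ k * (1 + Real.exp (-(24 * S)) * Real.exp (24 * S)) := by
        rw [hone]
        gcongr
    _ = _ := by
        rw [← Real.exp_add]; simp; ring

/-- The moments of the operator norm of the masked matrix of signs. -/
theorem maskedAverage_trace_le {q L : ℝ} (h0 : 0 < q) (h1 : q ≤ 1) {k : ℕ} (hk : 0 < k)
    (hι : (Fintype.card ι : ℝ) ≤ L) (hκ : (Fintype.card κ : ℝ) ≤ L) (hkL : k ≤ L * q) :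
    maskedAverage q (fun c d (Y : ι → κ → Bool) =>
      ((maskedMatrix c d Y * (maskedMatrix c d Y)ᵀ) ^ k).trace) ≤
      Fintype.card ι * (2 * (5184 * Real.exp 5 * (L * q)) ^ k) := by
  have hk' : (1 : ℝ) ≤ k := by exact_mod_cast hk
  have hLq : 0 < L * q := by linarith
  have hL : 0 < L := pos_of_mul_pos_left hLq h0.le
  -- The tilt h converts the k-th power of S, the number of unmasked rows and columns plus k, into
  -- an exponential moment: S^k ≤ (Lq)^k exp(hS). Since h ≤ 1, the rows, the columns and the summand
  -- k of S contribute at most e^{2k}, e^{2k} and e^k, whence the factor e⁵.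
  set h : ℝ := k / (L * q) with hh
  have hh0 : 0 ≤ h := by positivity
  have hh1 : h ≤ 1 := (div_le_one hLq).2 hkL
  have hwc : ∀ (c : ι → Bool), 0 ≤ ∏ a, bernWeight q (c a) := fun c =>
    Finset.prod_nonneg fun a _ => bernWeight_nonneg h0.le h1 _
  have hwd : ∀ (c : κ → Bool), 0 ≤ ∏ a, bernWeight q (c a) := fun c =>
    Finset.prod_nonneg fun a _ => bernWeight_nonneg h0.le h1 _
  have hw : ∀ Y : ι → κ → Bool, 0 ≤ ∏ a, ∏ b, bernWeight (1 / 3) (Y a b) := fun Y =>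
    Finset.prod_nonneg fun a _ => Finset.prod_nonneg fun b _ =>
      bernWeight_nonneg (by norm_num) (by norm_num) _
  have hpt : ∀ (c : ι → Bool) (d : κ → Bool),
      ∑ Y : ι → κ → Bool, (∏ a, ∏ b, bernWeight (1 / 3) (Y a b)) *
        ((maskedMatrix c d Y * (maskedMatrix c d Y)ᵀ) ^ k).trace ≤
      Fintype.card ι * (2 * (5184 * (L * q)) ^ k * (Real.exp k *
        ((∏ a, if c a then Real.exp h else 1) * ∏ b, if d b then Real.exp h else 1))) := by
    intro c d
    set S : ℝ := ((Finset.univ.filter fun a => c a = true).card : ℝ) +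
      (Finset.univ.filter fun b => d b = true).card + k with hS
    have e1 := sum_bernWeight_norm_pow_le c d (S := S) hk le_rfl
    have hS0 : 0 ≤ S := by positivity
    have e2 : S ^ k ≤ (L * q) ^ k * (Real.exp k *
        ((∏ a, if c a then Real.exp h else 1) * ∏ b, if d b then Real.exp h else 1)) := by
      have e3 : S = L * q * (S / (L * q)) := by field_simp
      have e4 : (S / (L * q)) ^ k ≤ Real.exp (h * S) := by
        rw [show h * S = k * (S / (L * q)) by rw [hh]; ring, Real.exp_nat_mul]
        exact pow_le_pow_left₀ (div_nonneg hS0 hLq.le)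
          (by linarith [Real.add_one_le_exp (S / (L * q))]) k
      have e6 : Real.exp (h * S) ≤ Real.exp k * ((∏ a, if c a then Real.exp h else 1) *
          ∏ b, if d b then Real.exp h else 1) := by
        rw [prod_ite_exp_eq, prod_ite_exp_eq, ← Real.exp_add, ← Real.exp_add]
        refine Real.exp_le_exp.2 ?_
        rw [hS]
        nlinarith
      calc S ^ k = (L * q) ^ k * (S / (L * q)) ^ k := by rw [← mul_pow, ← e3]
        _ ≤ (L * q) ^ k * Real.exp (h * S) := by gcongr
        _ ≤ _ := by gcongr
    calc _ ≤ ∑ Y : ι → κ → Bool, (∏ a, ∏ b, bernWeight (1 / 3) (Y a b)) *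
          (Fintype.card ι * ‖maskedMatrix c d Y‖ ^ (2 * k)) :=
          Finset.sum_le_sum fun Y _ =>
            mul_le_mul_of_nonneg_left (trace_mul_transpose_pow_le _ k) (hw Y)
      _ = Fintype.card ι * ∑ Y : ι → κ → Bool, (∏ a, ∏ b, bernWeight (1 / 3) (Y a b)) *
          ‖maskedMatrix c d Y‖ ^ (2 * k) := by
          rw [Finset.mul_sum]
          refine Finset.sum_congr rfl fun Y _ => by ring
      _ ≤ Fintype.card ι * (2 * (5184 * S) ^ k) := by gcongr
      _ = Fintype.card ι * (2 * (5184 ^ k * S ^ k)) := by rw [mul_pow]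
      _ ≤ Fintype.card ι * (2 * (5184 ^ k * ((L * q) ^ k * (Real.exp k *
        ((∏ a, if c a then Real.exp h else 1) * ∏ b, if d b then Real.exp h else 1))))) := by
          gcongr
      _ = _ := by rw [mul_pow]; ring
  have hmgf : ∀ m : ℕ, (m : ℝ) ≤ L → (q * Real.exp h + (1 - q) * 1) ^ m ≤ Real.exp (2 * k) := by
    intro m hm
    have f1 : Real.exp h ≤ 1 + 2 * h := by
      have := (abs_le.1 (Real.abs_exp_sub_one_sub_id_le (by rwa [abs_of_nonneg hh0]))).2
      nlinarith
    have f2 : q * Real.exp h + (1 - q) * 1 ≤ Real.exp (2 * h * q) := by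
      refine le_trans ?_ (Real.add_one_le_exp _)
      nlinarith
    have f3 : 0 ≤ q * Real.exp h + (1 - q) * 1 := by
      have := Real.exp_pos h
      have : 0 ≤ q * Real.exp h := by positivity
      linarith
    calc _ ≤ Real.exp (2 * h * q) ^ m := by gcongr
      _ = Real.exp (m * (2 * h * q)) := by rw [Real.exp_nat_mul]
      _ ≤ _ := by
          refine Real.exp_le_exp.2 ?_
          have f4 : h * (L * q) = k := by rw [hh]; field_simp
          have f5 : (m : ℝ) * (2 * h * q) ≤ L * (2 * h * q) := by gcongr
          linarith
  unfold maskedAverage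
  calc _ ≤ ∑ c : ι → Bool, ∑ d : κ → Bool, (∏ a, bernWeight q (c a)) * (∏ b, bernWeight q (d b)) *
      (Fintype.card ι * (2 * (5184 * (L * q)) ^ k * (Real.exp k *
        ((∏ a, if c a then Real.exp h else 1) * ∏ b, if d b then Real.exp h else 1)))) :=
        Finset.sum_le_sum fun c _ => Finset.sum_le_sum fun d _ =>
          mul_le_mul_of_nonneg_left (hpt c d) (mul_nonneg (hwc c) (hwd d))
    _ = Fintype.card ι * (2 * (5184 * (L * q)) ^ k * (Real.exp k *
        ((∑ c : ι → Bool, (∏ a, bernWeight q (c a)) * ∏ a, if c a then Real.exp h else 1) *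
          ∑ d : κ → Bool, (∏ b, bernWeight q (d b)) * ∏ b, if d b then Real.exp h else 1))) := by
        have hK : ∀ (K : ℝ) (f : (ι → Bool) → ℝ) (g : (κ → Bool) → ℝ) (f' : (ι → Bool) → ℝ)
            (g' : (κ → Bool) → ℝ), ∑ c, ∑ d, f c * g d * (K * (f' c * g' d)) =
            K * ((∑ c, f c * f' c) * ∑ d, g d * g' d) := by
          intro K f g f' g'
          rw [Finset.sum_mul_sum, Finset.mul_sum]
          refine Finset.sum_congr rfl fun c _ => ?_
          rw [Finset.mul_sum]
          exact Finset.sum_congr rfl fun d _ => by ring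
        simp only [← mul_assoc (Fintype.card ι : ℝ), ← mul_assoc _ (Real.exp k)]
        exact hK _ _ _ _ _
    _ = Fintype.card ι * (2 * (5184 * (L * q)) ^ k * (Real.exp k *
        ((q * Real.exp h + (1 - q) * 1) ^ Fintype.card ι *
          (q * Real.exp h + (1 - q) * 1) ^ Fintype.card κ))) := by
        rw [sum_prod_bernWeight_mul q (fun (_ : ι) c => if c then Real.exp h else 1),
          sum_prod_bernWeight_mul q (fun (_ : κ) c => if c then Real.exp h else 1)]
        simp
    _ ≤ Fintype.card ι * (2 * (5184 * (L * q)) ^ k * (Real.exp k *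
        (Real.exp (2 * k) * Real.exp (2 * k)))) := by
        have f3 : 0 ≤ q * Real.exp h + (1 - q) * 1 := by
          have : 0 ≤ q * Real.exp h := by positivity
          linarith
        gcongr
        · exact hmgf _ hι
        · exact hmgf _ hκ
    _ = _ := by
        rw [← Real.exp_add, ← Real.exp_add, show (k : ℝ) + (2 * k + 2 * k) = k * 5 by ring,
          Real.exp_nat_mul, mul_assoc 2, ← mul_pow]
        ring_nf

end SignMatrix

/-! ### Operator norm of a bounded sparse matrix -/

section OperatorNormBound

open Matrix
open scoped Matrix.Norms.L2Operator

variable {ι κ : Type*} [Fintype ι] [Fintype κ] [DecidableEq ι] [DecidableEq κ]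

theorem measurePreserving_matMeasure {ν ν' : ι → κ → Measure ℝ}
    [∀ j k, IsProbabilityMeasure (ν j k)] [∀ j k, IsProbabilityMeasure (ν' j k)]
    {f : ι → κ → ℝ → ℝ} (hf : ∀ j k, MeasurePreserving (f j k) (ν j k) (ν' j k)) :
    MeasurePreserving (fun (A : ι → κ → ℝ) j k => f j k (A j k)) (matMeasure ν)
      (matMeasure ν') :=
  measurePreserving_pi _ _ (f := fun j (x : κ → ℝ) k => f j k (x k)) fun j =>
    measurePreserving_pi _ _ (hf j)

theorem integrable_trace_pow {ν : ι → κ → Measure ℝ} [∀ j k, IsProbabilityMeasure (ν j k)]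
    (hint : ∀ j k (m : ℕ), Integrable (fun u => u ^ m) (ν j k)) (k : ℕ) :
    Integrable (fun A => ((Matrix.of A * (Matrix.of A)ᵀ) ^ k).trace) (matMeasure ν) := by
  simp only [Matrix.trace, Matrix.diag_apply, mul_transpose_pow_apply]
  refine integrable_finsetSum _ fun j _ => integrable_finsetSum _ fun s _ => ?_
  by_cases h : walkEnd k j s = j
  · simp only [h, if_true]
    refine Integrable.fintype_prod (f := fun a (x : κ → ℝ) => ∏ b, x b ^ walkExp k j s a b)
      fun a => ?_
    exact Integrable.fintype_prod (f := fun b (x : ℝ) => x ^ walkExp k j s a b) fun b => hint a b _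
  · simp [h]

theorem SparseLaw.abs_mean_le {ν : Measure ℝ} [IsProbabilityMeasure ν] {N p b M : ℝ}
    (h : SparseLaw ν N p b M) : |∫ u, u ∂ν| ≤ b := by
  have := norm_integral_le_of_norm_le_const (μ := ν) (f := fun u : ℝ => u) (C := b) h.abs_le
  simpa using this

theorem SparseLaw.abs_centered_moment_le {ν : Measure ℝ} [IsProbabilityMeasure ν] {N p b M : ℝ}
    (h : SparseLaw ν N p b M) (hb : 0 < b) {m : ℕ} (hm : 2 ≤ m) :
    |∫ u, (u - ∫ v, v ∂ν) ^ m ∂ν| ≤ (2 * b) ^ m * (p / b ^ 2) := by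
  set c := ∫ v, v ∂ν with hc
  have i1 : Integrable (fun u : ℝ => u) ν := by simpa using h.integrable_pow 1
  have i2 := h.integrable_pow 2
  have e : ∀ u : ℝ, (u - c) ^ 2 = u ^ 2 - 2 * c * u + c ^ 2 := fun u => by ring
  have j2 : Integrable (fun u : ℝ => (u - c) ^ 2) ν := by
    simp only [e]
    exact (i2.sub (i1.const_mul _)).add (integrable_const _)
  have hvar : ∫ u, (u - c) ^ 2 ∂ν ≤ 2 * p := by
    simp only [e]
    have h1 : ∫ u, (u ^ 2 - 2 * c * u + c ^ 2) ∂ν = ∫ u, u ^ 2 ∂ν - 2 * c * c + c ^ 2 := by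
      have hi : Integrable (fun u : ℝ => u ^ 2 - 2 * c * u) ν := i2.sub (i1.const_mul _)
      rw [integral_add hi (integrable_const _), integral_sub i2 (i1.const_mul _), integral_const_mul, ← hc]
      simp
    rw [h1]
    nlinarith [h.second_moment_le, sq_nonneg c]
  obtain ⟨l, rfl⟩ := Nat.exists_eq_add_of_le hm
  calc |∫ u, (u - c) ^ (2 + l) ∂ν| ≤ ∫ u, |(u - c) ^ (2 + l)| ∂ν := abs_integral_le_integral_abs
    _ ≤ ∫ u, (2 * b) ^ l * (u - c) ^ 2 ∂ν := by
        refine integral_mono_of_nonneg (Eventually.of_forall fun u => abs_nonneg _)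
          (j2.const_mul _) ?_
        filter_upwards [h.abs_le] with u hu
        have h2 : |u - c| ≤ 2 * b := by
          have := abs_sub u c
          have := h.abs_mean_le
          linarith
        simp only [abs_pow]
        rw [pow_add, sq_abs, mul_comm]
        gcongr
    _ = (2 * b) ^ l * ∫ u, (u - c) ^ 2 ∂ν := integral_const_mul _ _
    _ ≤ (2 * b) ^ l * (2 * p) := by gcongr
    _ ≤ (2 * b) ^ l * (4 * p) := by
        have : 0 ≤ ∫ u, (u - c) ^ 2 ∂ν := integral_nonneg fun u => sq_nonneg _
        exact mul_le_mul_of_nonneg_left (by linarith) (by positivity)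
    _ = _ := by
        rw [pow_add]; field_simp; ring

/-- A bound for the operator norm of a sparse random matrix. -/
theorem matMeasure_opNorm_gt_le {ν : ι → κ → Measure ℝ} [∀ j k, IsProbabilityMeasure (ν j k)]
    {N p b M : ℝ} (hν : ∀ j k, SparseLaw (ν j k) N p b M) (hp : 0 < p) (hb : 0 < b)
    (hpb : p ≤ b ^ 2) (hN : 0 < N) (hι : (Fintype.card ι : ℝ) ≤ N) (hκ : (Fintype.card κ : ℝ) ≤ N)
    {r : ℕ} (hr : (2 : ℝ) ^ (r + 1) ≤ N * (p / b ^ 2)) :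
    matMeasure ν {A | ∃ x : κ → ℝ, (144 * Real.exp 3 + 1) ^ 2 * (N * p) * ∑ k, x k ^ 2 <
      ∑ j, (∑ k, A j k * x k) ^ 2} ≤
    ENNReal.ofReal (2 * N * (b ^ 2 / p) * Real.exp (-(2 : ℝ) ^ (r + 1))) := by
  set c : ι → κ → ℝ := fun j k => ∫ u, u ∂(ν j k) with hc
  set D := N * p with hD
  have hDpos : 0 < D := by positivity
  set ν' : ι → κ → Measure ℝ := fun j k => (ν j k).map (fun u => u - c j k) with hν'
  have hmeas : ∀ j k, Measurable (fun u : ℝ => u - c j k) := fun j k => measurable_id.sub_const _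
  have : ∀ j k, IsProbabilityMeasure (ν' j k) := fun j k =>
    Measure.isProbabilityMeasure_map (hmeas j k).aemeasurable
  have hmp := measurePreserving_matMeasure (ν := ν) (ν' := ν') (f := fun j k u => u - c j k)
    fun j k => ⟨hmeas j k, rfl⟩
  set K : ℕ := 2 ^ (r + 1) with hK
  have hK0 : 0 < K := by positivity
  have hKr : (K : ℝ) = 2 ^ (r + 1) := by rw [hK]; push_cast; rfl
  have hmom : ∀ j k (m : ℕ), ∫ u, u ^ m ∂(ν' j k) = ∫ u, (u - c j k) ^ m ∂(ν j k) := by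
    intro j k m
    rw [hν', integral_map (hmeas j k).aemeasurable (by fun_prop)]
  have hint : ∀ j k (m : ℕ), Integrable (fun u => u ^ m) (ν' j k) := by
    intro j k m
    rw [hν', integrable_map_measure (by fun_prop) (hmeas j k).aemeasurable]
    refine Integrable.of_bound (C := (2 * b) ^ m)
      ((((measurable_id.sub_const _).pow_const m)).aestronglyMeasurable) ?_
    filter_upwards [(hν j k).abs_le] with u hu
    simp only [Function.comp_def, norm_pow, Real.norm_eq_abs]
    have := abs_sub u (c j k)
    have := (hν j k).abs_mean_le
    gcongr
    linarith
  have hq0 : 0 < p / b ^ 2 := by positivity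
  have hq1 : p / b ^ 2 ≤ 1 := (div_le_one (by positivity)).2 hpb
  -- The centred entries are at most 2b in absolute value and have second moment at most 2p, so they
  -- compare with entries of size 2b present with probability p/b².
  have htr := integral_trace_pow_le (ν := ν') (q := p / b ^ 2) (β := 2 * b) hq0 hq1 (by positivity)
    hint
    (fun j k => by
      have h1 := hmom j k 1
      simp only [pow_one] at h1
      have i1 : Integrable (fun u : ℝ => u) (ν j k) := by simpa using (hν j k).integrable_pow 1
      rw [h1, integral_sub i1 (integrable_const _)]
      simp [hc])
    (fun j k m hm => by rw [hmom]; exact (abs_le.1 ((hν j k).abs_centered_moment_le hb hm)).2)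
    (fun j k m hm => by rw [hmom]; exact (abs_le.1 ((hν j k).abs_centered_moment_le hb hm)).1) K
  have hmask := maskedAverage_trace_le (ι := ι) (κ := κ) hq0 hq1 hK0 hι hκ (by rw [hKr]; exact hr)
  set R : ℝ := (144 * Real.exp 3) ^ 2 * D with hR
  have hE : ∫ A, ((Matrix.of A * (Matrix.of A)ᵀ) ^ K).trace ∂(matMeasure ν') ≤
      2 * N * (b ^ 2 / p) * (20736 * Real.exp 5 * D) ^ K := by
    refine htr.trans ?_
    calc _ ≤ (2 * b) ^ (2 * K) * (p / b ^ 2)⁻¹ *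
          (N * (2 * (5184 * Real.exp 5 * (N * (p / b ^ 2))) ^ K)) := by
          refine mul_le_mul_of_nonneg_left (hmask.trans ?_) (by positivity)
          gcongr
      _ = 2 * N * (b ^ 2 / p) *
          (((2 * b) ^ 2) ^ K * (5184 * Real.exp 5 * (N * (p / b ^ 2))) ^ K) := by
          rw [pow_mul, inv_div]; ring
      _ = _ := by
          rw [← mul_pow]
          congr 2
          rw [hD]
          field_simp
          ring
  -- Here 144² = 20736 and e⁶ = e⁵ · e; the spare factor e, to the power K, is the probability
  -- gained by Markov's inequality.
  have hRK : R ^ K = (20736 * Real.exp 5 * D) ^ K * Real.exp (2 ^ (r + 1)) := by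
    rw [← hKr, ← Real.exp_one_pow, ← mul_pow, hR]
    congr 1
    have : Real.exp 3 ^ 2 = Real.exp 5 * Real.exp 1 := by
      rw [← Real.exp_nat_mul, ← Real.exp_add]; norm_num
    rw [mul_pow, this]
    ring
  have hmarkov := mul_meas_ge_le_integral_of_nonneg (μ := matMeasure ν')
    (f := fun A => ((Matrix.of A * (Matrix.of A)ᵀ) ^ K).trace)
    (Eventually.of_forall fun A => by
      refine le_trans ?_ (norm_pow_le_trace (Matrix.of A) r)
      positivity) (integrable_trace_pow hint K) (R ^ K)
  have hreal : (matMeasure ν').real {A | R ^ K ≤ ((Matrix.of A * (Matrix.of A)ᵀ) ^ K).trace} ≤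
      2 * N * (b ^ 2 / p) * Real.exp (-(2 : ℝ) ^ (r + 1)) := by
    have h1 := hmarkov.trans hE
    have hRpos : 0 < R ^ K := by positivity
    rw [mul_comm, ← le_div_iff₀ hRpos] at h1
    refine h1.trans (le_of_eq ?_)
    rw [hRK, Real.exp_neg]
    have : 0 < (20736 * Real.exp 5 * D) ^ K := by positivity
    field_simp
  have hsub : {A : ι → κ → ℝ | ∃ x : κ → ℝ, (144 * Real.exp 3 + 1) ^ 2 * D * ∑ k, x k ^ 2 <
      ∑ j, (∑ k, A j k * x k) ^ 2} ⊆
      (fun (A : ι → κ → ℝ) j k => A j k - c j k) ⁻¹'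
        {A | R ^ K ≤ ((Matrix.of A * (Matrix.of A)ᵀ) ^ K).trace} := by
    rintro A ⟨x, hx⟩
    rw [Set.mem_preimage, Set.mem_ofPred_eq]
    set B : Matrix ι κ ℝ := Matrix.of fun j k => A j k - c j k with hB
    refine le_trans ?_ (norm_pow_le_trace B r)
    rw [pow_mul]
    refine pow_le_pow_left₀ (by positivity) ?_ K
    by_contra hlt
    push Not at hlt
    have hBn : ‖B‖ ≤ 144 * Real.exp 3 * √D := by
      refine (sq_le_sq₀ (norm_nonneg _) (by positivity)).1 ?_
      rw [mul_pow, Real.sq_sqrt hDpos.le]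
      exact hlt.le
    -- By `sq_mean_le` the matrix of means has Hilbert–Schmidt norm at most √D; undoing the centring
    -- costs the summand 1 in the constant.
    have hC : ‖(Matrix.of c : Matrix ι κ ℝ)‖ ≤ √D := by
      refine norm_le_of_sum_mul_sum_mul_le _ (Real.sqrt_nonneg _) fun x y hx hy => ?_
      have h3 : ∑ i, ∑ j, y i * (Matrix.of c : Matrix ι κ ℝ) i j * x j =
          ∑ e : ι × κ, c e.1 e.2 * (y e.1 * x e.2) := by
        rw [Fintype.sum_prod_type]
        refine Finset.sum_congr rfl fun i _ => Finset.sum_congr rfl fun j _ => ?_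
        rw [Matrix.of_apply]; ring
      rw [h3]
      refine (Real.sum_mul_le_sqrt_mul_sqrt _ _ _).trans ?_
      have h4 : ∑ e : ι × κ, (y e.1 * x e.2) ^ 2 ≤ 1 := by
        simp only [mul_pow]
        rw [Fintype.sum_prod_type]
        simp only
        rw [← Finset.sum_mul_sum]
        exact mul_le_one₀ hy (Finset.sum_nonneg fun _ _ => sq_nonneg _) hx
      have h5 : ∑ e : ι × κ, c e.1 e.2 ^ 2 ≤ D := by
        calc ∑ e : ι × κ, c e.1 e.2 ^ 2 ≤ ∑ e : ι × κ, p / N :=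
              Finset.sum_le_sum fun e _ => (le_div_iff₀ hN).2 (hν _ _).sq_mean_le
          _ = Fintype.card ι * Fintype.card κ * (p / N) := by
              rw [Finset.sum_const, Finset.card_univ, Fintype.card_prod, nsmul_eq_mul]
              push_cast; ring
          _ ≤ N * N * (p / N) := by gcongr
          _ = D := by rw [hD]; field_simp
      calc _ ≤ √D * 1 := by
            gcongr
            exact Real.sqrt_le_one.2 h4
        _ = _ := mul_one _
    have hA : ‖(Matrix.of A : Matrix ι κ ℝ)‖ ≤ (144 * Real.exp 3 + 1) * √D := by
      have h6 : (Matrix.of A : Matrix ι κ ℝ) = B + Matrix.of c := by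
        ext j k; simp [hB]
      rw [h6]
      refine (norm_add_le _ _).trans ?_
      linarith
    have h7 := sum_sq_sum_mul_le_sq_norm (Matrix.of A) x
    simp only [Matrix.of_apply] at h7
    have h8 : ‖(Matrix.of A : Matrix ι κ ℝ)‖ ^ 2 ≤ (144 * Real.exp 3 + 1) ^ 2 * D := by
      have := pow_le_pow_left₀ (norm_nonneg _) hA 2
      rwa [mul_pow, Real.sq_sqrt hDpos.le] at this
    have h9 : ‖(Matrix.of A : Matrix ι κ ℝ)‖ ^ 2 * ∑ k, x k ^ 2 ≤
        (144 * Real.exp 3 + 1) ^ 2 * D * ∑ k, x k ^ 2 :=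
      mul_le_mul_of_nonneg_right h8 (Finset.sum_nonneg fun _ _ => sq_nonneg _)
    linarith
  calc _ ≤ matMeasure ν ((fun (A : ι → κ → ℝ) j k => A j k - c j k) ⁻¹'
        {A | R ^ K ≤ ((Matrix.of A * (Matrix.of A)ᵀ) ^ K).trace}) := measure_mono hsub
    _ ≤ matMeasure ν' {A | R ^ K ≤ ((Matrix.of A * (Matrix.of A)ᵀ) ^ K).trace} := by
        rw [← hmp.map_eq]
        exact Measure.le_map_apply hmp.measurable.aemeasurable _
    _ ≤ _ := by
        rw [← ofReal_measureReal]
        exact ENNReal.ofReal_le_ofReal hreal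

end OperatorNormBound

/-! ### Tent functions of the level -/

section Tents

/-- The tent function of half-width `H` with centre `c - H`, evaluated at `i`. -/
noncomputable def tent (H c i : ℕ) : ℝ := max 0 (1 - |(i : ℝ) + H - c| / H)

theorem tent_nonneg (H c i : ℕ) : 0 ≤ tent H c i := le_max_left _ _

theorem tent_le_one (H c i : ℕ) : tent H c i ≤ 1 :=
  max_le zero_le_one (by
    have : 0 ≤ |(i : ℝ) + H - c| / H := by positivity
    linarith)

theorem tent_eq_zero {H c i : ℕ} (hH : 0 < H) (h : ¬ (i < c ∧ c < i + 2 * H)) :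
    tent H c i = 0 := by
  have hH' : (0 : ℝ) < H := by exact_mod_cast hH
  refine max_eq_left ?_
  have : (1 : ℝ) ≤ |(i : ℝ) + H - c| / H := by
    rw [le_div_iff₀ hH', one_mul]
    rcases not_and_or.1 h with h | h
    · have : (c : ℝ) ≤ i := by exact_mod_cast not_lt.1 h
      exact le_trans (by linarith) (le_abs_self _)
    · have : (i : ℝ) + 2 * H ≤ c := by exact_mod_cast not_lt.1 h
      exact le_trans (by linarith) (neg_le_abs _)
  linarith

theorem abs_tent_sub_le {H : ℕ} (hH : 0 < H) (c i i' : ℕ) :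
    |tent H c i - tent H c i'| ≤ |(i : ℝ) - i'| / H := by
  have hH' : (0 : ℝ) < H := by exact_mod_cast hH
  rw [tent, tent, max_comm, max_comm (0 : ℝ)]
  refine (abs_max_sub_max_le_abs _ _ _).trans ?_
  rw [show 1 - |(i : ℝ) + H - c| / H - (1 - |(i' : ℝ) + H - c| / H) =
    (|(i' : ℝ) + H - c| - |(i : ℝ) + H - c|) / H by ring, abs_div, abs_of_pos hH']
  refine div_le_div_of_nonneg_right ?_ hH'.le
  refine (abs_abs_sub_abs_le _ _).trans (le_of_eq ?_)
  rw [abs_sub_comm]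
  congr 1
  ring

theorem sum_tent_support_le (H i n : ℕ) :
    ∑ c ∈ Finset.range n, (if i < c ∧ c < i + 2 * H then (1 : ℝ) else 0) ≤ 2 * H := by
  rw [← Finset.sum_filter, Finset.sum_const, nsmul_eq_mul, mul_one]
  have h1 : (Finset.range n).filter (fun c => i < c ∧ c < i + 2 * H) ⊆
      Finset.Ioo i (i + 2 * H) := by
    intro c hc
    rw [Finset.mem_filter] at hc
    exact Finset.mem_Ioo.2 hc.2
  have h2 := Finset.card_le_card h1
  rw [Nat.card_Ioo] at h2
  have h3 : ((Finset.range n).filter (fun c => i < c ∧ c < i + 2 * H)).card ≤ 2 * H := by omega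
  exact_mod_cast h3

theorem sum_tent_sq_le {H : ℕ} (hH : 0 < H) (i n : ℕ) :
    ∑ c ∈ Finset.range n, tent H c i ^ 2 ≤ 2 * H := by
  refine (Finset.sum_le_sum fun c _ => ?_).trans (sum_tent_support_le H i n)
  split_ifs with h
  · exact pow_le_one₀ (tent_nonneg _ _ _) (tent_le_one _ _ _)
  · simp [tent_eq_zero hH h]

/-- A tent has slope 1/H and only about 2H centres see a given level, so summing the squared
differences over the centres leaves a gain of 1/H. -/
theorem sum_tent_sub_sq_le {H : ℕ} (hH : 0 < H) (i i' n : ℕ) :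
    ∑ c ∈ Finset.range n, (tent H c i - tent H c i') ^ 2 ≤ 4 * ((i : ℝ) - i') ^ 2 / H := by
  have hH' : (0 : ℝ) < H := by exact_mod_cast hH
  have h1 : ∀ c, (tent H c i - tent H c i') ^ 2 ≤ (((i : ℝ) - i') / H) ^ 2 *
      ((if i < c ∧ c < i + 2 * H then (1 : ℝ) else 0) +
        (if i' < c ∧ c < i' + 2 * H then (1 : ℝ) else 0)) := by
    intro c
    have h2 : (tent H c i - tent H c i') ^ 2 ≤ (((i : ℝ) - i') / H) ^ 2 := by
      refine sq_le_sq.2 ?_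
      rw [abs_div, abs_of_pos hH']
      exact abs_tent_sub_le hH c i i'
    by_cases h : i < c ∧ c < i + 2 * H
    · rw [if_pos h]
      refine h2.trans (le_mul_of_one_le_right (sq_nonneg _) ?_)
      split_ifs <;> norm_num
    · by_cases h' : i' < c ∧ c < i' + 2 * H
      · rw [if_neg h, if_pos h']
        simpa using h2
      · rw [tent_eq_zero hH h, tent_eq_zero hH h', if_neg h, if_neg h']
        simp
  refine (Finset.sum_le_sum fun c _ => h1 c).trans ?_
  rw [← Finset.mul_sum, Finset.sum_add_distrib]
  have h3 := sum_tent_support_le H i n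
  have h4 := sum_tent_support_le H i' n
  calc _ ≤ (((i : ℝ) - i') / H) ^ 2 * (2 * H + 2 * H) := by gcongr
    _ = _ := by field_simp; ring

theorem le_sum_tent_sq {a i L : ℕ} (ha : 0 < a) (hi : i ≤ L) :
    (a : ℝ) / 2 ≤ ∑ c ∈ Finset.range (L + 2 * (2 * a) + 1), tent (2 * a) c i ^ 2 := by
  have ha' : (0 : ℝ) < a := by exact_mod_cast ha
  have h1 : Finset.Icc (i + a) (i + 3 * a) ⊆ Finset.range (L + 2 * (2 * a) + 1) := by
    intro c hc
    rw [Finset.mem_Icc] at hc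
    rw [Finset.mem_range]
    omega
  calc (a : ℝ) / 2 ≤ ∑ c ∈ Finset.Icc (i + a) (i + 3 * a), (1 / 2 : ℝ) ^ 2 := by
        rw [Finset.sum_const, Nat.card_Icc, nsmul_eq_mul,
          show i + 3 * a + 1 - (i + a) = 2 * a + 1 by omega]
        push_cast
        linarith
    _ ≤ ∑ c ∈ Finset.Icc (i + a) (i + 3 * a), tent (2 * a) c i ^ 2 := by
        refine Finset.sum_le_sum fun c hc => ?_
        rw [Finset.mem_Icc] at hc
        have hc1 : (i : ℝ) + a ≤ c := by exact_mod_cast hc.1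
        have hc2 : (c : ℝ) ≤ i + 3 * a := by exact_mod_cast hc.2
        refine pow_le_pow_left₀ (by norm_num) ?_ 2
        refine le_trans ?_ (le_max_right _ _)
        have : |(i : ℝ) + (2 * a : ℕ) - c| / (2 * a : ℕ) ≤ 1 / 2 := by
          push_cast
          rw [div_le_iff₀ (by positivity), abs_le]
          constructor <;> linarith
        linarith
    _ ≤ _ := Finset.sum_le_sum_of_subset_of_nonneg h1 fun _ _ _ => sq_nonneg _

end Tents

/-! ### From flat vectors to arbitrary vectors -/

section Localization

variable {ι κ : Type*} [Fintype ι] [Fintype κ] [DecidableEq κ]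

/-- The pieces of x on different levels have disjoint supports, so their squared norms add up to at
most that of x. -/
theorem sum_sum_level_sq_le {A : ι → κ → ℝ} {R : ℝ}
    (hA : ∀ w : κ → ℝ, ∑ j, (∑ k, A j k * w k) ^ 2 ≤ R * ∑ k, w k ^ 2) (x : κ → ℝ)
    (g : κ → ℕ) (S : Finset ℕ) (hR : 0 ≤ R) :
    ∑ j, ∑ i ∈ S, (∑ k, A j k * (if g k = i then x k else 0)) ^ 2 ≤ R * ∑ k, x k ^ 2 := by
  rw [Finset.sum_comm]
  refine (Finset.sum_le_sum fun i _ => hA _).trans ?_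
  rw [← Finset.mul_sum, Finset.sum_comm]
  refine mul_le_mul_of_nonneg_left (Finset.sum_le_sum fun k _ => ?_) hR
  have : ∀ i, (if g k = i then x k else 0) ^ 2 = if g k = i then x k ^ 2 else 0 := by
    intro i; split_ifs <;> simp
  simp only [this]
  rw [Finset.sum_ite_eq]
  split_ifs
  · exact le_rfl
  · positivity

/-- Localization of a vector to windows of neighbouring levels. -/
theorem sum_tent_localized_sq_le {A : ι → κ → ℝ} {R F : ℝ} (hR : 0 ≤ R)
    (hA : ∀ w : κ → ℝ, ∑ j, (∑ k, A j k * w k) ^ 2 ≤ R * ∑ k, w k ^ 2) (x : κ → ℝ)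
    (g : κ → ℕ) (h : ι → ℕ) (hgh : ∀ j k, A j k ≠ 0 → h j ≤ g k) {H d n : ℕ} (hH : 0 < H)
    (hF : ∑ j, (∑ k, if h j + d ≤ g k then |A j k * x k| else 0) ^ 2 ≤ F) :
    ∑ c ∈ Finset.range n, ∑ j, (∑ k, A j k * (tent H c (g k) * x k)) ^ 2 ≤
      4 * H * ∑ j, (∑ k, A j k * x k) ^ 2 + 16 * d ^ 3 / H * (R * ∑ k, x k ^ 2) + 4 * n * F := by
  have hH' : (0 : ℝ) < H := by exact_mod_cast hH
  set Y : ι → ℕ → ℝ := fun j i => ∑ k, A j k * (if g k = i then x k else 0) with hY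
  set far : ι → ℝ := fun j => ∑ k, if h j + d ≤ g k then |A j k * x k| else 0 with hfar
  have hfar0 : ∀ j, 0 ≤ far j := fun j => Finset.sum_nonneg fun k _ => by split_ifs <;> positivity
  -- Row j meets no level below `h j`. The tent is replaced by its value at `h j`; the error is
  -- split into the d nearest levels, where the tent has hardly changed, and the far levels, where x
  -- is tiny.
  have hdec : ∀ c j, ∑ k, A j k * (tent H c (g k) * x k) =
      tent H c (h j) * (∑ k, A j k * x k) +
      (∑ e ∈ Finset.range d, (tent H c (h j + e) - tent H c (h j)) * Y j (h j + e) +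
      ∑ k, if h j + d ≤ g k then (tent H c (g k) - tent H c (h j)) * (A j k * x k) else 0) := by
    intro c j
    simp only [hY, Finset.mul_sum]
    rw [Finset.sum_comm, ← Finset.sum_add_distrib, ← Finset.sum_add_distrib]
    refine Finset.sum_congr rfl fun k _ => ?_
    by_cases hAk : A j k = 0
    · simp [hAk]
    · have hle := hgh j k hAk
      by_cases hfk : h j + d ≤ g k
      · rw [if_pos hfk, Finset.sum_eq_zero]
        · ring
        · intro e he
          rw [Finset.mem_range] at he
          rw [if_neg (by omega)]
          simp
      · rw [if_neg hfk, Finset.sum_eq_single (g k - h j)]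
        · rw [if_pos (by omega), Nat.add_sub_cancel' hle]
          ring
        · intro e _ he
          rw [if_neg (by omega)]
          simp
        · intro hn
          rw [Finset.mem_range] at hn
          omega
  have hpt : ∀ c j, (∑ k, A j k * (tent H c (g k) * x k)) ^ 2 ≤
      2 * (tent H c (h j) ^ 2 * (∑ k, A j k * x k) ^ 2) +
      4 * ((∑ e ∈ Finset.range d, (tent H c (h j + e) - tent H c (h j)) ^ 2) *
        ∑ e ∈ Finset.range d, Y j (h j + e) ^ 2) + 4 * far j ^ 2 := by
    intro c j
    rw [hdec]
    set P := tent H c (h j) * (∑ k, A j k * x k)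
    have hQ := Finset.sum_mul_sq_le_sq_mul_sq (Finset.range d)
      (fun e => tent H c (h j + e) - tent H c (h j)) (fun e => Y j (h j + e))
    set Q := ∑ e ∈ Finset.range d, (tent H c (h j + e) - tent H c (h j)) * Y j (h j + e)
    set Z := ∑ k, if h j + d ≤ g k then (tent H c (g k) - tent H c (h j)) * (A j k * x k) else 0
      with hZdef
    have hZ : |Z| ≤ far j := by
      refine (Finset.abs_sum_le_sum_abs _ _).trans (Finset.sum_le_sum fun k _ => ?_)
      split_ifs
      · rw [abs_mul]
        refine mul_le_of_le_one_left (abs_nonneg _) ?_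
        rw [abs_le]
        constructor <;>
          linarith [tent_nonneg H c (g k), tent_le_one H c (g k), tent_nonneg H c (h j),
            tent_le_one H c (h j)]
      · simp
    have hZ2 : Z ^ 2 ≤ far j ^ 2 := sq_le_sq.2 (by rwa [abs_of_nonneg (hfar0 j)])
    have hP : P ^ 2 = tent H c (h j) ^ 2 * (∑ k, A j k * x k) ^ 2 := mul_pow _ _ _
    rw [← hP]
    nlinarith [sq_nonneg (P - (Q + Z)), sq_nonneg (Q - Z)]
  have hnear : ∀ j, ∑ c ∈ Finset.range n, ∑ e ∈ Finset.range d,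
      (tent H c (h j + e) - tent H c (h j)) ^ 2 ≤ 4 * d ^ 3 / H := by
    intro j
    rw [Finset.sum_comm]
    calc _ ≤ ∑ e ∈ Finset.range d, 4 * (d : ℝ) ^ 2 / H := by
          refine Finset.sum_le_sum fun e he => (sum_tent_sub_sq_le hH _ _ n).trans ?_
          have : (e : ℝ) ≤ d := by exact_mod_cast (Finset.mem_range.1 he).le
          push_cast
          rw [add_sub_cancel_left]
          gcongr
      _ = _ := by
          rw [Finset.sum_const, Finset.card_range, nsmul_eq_mul]; ring
  have hYsum : ∑ j, ∑ e ∈ Finset.range d, Y j (h j + e) ^ 2 ≤ R * ∑ k, x k ^ 2 := by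
    obtain ⟨m, hm⟩ : ∃ m, ∀ j, h j + d ≤ m :=
      ⟨∑ j, (h j + d), fun j => Finset.single_le_sum (f := fun j => h j + d)
        (fun _ _ => Nat.zero_le _) (Finset.mem_univ j)⟩
    refine le_trans (Finset.sum_le_sum fun j _ => ?_)
      (sum_sum_level_sq_le hA x g (Finset.range m) hR)
    have : ∑ e ∈ Finset.range d, Y j (h j + e) ^ 2 =
        ∑ i ∈ (Finset.range d).image (fun e => h j + e), Y j i ^ 2 := by
      rw [Finset.sum_image]
      intro a _ b _ hab
      simpa using hab
    rw [this]
    refine Finset.sum_le_sum_of_subset_of_nonneg ?_ fun _ _ _ => sq_nonneg _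
    intro i hi
    rw [Finset.mem_image] at hi
    obtain ⟨e, he, rfl⟩ := hi
    rw [Finset.mem_range] at he ⊢
    have := hm j
    omega
  rw [Finset.sum_comm]
  calc _ ≤ ∑ j, (4 * H * (∑ k, A j k * x k) ^ 2 +
        16 * d ^ 3 / H * ∑ e ∈ Finset.range d, Y j (h j + e) ^ 2 + 4 * n * far j ^ 2) := by
        refine Finset.sum_le_sum fun j _ => ?_
        refine (Finset.sum_le_sum fun c _ => hpt c j).trans ?_
        rw [Finset.sum_add_distrib, Finset.sum_add_distrib, ← Finset.mul_sum, ← Finset.sum_mul,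
          ← Finset.mul_sum, ← Finset.sum_mul, Finset.sum_const, Finset.card_range, nsmul_eq_mul]
        have e1 := mul_le_mul_of_nonneg_right (sum_tent_sq_le hH (h j) n)
          (sq_nonneg (∑ k, A j k * x k))
        have e2 := mul_le_mul_of_nonneg_right (hnear j)
          (Finset.sum_nonneg fun e (_ : e ∈ Finset.range d) => sq_nonneg (Y j (h j + e)))
        have e3 : 16 * (d : ℝ) ^ 3 / H * ∑ e ∈ Finset.range d, Y j (h j + e) ^ 2 =
          4 * (4 * (d : ℝ) ^ 3 / H * ∑ e ∈ Finset.range d, Y j (h j + e) ^ 2) := by ring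
        rw [e3]
        linarith
    _ = 4 * H * ∑ j, (∑ k, A j k * x k) ^ 2 +
        16 * d ^ 3 / H * ∑ j, ∑ e ∈ Finset.range d, Y j (h j + e) ^ 2 +
        4 * n * ∑ j, far j ^ 2 := by
        simp only [Finset.sum_add_distrib, Finset.mul_sum]
    _ ≤ _ := by gcongr

theorem card_mul_le_of_sum_le {x : κ → ℝ} (hx : ∑ k, x k ^ 2 = 1) {J : Finset κ} {r : ℝ}
    (hr : 0 < r) (hJ : ∀ k ∈ J, r⁻¹ ≤ x k ^ 2) : (J.card : ℝ) ≤ r := by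
  have h1 : (J.card : ℝ) * r⁻¹ ≤ 1 := by
    rw [← nsmul_eq_mul]
    calc _ ≤ ∑ k ∈ J, x k ^ 2 := Finset.card_nsmul_le_sum _ _ _ hJ
      _ ≤ ∑ k, x k ^ 2 := Finset.sum_le_sum_of_subset_of_nonneg (Finset.subset_univ _)
          fun _ _ _ => sq_nonneg _
      _ = 1 := hx
  rwa [← div_eq_mul_inv, div_le_one hr] at h1

/-- The level of a coordinate measures its size on a logarithmic scale. -/
theorem exists_column_levels {x : κ → ℝ} (hx : ∑ k, x k ^ 2 = 1) {lam : ℝ} (hlam : 1 ≤ lam)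
    (L : ℕ) : ∃ g : κ → ℕ, (∀ k, g k ≤ L) ∧ (∀ k, x k ^ 2 ≤ (lam ^ g k)⁻¹) ∧
      (∀ i < L, ((Finset.univ.filter fun k => g k = i).card : ℝ) ≤ lam ^ (i + 1)) ∧
      ((Finset.univ.filter fun k => g k ≠ L).card : ℝ) ≤ lam ^ L := by
  classical
  have hl : 0 < lam := by linarith
  -- The level is the first i with lam^{-(i+1)} < x_k², capped at L, so the level L collects all
  -- remaining small coordinates.
  have hex : ∀ k, ∃ i ≤ L, x k ^ 2 ≤ (lam ^ i)⁻¹ ∧ (i ≠ L → (lam ^ (i + 1))⁻¹ < x k ^ 2) := by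
    intro k
    have hP : ∃ i, i = L ∨ (lam ^ (i + 1))⁻¹ < x k ^ 2 := ⟨L, Or.inl rfl⟩
    refine ⟨Nat.find hP, Nat.find_min' hP (Or.inl rfl), ?_, fun h => (Nat.find_spec hP).resolve_left h⟩
    rcases Nat.eq_zero_or_pos (Nat.find hP) with h | h
    · rw [h, pow_zero, inv_one, ← hx]
      exact Finset.single_le_sum (f := fun k => x k ^ 2) (fun k _ => sq_nonneg _)
        (Finset.mem_univ k)
    · have := Nat.find_min hP (Nat.sub_lt h one_pos)
      push Not at this
      have h2 := this.2
      rwa [Nat.sub_one_add_one h.ne'] at h2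
  choose g hle hgx hgt using hex
  refine ⟨g, hle, hgx, ?_, ?_⟩
  · intro i hi
    refine card_mul_le_of_sum_le hx (by positivity) fun k hk => ?_
    rw [Finset.mem_filter_univ] at hk
    have := hgt k (by omega)
    rw [hk] at this
    exact this.le
  · refine card_mul_le_of_sum_le hx (by positivity) fun k hk => ?_
    rw [Finset.mem_filter_univ] at hk
    refine le_trans ?_ (hgt k hk).le
    have h3 : g k + 1 ≤ L := by
      have := hle k
      omega
    exact inv_anti₀ (by positivity) (pow_le_pow_right₀ hlam h3)

/-- The level of a row is the lowest level it meets, that is, the one of the largest coordinates of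
x in its support, or L. The last clause allows the rows of a given level to be counted through the
columns of that level. -/
theorem exists_row_levels (A : ι → κ → ℝ) (g : κ → ℕ) (L : ℕ) :
    ∃ h : ι → ℕ, (∀ j, h j ≤ L) ∧ (∀ j k, A j k ≠ 0 → h j ≤ g k) ∧
      ∀ j, h j < L → ∃ k, A j k ≠ 0 ∧ g k = h j := by
  classical
  have hex : ∀ j, ∃ i, i = L ∨ ∃ k, A j k ≠ 0 ∧ g k = i := fun j => ⟨L, Or.inl rfl⟩
  refine ⟨fun j => Nat.find (hex j), fun j => Nat.find_min' (hex j) (Or.inl rfl), ?_, ?_⟩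
  · intro j k hk
    exact Nat.find_min' (hex j) (Or.inr ⟨k, hk, rfl⟩)
  · intro j hj
    exact (Nat.find_spec (hex j)).resolve_left hj.ne

/-- A row of level i < L meets one of the at most lam^{i+1} columns of level i, and each column
meets at most Δ rows, so there are at most lam^{i+1}Δ such rows. The far part of each has at most Δ
terms with squares at most b²lam^{-(i+d)}. The powers lam^i cancel. A row of level L has no far
part. -/
theorem sum_far_sq_le {A : ι → κ → ℝ} {x : κ → ℝ} {g : κ → ℕ} {h : ι → ℕ} {L d Δ : ℕ} {lam b : ℝ}
    (hlam : 1 ≤ lam) (hd : 0 < d) (hb : ∀ j k, |A j k| ≤ b)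
    (hrow : ∀ j, (Finset.univ.filter fun k => A j k ≠ 0).card ≤ Δ)
    (hcol : ∀ k, (Finset.univ.filter fun j => A j k ≠ 0).card ≤ Δ)
    (hgL : ∀ k, g k ≤ L) (hgx : ∀ k, x k ^ 2 ≤ (lam ^ g k)⁻¹)
    (hgc : ∀ i < L, ((Finset.univ.filter fun k => g k = i).card : ℝ) ≤ lam ^ (i + 1))
    (hnb : ∀ j, h j < L → ∃ k, A j k ≠ 0 ∧ g k = h j) :
    ∑ j, (∑ k, if h j + d ≤ g k then |A j k * x k| else 0) ^ 2 ≤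
      L * (Δ ^ 3 * b ^ 2 * lam * (lam ^ d)⁻¹) := by
  classical
  have hl : 0 < lam := by linarith
  have hrowsum : ∀ j, (∑ k, if h j + d ≤ g k then |A j k * x k| else 0) ^ 2 ≤
      ∑ i ∈ Finset.range L, if h j = i then (Δ : ℝ) ^ 2 * b ^ 2 * (lam ^ (i + d))⁻¹ else 0 := by
    intro j
    rw [Finset.sum_ite_eq]
    by_cases hj : h j < L
    · rw [if_pos (Finset.mem_range.2 hj)]
      set T := Finset.univ.filter fun k => A j k ≠ 0 with hT
      have e1 : ∑ k, (if h j + d ≤ g k then |A j k * x k| else 0) =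
          ∑ k ∈ T, if h j + d ≤ g k then |A j k * x k| else 0 := by
        rw [hT, Finset.sum_filter]
        refine Finset.sum_congr rfl fun k _ => ?_
        by_cases hk : A j k = 0 <;> simp [hk]
      rw [e1]
      refine (sq_sum_le_card_mul_sum_sq (s := T)).trans ?_
      have e2 : ∀ k ∈ T, (if h j + d ≤ g k then |A j k * x k| else 0) ^ 2 ≤
          b ^ 2 * (lam ^ (h j + d))⁻¹ := by
        intro k _
        split_ifs with hk
        · rw [sq_abs, mul_pow]
          have h1 : A j k ^ 2 ≤ b ^ 2 := sq_le_sq.2 ((hb j k).trans (le_abs_self b))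
          have h2 : x k ^ 2 ≤ (lam ^ (h j + d))⁻¹ :=
            (hgx k).trans (inv_anti₀ (by positivity) (pow_le_pow_right₀ hlam hk))
          gcongr
        · rw [zero_pow two_ne_zero]; positivity
      have hTc : (T.card : ℝ) ≤ Δ := by exact_mod_cast hrow j
      calc _ ≤ (T.card : ℝ) * ∑ k ∈ T, b ^ 2 * (lam ^ (h j + d))⁻¹ := by
            gcongr with k hk
            exact e2 k hk
        _ = T.card * (T.card * (b ^ 2 * (lam ^ (h j + d))⁻¹)) := by
            rw [Finset.sum_const, nsmul_eq_mul]
        _ ≤ Δ * (Δ * (b ^ 2 * (lam ^ (h j + d))⁻¹)) := by gcongr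
        _ = _ := by ring
    · rw [if_neg (by simpa using hj), Finset.sum_eq_zero]
      · norm_num
      · intro k _
        have := hgL k
        rw [if_neg (by omega)]
  refine (Finset.sum_le_sum fun j _ => hrowsum j).trans ?_
  rw [Finset.sum_comm]
  calc _ ≤ ∑ i ∈ Finset.range L, (Δ : ℝ) ^ 3 * b ^ 2 * lam * (lam ^ d)⁻¹ := by
        refine Finset.sum_le_sum fun i hi => ?_
        rw [Finset.mem_range] at hi
        rw [← Finset.sum_filter, Finset.sum_const, nsmul_eq_mul]
        have hsub : (Finset.univ.filter fun j => h j = i) ⊆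
            (Finset.univ.filter fun k => g k = i).biUnion
              fun k => Finset.univ.filter fun j => A j k ≠ 0 := by
          intro j hj
          rw [Finset.mem_filter_univ] at hj
          obtain ⟨k, hk, hk'⟩ := hnb j (by omega)
          rw [Finset.mem_biUnion]
          exact ⟨k, by rw [Finset.mem_filter_univ]; omega, by rwa [Finset.mem_filter_univ]⟩
        have hcard : ((Finset.univ.filter fun j => h j = i).card : ℝ) ≤ lam ^ (i + 1) * Δ := by
          have h1 := (Finset.card_le_card hsub).trans
            (Finset.card_biUnion_le_card_mul _ _ Δ fun k _ => hcol k)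
          have h2 : ((Finset.univ.filter fun j => h j = i).card : ℝ) ≤
              (Finset.univ.filter fun k => g k = i).card * Δ := by exact_mod_cast h1
          refine h2.trans ?_
          gcongr
          exact hgc i hi
        calc _ ≤ (lam ^ (i + 1) * Δ) * ((Δ : ℝ) ^ 2 * b ^ 2 * (lam ^ (i + d))⁻¹) := by gcongr
          _ = _ := by
            rw [pow_add, pow_add]
            field_simp
    _ = _ := by rw [Finset.sum_const, Finset.card_range, nsmul_eq_mul]

/-- The image of a vector that is spread out over `J` is large, no matter what the vector is
outside `J`. -/
def FlatBound (A : ι → κ → ℝ) (J : Finset κ) (ζ s : ℝ) : Prop :=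
  ∀ x : κ → ℝ, (∀ k ∈ J, x k ^ 2 ≤ ζ * ∑ k ∈ J, x k ^ 2) →
    s * ∑ k ∈ J, x k ^ 2 ≤ ∑ j, (∑ k, A j k * x k) ^ 2

/-- On a level i < L the squares are at most lam^{-i} and there are at most lam^{i+1} coordinates.
If the level carries mass at least 1/(16n), no square exceeds the average by more than the factor
16n·lam. The top level has no such count from above; there the bound lam^{-L} itself is used, and
only its complement is known to be small. -/
theorem FlatBound.level_le {A : ι → κ → ℝ} {x : κ → ℝ} {g : κ → ℕ} {L n : ℕ} {lam s : ℝ}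
    (hlam : 1 ≤ lam) (hgL : ∀ k, g k ≤ L) (hgx : ∀ k, x k ^ 2 ≤ (lam ^ g k)⁻¹)
    (hgc : ∀ i < L, ((Finset.univ.filter fun k => g k = i).card : ℝ) ≤ lam ^ (i + 1))
    (hgc' : ((Finset.univ.filter fun k => g k ≠ L).card : ℝ) ≤ lam ^ L)
    (hflat : ∀ J : Finset κ, J.Nonempty → (J.card : ℝ) ≤ lam ^ L →
      FlatBound A J (16 * n * lam / J.card) s)
    (hlast : ∀ J : Finset κ, (Jᶜ.card : ℝ) ≤ lam ^ L →
      FlatBound A J (16 * n * (lam ^ L)⁻¹) s) {φ : ℕ → ℝ} (hφ0 : ∀ i, 0 ≤ φ i) (hφ1 : ∀ i, φ i ≤ 1)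
    {i : ℕ} (hm : 1 ≤ 16 * n * ∑ k ∈ Finset.univ.filter (fun k => g k = i), (φ (g k) * x k) ^ 2) :
    s * ∑ k ∈ Finset.univ.filter (fun k => g k = i), (φ (g k) * x k) ^ 2 ≤
      ∑ j, (∑ k, A j k * (φ (g k) * x k)) ^ 2 := by
  classical
  have hl : 0 < lam := by linarith
  set J := Finset.univ.filter (fun k => g k = i) with hJ
  have hJne : J.Nonempty := by
    by_contra hne
    rw [Finset.not_nonempty_iff_eq_empty] at hne
    rw [hne] at hm
    norm_num at hm
  obtain ⟨k₀, hk₀⟩ := hJne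
  have hiL : i ≤ L := by
    rw [hJ, Finset.mem_filter_univ] at hk₀
    rw [← hk₀]; exact hgL k₀
  have hbd : ∀ k ∈ J, (φ (g k) * x k) ^ 2 ≤ (lam ^ i)⁻¹ := by
    intro k hk
    rw [hJ, Finset.mem_filter_univ] at hk
    rw [mul_pow, ← hk]
    exact (mul_le_of_le_one_left (sq_nonneg _) (pow_le_one₀ (hφ0 _) (hφ1 _))).trans (hgx k)
  have hinv : 0 ≤ (lam ^ i)⁻¹ := by positivity
  rcases hiL.lt_or_eq with hlt | heq
  · have hcard := hgc i hlt
    have hJpos : (0 : ℝ) < J.card := by exact_mod_cast Finset.card_pos.2 ⟨k₀, hk₀⟩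
    refine hflat J ⟨k₀, hk₀⟩ (hcard.trans (pow_le_pow_right₀ hlam (by omega))) _ fun k hk => ?_
    refine (hbd k hk).trans ?_
    have h1 : (lam ^ i)⁻¹ ≤ lam / J.card := by
      rw [le_div_iff₀ hJpos, inv_mul_le_iff₀ (by positivity), ← pow_succ]
      exact hcard
    calc (lam ^ i)⁻¹ ≤ lam / J.card * 1 := by rw [mul_one]; exact h1
      _ ≤ lam / J.card * (16 * n * ∑ k ∈ J, (φ (g k) * x k) ^ 2) := by gcongr
      _ = _ := by ring
  · subst heq
    refine hlast J ?_ _ fun k hk => (hbd k hk).trans ?_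
    · refine le_trans (le_of_eq ?_) hgc'
      congr 2
      rw [hJ, Finset.compl_filter]
    · calc (lam ^ i)⁻¹ ≤ (lam ^ i)⁻¹ * (16 * n * ∑ k ∈ J, (φ (g k) * x k) ^ 2) :=
            le_mul_of_one_le_right hinv hm
        _ = _ := by ring

/-- A lower bound for the image of a unit vector, from bounds for the images of vectors that are
spread out. -/
theorem le_sum_sq_of_flatBound {A : ι → κ → ℝ} {R s lam b : ℝ} {L a d Δ n : ℕ} (hR : 0 ≤ R)
    (hs : 0 ≤ s) (ha : 0 < a) (hd : 0 < d) (hn : n = L + 2 * (2 * a) + 1)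
    (hA : ∀ w : κ → ℝ, ∑ j, (∑ k, A j k * w k) ^ 2 ≤ R * ∑ k, w k ^ 2)
    (hlam : 1 ≤ lam) (hb : ∀ j k, |A j k| ≤ b)
    (hrow : ∀ j, (Finset.univ.filter fun k => A j k ≠ 0).card ≤ Δ)
    (hcol : ∀ k, (Finset.univ.filter fun j => A j k ≠ 0).card ≤ Δ)
    (hflat : ∀ J : Finset κ, J.Nonempty → (J.card : ℝ) ≤ lam ^ L →
      FlatBound A J (16 * n * lam / J.card) s)
    (hlast : ∀ J : Finset κ, (Jᶜ.card : ℝ) ≤ lam ^ L →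
      FlatBound A J (16 * n * (lam ^ L)⁻¹) s) {x : κ → ℝ} (hx : ∑ k, x k ^ 2 = 1) :
    s / 16 ≤ 8 * a * ∑ j, (∑ k, A j k * x k) ^ 2 + 8 * d ^ 3 / a * R +
      4 * n * (L * (Δ ^ 3 * b ^ 2 * lam * (lam ^ d)⁻¹)) := by
  classical
  have ha' : (0 : ℝ) < a := by exact_mod_cast ha
  have hn' : (0 : ℝ) < n := by exact_mod_cast (show 0 < n by omega)
  obtain ⟨g, hgL, hgx, hgc, hgc'⟩ := exists_column_levels hx hlam L
  obtain ⟨h, hhL, hgh, hnb⟩ := exists_row_levels A g L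
  have hfar := sum_far_sq_le hlam hd hb hrow hcol hgL hgx hgc hnb
  have hup := sum_tent_localized_sq_le hR hA x g h hgh (H := 2 * a) (n := n) (by omega) hfar
  set V : ℕ → ℝ := fun c => ∑ k, (tent (2 * a) c (g k) * x k) ^ 2 with hV
  set W : ℕ → ℝ := fun c => ∑ j, (∑ k, A j k * (tent (2 * a) c (g k) * x k)) ^ 2 with hW
  have hW0 : ∀ c, 0 ≤ W c := fun c => Finset.sum_nonneg fun _ _ => sq_nonneg _
  have hVsum : (a : ℝ) / 2 ≤ ∑ c ∈ Finset.range n, V c := by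
    rw [hV, Finset.sum_comm, ← mul_one ((a : ℝ) / 2), ← hx, Finset.mul_sum]
    refine Finset.sum_le_sum fun k _ => ?_
    simp only [mul_pow]
    rw [← Finset.sum_mul, hn]
    gcongr
    exact le_sum_tent_sq ha (hgL k)
  -- The windows below this threshold carry at most n · a/(4n) = a/4 together, half of the lower
  -- bound for the total. In any other window the heaviest of its at most 4a levels has mass at
  -- least 1/(16n), and it loses only the constant 4a against the whole window.
  have hgood : ∀ c, (a : ℝ) / (4 * n) ≤ V c → s * V c ≤ 4 * a * W c := by
    intro c hc
    set m : ℕ → ℝ := fun i =>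
      ∑ k ∈ Finset.univ.filter (fun k => g k = i), (tent (2 * a) c (g k) * x k) ^ 2 with hm
    set S := (Finset.range c).filter (fun i => c < i + 2 * (2 * a)) with hS
    have hScard : (S.card : ℝ) ≤ 4 * a := by
      have h1 : S ⊆ Finset.Ico (c - 4 * a) c := by
        intro i hi
        rw [hS, Finset.mem_filter, Finset.mem_range] at hi
        rw [Finset.mem_Ico]
        omega
      have h2 := Finset.card_le_card h1
      rw [Nat.card_Ico] at h2
      have h3 : S.card ≤ 4 * a := by omega
      exact_mod_cast h3
    have hVm : V c = ∑ i ∈ S, m i := by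
      simp only [hV, hm, Finset.sum_filter]
      rw [Finset.sum_comm]
      refine Finset.sum_congr rfl fun k _ => ?_
      rw [Finset.sum_ite_eq]
      split_ifs with hk
      · rfl
      · rw [tent_eq_zero (by omega)]
        · simp
        · simpa [hS] using hk
    have hSne : S.Nonempty := by
      by_contra hne
      rw [Finset.not_nonempty_iff_eq_empty] at hne
      rw [hVm, hne, Finset.sum_empty] at hc
      have : 0 < (a : ℝ) / (4 * n) := by positivity
      linarith
    obtain ⟨i, hi, hmax⟩ := Finset.exists_max_image S m hSne
    have hVi : V c ≤ 4 * a * m i := by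
      rw [hVm]
      refine (Finset.sum_le_card_nsmul S m (m i) hmax).trans ?_
      rw [nsmul_eq_mul]
      have : 0 ≤ m i := Finset.sum_nonneg fun _ _ => sq_nonneg _
      gcongr
    have hmi : 1 ≤ 16 * n * m i := by
      have h1 := hc.trans hVi
      rw [div_le_iff₀ (by positivity)] at h1
      have h2 : (a : ℝ) * 1 ≤ a * (16 * n * m i) := by linarith
      exact le_of_mul_le_mul_left h2 ha'
    have hfl := FlatBound.level_le hlam hgL hgx hgc hgc' hflat hlast
      (φ := fun i => tent (2 * a) c i) (fun i => tent_nonneg _ _ _)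
      (fun i => tent_le_one _ _ _) hmi
    calc s * V c ≤ s * (4 * a * m i) := by gcongr
      _ = 4 * a * (s * m i) := by ring
      _ ≤ 4 * a * W c := by gcongr
  have hall : ∀ c, s * (V c - (a : ℝ) / (4 * n)) ≤ 4 * a * W c := by
    intro c
    rcases le_or_gt ((a : ℝ) / (4 * n)) (V c) with hc | hc
    · refine le_trans ?_ (hgood c hc)
      have : 0 < (a : ℝ) / (4 * n) := by positivity
      gcongr
      linarith
    · have := hW0 c
      have h1 : s * (V c - (a : ℝ) / (4 * n)) ≤ 0 :=
        mul_nonpos_of_nonneg_of_nonpos hs (by linarith)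
      have h2 : 0 ≤ 4 * a * W c := by positivity
      linarith
  have hsum := Finset.sum_le_sum fun c (_ : c ∈ Finset.range n) => hall c
  rw [← Finset.mul_sum, Finset.sum_sub_distrib, Finset.sum_const, Finset.card_range,
    nsmul_eq_mul, ← Finset.mul_sum] at hsum
  have h1 : (n : ℝ) * (a / (4 * n)) = a / 4 := by field_simp
  rw [h1] at hsum
  have h2 : s * (a / 4) ≤ 4 * a * ∑ c ∈ Finset.range n, W c := by
    refine le_trans ?_ hsum
    gcongr
    linarith
  have h3 : s / 16 ≤ ∑ c ∈ Finset.range n, W c := by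
    have : a * (s / 16) ≤ a * ∑ c ∈ Finset.range n, W c := by linarith
    exact le_of_mul_le_mul_left this ha'
  refine h3.trans (hup.trans (le_of_eq ?_))
  rw [hx]
  push_cast
  field_simp
  ring

end Localization

/-! ### Nets for flat vectors -/

section FlatNet

variable {ι κ : Type*} [Fintype ι] [Fintype κ] [DecidableEq κ]

/-- A strict inequality is an open condition on y, and rational points are dense. -/
theorem exists_rat_sum_sq_lt {A : ι → κ → ℝ} {J : Finset κ} {z y : κ → ℝ} {T : ℝ}
    (h : ∑ j, (∑ k, A j k * (if k ∈ J then z k else y k)) ^ 2 < T) :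
    ∃ y : κ → ℚ, ∑ j, (∑ k, A j k * (if k ∈ J then z k else y k)) ^ 2 < T := by
  have hopen : IsOpen {y : κ → ℝ |
      ∑ j, (∑ k, A j k * (if k ∈ J then z k else y k)) ^ 2 < T} := by
    refine isOpen_lt ?_ continuous_const
    refine continuous_finsetSum _ fun j _ => Continuous.pow (continuous_finsetSum _ fun k _ => ?_) 2
    refine continuous_const.mul ?_
    split_ifs
    · exact continuous_const
    · exact continuous_apply k
  have hdense : DenseRange (Pi.map fun _ : κ => ((↑) : ℚ → ℝ)) :=
    DenseRange.piMap fun _ => Rat.denseRange_cast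
  obtain ⟨q, hq⟩ := hdense.exists_mem_open hopen ⟨y, h⟩
  exact ⟨q, hq⟩

/-- A union bound over a net of the vectors that are spread out over `J`. -/
theorem matMeasure_not_flatBound_le {ν : ι → κ → Measure ℝ} (J : Finset κ) {R s ζ ε m : ℝ}
    {π : ENNReal} (hε0 : 0 < ε) (hε : ε ≤ 1 / 2) (hR : R * ε ^ 2 ≤ s) (hR0 : 0 ≤ R) (hs : 0 < s)
    (hm : 0 < m) (hJ : J.card ≤ m)
    (hπ : ∀ z : κ → ℝ, (∀ k ∈ J, z k ^ 2 ≤ ζ) → 1 / 4 ≤ ∑ k ∈ J, z k ^ 2 → ∑ k ∈ J, z k ^ 2 ≤ 1 →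
      matMeasure ν {A | ∃ y : κ → ℚ,
        ∑ j, (∑ k, A j k * (if k ∈ J then z k else y k)) ^ 2 < 4 * s} ≤ π) :
    matMeasure ν {A | (∀ w : κ → ℝ, ∑ j, (∑ k, A j k * w k) ^ 2 ≤ R * ∑ k, w k ^ 2) ∧
      ¬ FlatBound A J ζ s} ≤ ENNReal.ofReal (Real.exp m * (1 + 3 / ε) ^ J.card) * π := by
  -- The net has mesh ε/√m, so that rounding at most m coordinates moves a vector by at most ε;
  -- after rescaling, the unit ball has squared radius m/ε².
  obtain ⟨S, hS, hcard⟩ := exists_finset_lattice_points J (ε := ε) (ρ := m / ε ^ 2) hε0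
  rw [show ε ^ 2 * (m / ε ^ 2) = m by field_simp] at hcard
  have hsm : 0 < √m := Real.sqrt_pos.2 hm
  set Z : (κ → ℤ) → κ → ℝ := fun r k => ε * r k / √m with hZ
  classical
  set S' := S.filter fun r => (∀ k ∈ J, Z r k ^ 2 ≤ ζ) ∧ 1 / 4 ≤ ∑ k ∈ J, Z r k ^ 2 ∧
    ∑ k ∈ J, Z r k ^ 2 ≤ 1 with hS'
  have hsub : {A : ι → κ → ℝ | (∀ w : κ → ℝ, ∑ j, (∑ k, A j k * w k) ^ 2 ≤ R * ∑ k, w k ^ 2) ∧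
      ¬ FlatBound A J ζ s} ⊆ ⋃ r ∈ S', {A | ∃ y : κ → ℚ,
        ∑ j, (∑ k, A j k * (if k ∈ J then Z r k else y k)) ^ 2 < 4 * s} := by
    rintro A ⟨hop, hA⟩
    unfold FlatBound at hA
    push Not at hA
    obtain ⟨x, hx, hAx⟩ := hA
    set V := ∑ k ∈ J, x k ^ 2 with hV
    have hV0 : 0 < V := by
      have h1 : 0 ≤ ∑ j, (∑ k, A j k * x k) ^ 2 := Finset.sum_nonneg fun _ _ => sq_nonneg _
      exact pos_of_mul_pos_right (h1.trans_lt hAx) hs.le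
    have hsV : 0 < √V := Real.sqrt_pos.2 hV0
    set x' : κ → ℝ := fun k => x k / √V with hx'
    have hx'sq : ∀ k, x' k ^ 2 = x k ^ 2 / V := by
      intro k; rw [hx', div_pow, Real.sq_sqrt hV0.le]
    have hx'J : ∑ k ∈ J, x' k ^ 2 = 1 := by
      simp only [hx'sq]
      rw [← Finset.sum_div, ← hV, div_self hV0.ne']
    have hx'ζ : ∀ k ∈ J, x' k ^ 2 ≤ ζ := by
      intro k hk
      rw [hx'sq, div_le_iff₀ hV0]
      exact hx k hk
    have hAx' : ∑ j, (∑ k, A j k * x' k) ^ 2 < s := by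
      have : ∀ j, (∑ k, A j k * x' k) ^ 2 = (∑ k, A j k * x k) ^ 2 / V := by
        intro j
        have e : ∑ k, A j k * x' k = (∑ k, A j k * x k) / √V := by
          rw [Finset.sum_div]
          exact Finset.sum_congr rfl fun k _ => by rw [hx']; ring
        rw [e, div_pow, Real.sq_sqrt hV0.le]
      simp only [this]
      rwa [← Finset.sum_div, div_lt_iff₀ hV0]
    set r : κ → ℤ := fun k => if k ∈ J then roundZero (√m * x' k / ε) else 0 with hr
    have hrJ : ∀ k ∈ J, r k = roundZero (√m * x' k / ε) := fun k hk => by simp [hr, hk]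
    have hZle : ∀ k ∈ J, Z r k ^ 2 ≤ x' k ^ 2 := by
      intro k hk
      refine sq_le_sq.2 ?_
      simp only [hZ]
      rw [hrJ k hk, abs_div, abs_mul, abs_of_pos hε0, abs_of_pos hsm, div_le_iff₀ hsm]
      have := abs_roundZero_le (√m * x' k / ε)
      rw [abs_div, abs_mul, abs_of_pos hε0, abs_of_pos hsm, le_div_iff₀ hε0] at this
      linarith
    have hZsub : ∀ k ∈ J, (x' k - Z r k) ^ 2 ≤ ε ^ 2 / m := by
      intro k hk
      have h1 := abs_sub_roundZero_le (√m * x' k / ε)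
      have h2 : x' k - Z r k = (√m * x' k / ε - r k) * (ε / √m) := by
        simp only [hZ]
        field_simp
      rw [h2, mul_pow, div_pow, Real.sq_sqrt hm.le, hrJ k hk]
      refine mul_le_of_le_one_left (by positivity) ?_
      rwa [sq_le_one_iff_abs_le_one]
    have hdist : ∑ k ∈ J, (x' k - Z r k) ^ 2 ≤ ε ^ 2 := by
      refine (Finset.sum_le_sum hZsub).trans ?_
      rw [Finset.sum_const, nsmul_eq_mul]
      calc _ ≤ m * (ε ^ 2 / m) := by gcongr
        _ = _ := by field_simp
    have hZ1 : ∑ k ∈ J, Z r k ^ 2 ≤ 1 := (Finset.sum_le_sum hZle).trans hx'J.le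
    have hZ4 : 1 / 4 ≤ ∑ k ∈ J, Z r k ^ 2 := by
      have h1 : ∑ k ∈ J, x' k ^ 2 ≤ ∑ k ∈ J, (2 * Z r k ^ 2 + 2 * (x' k - Z r k) ^ 2) :=
        Finset.sum_le_sum fun k _ => by nlinarith [sq_nonneg (2 * Z r k - x' k)]
      rw [Finset.sum_add_distrib, ← Finset.mul_sum, ← Finset.mul_sum, hx'J] at h1
      nlinarith
    have hrS : r ∈ S := by
      rw [hS]
      refine ⟨fun k hk => by simp [hr, hk], ?_⟩
      have h1 : ∑ k, (r k : ℝ) ^ 2 = ∑ k ∈ J, (r k : ℝ) ^ 2 := by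
        refine (Finset.sum_subset (Finset.subset_univ J) fun k _ hk => ?_).symm
        simp [hr, hk]
      have h2 : ∑ k ∈ J, (r k : ℝ) ^ 2 = m / ε ^ 2 * ∑ k ∈ J, Z r k ^ 2 := by
        rw [Finset.mul_sum]
        refine Finset.sum_congr rfl fun k _ => ?_
        simp only [hZ]
        rw [div_pow, Real.sq_sqrt hm.le]
        field_simp
      rw [h1, h2]
      exact mul_le_of_le_one_right (by positivity) hZ1
    simp only [Set.mem_iUnion]
    refine ⟨r, Finset.mem_filter.2 ⟨hrS, fun k hk => (hZle k hk).trans (hx'ζ k hk), hZ4, hZ1⟩, ?_⟩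
    -- Outside J the vector x' is kept, so A sees only the error on J, of norm at most ε, and the
    -- value s grows to at most 2s + 2Rε² ≤ 4s.
    refine exists_rat_sum_sq_lt (y := x') ?_
    set u : κ → ℝ := fun k => if k ∈ J then x' k - Z r k else 0 with hu
    have e1 : ∀ j, ∑ k, A j k * (if k ∈ J then Z r k else x' k) =
        ∑ k, A j k * x' k - ∑ k, A j k * u k := by
      intro j
      rw [← Finset.sum_sub_distrib]
      refine Finset.sum_congr rfl fun k _ => ?_
      by_cases hk : k ∈ J <;> simp [hu, hk]
      ring
    have hu2 : ∑ k, u k ^ 2 ≤ ε ^ 2 := by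
      refine le_trans (le_of_eq ?_) hdist
      rw [← Finset.sum_subset (Finset.subset_univ J)]
      · exact Finset.sum_congr rfl fun k hk => by simp [hu, hk]
      · intro k _ hk; simp [hu, hk]
    have h3 := hop u
    calc ∑ j, (∑ k, A j k * (if k ∈ J then Z r k else x' k)) ^ 2
        ≤ ∑ j, (2 * (∑ k, A j k * x' k) ^ 2 + 2 * (∑ k, A j k * u k) ^ 2) := by
          refine Finset.sum_le_sum fun j _ => ?_
          rw [e1]
          nlinarith [sq_nonneg (∑ k, A j k * x' k + ∑ k, A j k * u k)]
      _ = 2 * ∑ j, (∑ k, A j k * x' k) ^ 2 + 2 * ∑ j, (∑ k, A j k * u k) ^ 2 := by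
          rw [Finset.sum_add_distrib, Finset.mul_sum, Finset.mul_sum]
      _ < 2 * s + 2 * (R * ε ^ 2) := by
          have : R * ∑ k, u k ^ 2 ≤ R * ε ^ 2 := by gcongr
          linarith
      _ ≤ 4 * s := by linarith
  refine (measure_mono hsub).trans ((measure_biUnion_finset_le _ _).trans ?_)
  calc _ ≤ ∑ r ∈ S', π := by
        refine Finset.sum_le_sum fun r hr => ?_
        obtain ⟨-, h1, h2, h3⟩ := Finset.mem_filter.1 hr
        exact hπ (Z r) h1 h2 h3
    _ = (S'.card : ENNReal) * π := by rw [Finset.sum_const, nsmul_eq_mul]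
    _ ≤ _ := by
        gcongr
        have h1 : ((S'.card : ℕ) : ENNReal) = ENNReal.ofReal (S'.card : ℝ) := by simp
        rw [h1]
        refine ENNReal.ofReal_le_ofReal (le_trans ?_ hcard)
        exact_mod_cast Finset.card_filter_le _ _

end FlatNet

/-! ### Flat bounds for one set of coordinates -/

section FlatProbability

/-- The probability that a vector that is spread out over a given set of coordinates has a small
image, when the per-row Laplace transform has a gap. -/
theorem exists_matMeasure_not_flatBound_le :
    ∃ c : ℝ, 0 < c ∧ ∀ {ι κ : Type} [Fintype ι] [Fintype κ] [DecidableEq ι] [DecidableEq κ]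
      {ν : ι → κ → Measure ℝ} [∀ j k, IsProbabilityMeasure (ν j k)] {N p b M : ℝ},
      (∀ j k, SparseLaw (ν j k) N p b M) → 0 < p → 0 ≤ M → ∀ {η : ℝ}, 0 < η → 4 ≤ η * N →
      (Fintype.card ι : ℝ) ≤ N → Fintype.card κ + η * N ≤ (Fintype.card ι : ℝ) →
      ∀ {σ R ε ζ v : ℝ}, 0 < σ → σ ≤ c * η ^ 2 → 0 < ε → ε ≤ 1 / 2 → 0 ≤ R →
      R * ε ^ 2 ≤ σ * (N * p) → 0 < v → p * v ≤ 1 → 256 * M * ζ * v ≤ 1 →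
      ∀ J : Finset κ, J.Nonempty →
      matMeasure ν {A | (∀ w : κ → ℝ, ∑ j, (∑ k, A j k * w k) ^ 2 ≤ R * ∑ k, w k ^ 2) ∧
        ¬ FlatBound A J ζ (σ * (N * p))} ≤
      ENNReal.ofReal (Real.exp J.card * (1 + 3 / ε) ^ J.card *
        Real.exp (-(c * η * (p * v * N)))) := by
  obtain ⟨c, hc, hmain⟩ := exists_lintegral_exp_neg_sq_sum_le
  refine ⟨c / 128, by positivity, ?_⟩
  intro ι κ _ _ _ _ ν _ N p b M hν hp hM η hη hηN hι hκι σ R ε ζ v hσ hση hε0 hε hR hRε hv hpv hζ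
    J hJ
  have hN : 0 < N := by
    by_contra h
    push Not at h
    nlinarith
  have hm : (0 : ℝ) < J.card := by exact_mod_cast Finset.card_pos.2 hJ
  have hs : 0 < σ * (N * p) := by positivity
  refine (matMeasure_not_flatBound_le J hε0 hε hRε hR hs hm le_rfl
    (π := ENNReal.ofReal (Real.exp (-(c / 128 * η * (p * v * N))))) ?_).trans ?_
  · intro z hzζ hz4 hz1
    set V := ∑ k ∈ J, z k ^ 2 with hV
    have hVsub : ∑ k : {k // k ∈ J}, z k ^ 2 = V := Finset.sum_coe_sort J fun k => z k ^ 2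
    set v' : NNReal := ⟨v, hv.le⟩ with hv'
    have hv'0 : v' ≠ 0 := by
      intro h
      have : v = 0 := congrArg NNReal.toReal h
      exact hv.ne' this
    have hq : ∀ j u, ∫⁻ x, ENNReal.ofReal (Real.exp (-(v / 2 * (x + u) ^ 2)))
        ∂((Measure.pi fun k : {k // k ∈ J} => ν j k).map
          fun x => ∑ k : {k // k ∈ J}, x k * z k) ≤
        ENNReal.ofReal (Real.exp (-(c * (p * v) / 4))) := by
      intro j u
      have h1 := hmain (ν := fun k : {k // k ∈ J} => ν j k) (fun k => hν j k) hp.le hM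
        (z := fun k => z k) (v := v') hv'0 (by
          rw [hVsub]
          calc p * V * v' ≤ p * 1 * v := by
                change p * V * v ≤ p * 1 * v
                gcongr
            _ ≤ 1 := by linarith) (fun k => by
          have h2 := hzζ k k.2
          calc 256 * M * z k ^ 2 * v' ≤ 256 * M * ζ * v := by
                change 256 * M * z k ^ 2 * v ≤ _
                gcongr
            _ ≤ 1 := hζ) u
      refine h1.trans (ENNReal.ofReal_le_ofReal ?_)
      rw [hVsub]
      change 1 - c * (p * V * v) ≤ _
      have h3 := Real.add_one_le_exp (-(c * (p * v) / 4))
      have h4 : c * (p * v) / 4 ≤ c * (p * V * v) := by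
        have : 0 < c * (p * v) := by positivity
        nlinarith
      linarith
    -- Of the ηN surplus dimensions, a · card ι ≤ ηN/4 is paid for a = η/4; the rest is t.
    set t := ⌊3 / 4 * (η * N)⌋₊ with ht
    have ht1 : (t : ℝ) ≤ 3 / 4 * (η * N) := Nat.floor_le (by positivity)
    have ht2 : η * N / 2 ≤ t := by
      have := Nat.lt_floor_add_one (3 / 4 * (η * N))
      rw [← ht] at this
      linarith
    have hSB := matMeasure_dist_lt_le (ν := ν) (θ := v / 2) (a := η / 4) (T := 4 * (σ * (N * p)))
      (by positivity) (by positivity) (q := ENNReal.ofReal (Real.exp (-(c * (p * v) / 4))))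
      (fun k => k ∈ J) z (by convert hq) t (by
        have h1 : (Fintype.card {k // ¬ k ∈ J} : ℝ) ≤ Fintype.card κ := by
          exact_mod_cast Fintype.card_subtype_le _
        have h2 : η / 4 * Fintype.card ι ≤ η / 4 * N := by gcongr
        linarith)
    refine hSB.trans ?_
    rw [← ENNReal.ofReal_pow (Real.exp_pos _).le, ← ENNReal.ofReal_mul (Real.exp_pos _).le,
      ← Real.exp_nat_mul, ← Real.exp_add]
    refine ENNReal.ofReal_le_ofReal (Real.exp_le_exp.2 ?_)
    have h1 : v / 2 / (η / 4) * (4 * (σ * (N * p))) = 8 * σ / η * (p * v * N) := by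
      field_simp; ring
    -- The exponential Markov factor thus costs at most half of the gain from the t row factors.
    have h2 : 8 * σ / η ≤ c * η / 16 := by
      rw [div_le_iff₀ hη]
      linarith
    have h3 : 8 * σ / η * (p * v * N) ≤ c * η / 16 * (p * v * N) := by gcongr
    have h4 : η * N / 2 * (c * (p * v) / 4) ≤ t * (c * (p * v) / 4) := by gcongr
    have h5 : 0 ≤ c * η * (p * v * N) := by positivity
    rw [h1]
    linarith
  · rw [← ENNReal.ofReal_mul (by positivity)]

/-- The probability that a vector that is spread out over most coordinates has a small image. -/
theorem matMeasure_not_flatBound_last_le {ι κ : Type} [Fintype ι] [Fintype κ] [DecidableEq ι]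
    [DecidableEq κ] {ν : ι → κ → Measure ℝ} [∀ j k, IsProbabilityMeasure (ν j k)] {N p b M : ℝ}
    (hν : ∀ j k, SparseLaw (ν j k) N p b M) (hp : 0 < p) (hM : 0 < M) {η : ℝ} (hη : 0 < η)
    (hN : 0 < N) (hι : (Fintype.card ι : ℝ) ≤ N)
    (hκι : Fintype.card κ + η * N ≤ (Fintype.card ι : ℝ)) {σ R ε ζ w : ℝ} (hσ : 0 < σ)
    (hε0 : 0 < ε) (hε : ε ≤ 1 / 2) (hR : 0 ≤ R) (hRε : R * ε ^ 2 ≤ σ * (N * p)) (hw : 0 < w)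
    (hζ : 0 < ζ) (J : Finset κ) (hJ : (Jᶜ.card : ℝ) ≤ η * N / 4) :
    matMeasure ν {A | (∀ w : κ → ℝ, ∑ j, (∑ k, A j k * w k) ^ 2 ≤ R * ∑ k, w k ^ 2) ∧
      ¬ FlatBound A J ζ (σ * (N * p))} ≤
    ENNReal.ofReal (Real.exp N * (1 + 3 / ε) ^ Fintype.card κ * (Real.exp (8 * w * σ * N / η) *
      (4 / √w + 64 * M * ζ * w / p) ^ (Fintype.card κ + ⌊η * N / 2⌋₊))) := by
  have hs : 0 < σ * (N * p) := by positivity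
  have hκN : (Fintype.card κ : ℝ) ≤ N := by
    have : 0 < η * N := by positivity
    linarith
  have hJκ : J.card ≤ Fintype.card κ := Finset.card_le_univ J
  have hJN : (J.card : ℝ) ≤ N := le_trans (by exact_mod_cast hJκ) hκN
  set q : ℝ := 4 / √w + 64 * M * ζ * w / p with hqdef
  have hq0 : 0 ≤ q := by positivity
  refine (matMeasure_not_flatBound_le J hε0 hε hRε hR hs hN hJN
    (π := ENNReal.ofReal (Real.exp (8 * w * σ * N / η) *
      q ^ (Fintype.card κ + ⌊η * N / 2⌋₊))) ?_).trans ?_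
  · intro z hzζ hz4 hz1
    set V := ∑ k ∈ J, z k ^ 2 with hV
    have hVsub : ∑ k : {k // k ∈ J}, z k ^ 2 = V := Finset.sum_coe_sort J fun k => z k ^ 2
    have hv : 0 < w / p := by positivity
    set v' : NNReal := ⟨w / p, hv.le⟩ with hv'
    have hv'0 : v' ≠ 0 := by
      intro h
      have : w / p = 0 := congrArg NNReal.toReal h
      exact hv.ne' this
    have hq : ∀ j u, ∫⁻ x, ENNReal.ofReal (Real.exp (-(w / p / 2 * (x + u) ^ 2)))
        ∂((Measure.pi fun k : {k // k ∈ J} => ν j k).map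
          fun x => ∑ k : {k // k ∈ J}, x k * z k) ≤ ENNReal.ofReal q := by
      intro j u
      have h1 := lintegral_exp_neg_sq_sum_le (ν := fun k : {k // k ∈ J} => ν j k)
        (fun k => hν j k) hp hM (z := fun k => z k) (v := v') hv'0 (by
          rw [hVsub]; linarith) hζ (fun k => hzζ k k.2) u
      refine h1.trans (ENNReal.ofReal_le_ofReal ?_)
      rw [hVsub]
      change 2 / √(p * V * (w / p)) + 64 * M * ζ * (w / p) ≤ q
      have h2 : √w / 2 ≤ √(p * V * (w / p)) := by
        refine Real.le_sqrt_of_sq_le ?_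
        rw [div_pow, Real.sq_sqrt hw.le, show p * V * (w / p) = V * w by field_simp]
        nlinarith
      have hsw : 0 < √w := Real.sqrt_pos.2 hw
      have h3 : 2 / √(p * V * (w / p)) ≤ 4 / √w := by
        calc _ ≤ 2 / (√w / 2) := by gcongr
          _ = _ := by field_simp; norm_num
      have h4 : 64 * M * ζ * (w / p) = 64 * M * ζ * w / p := by ring
      rw [h4, hqdef]
      linarith
    -- Since J omits at most ηN/4 coordinates, the exponent t may exceed card κ by ηN/2. The first
    -- card κ row factors compensate the net, which has about (3/ε)^{card κ} points, and the others
    -- are pure gain.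
    have hSB := matMeasure_dist_lt_le (ν := ν) (θ := w / p / 2) (a := η / 4)
      (T := 4 * (σ * (N * p))) (by positivity) (by positivity) (q := ENNReal.ofReal q)
      (fun k => k ∈ J) z (by convert hq)
      (Fintype.card κ + ⌊η * N / 2⌋₊) (by
        have h1 : Fintype.card {k // ¬ k ∈ J} = Jᶜ.card := by
          rw [Fintype.card_subtype]
          congr 1
          ext k; simp
        have h2 : η / 4 * Fintype.card ι ≤ η / 4 * N := by gcongr
        have h3 : (⌊η * N / 2⌋₊ : ℝ) ≤ η * N / 2 := Nat.floor_le (by positivity)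
        rw [h1]
        push_cast
        linarith)
    refine hSB.trans (le_of_eq ?_)
    rw [← ENNReal.ofReal_pow hq0, ← ENNReal.ofReal_mul (Real.exp_pos _).le]
    congr 3
    field_simp
    ring
  · rw [← ENNReal.ofReal_mul (by positivity)]
    refine ENNReal.ofReal_le_ofReal ?_
    refine mul_le_mul_of_nonneg_right (mul_le_mul_of_nonneg_left ?_ (by positivity)) (by positivity)
    refine pow_le_pow_right₀ ?_ hJκ
    have : 0 < 3 / ε := by positivity
    linarith

end FlatProbability

/-! ### Numbers of nonzero entries in rows and columns -/

section Degrees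

variable {ι κ : Type*} [Fintype ι] [Fintype κ] [DecidableEq ι] [DecidableEq κ]

/-- A Chernoff bound for the number of nonzero entries among given positions. -/
theorem matMeasure_card_ne_zero_gt_le {ν : ι → κ → Measure ℝ} [∀ j k, IsProbabilityMeasure (ν j k)]
    {N p b M : ℝ} (hν : ∀ j k, SparseLaw (ν j k) N p b M) (hp : 0 ≤ p) (E : Finset (ι × κ))
    (hE : E.card ≤ N) :
    matMeasure ν {A | 8 * (N * p) < (E.filter fun e => A e.1 e.2 ≠ 0).card} ≤
      ENNReal.ofReal (Real.exp (-(3 * (N * p)))) := by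
  have hmeas : MeasurableSet {u : ℝ | u ≠ 0} := (measurableSet_singleton 0).compl
  set f : ι → κ → ℝ → ℝ := fun a b u =>
    if (a, b) ∈ E then 1 + Set.indicator {u : ℝ | u ≠ 0} (fun _ => 1) u else 1 with hf
  have hfm : ∀ a b, Measurable (f a b) := by
    intro a b
    simp only [hf]
    split_ifs
    · exact measurable_const.add (measurable_const.indicator hmeas)
    · exact measurable_const
  have hf1 : ∀ a b u, 1 ≤ f a b u := by
    intro a b u
    simp only [hf]
    split_ifs
    · have : 0 ≤ Set.indicator {u : ℝ | u ≠ 0} (fun _ => (1 : ℝ)) u :=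
        Set.indicator_nonneg (fun _ _ => zero_le_one) _
      linarith
    · exact le_rfl
  have hf2 : ∀ a b u, f a b u ≤ 2 := by
    intro a b u
    simp only [hf]
    split_ifs
    · have : Set.indicator {u : ℝ | u ≠ 0} (fun _ => (1 : ℝ)) u ≤ 1 :=
        Set.indicator_le_self' (fun _ _ => zero_le_one) _
      linarith
    · norm_num
  have hfint : ∀ a b, Integrable (f a b) (ν a b) := fun a b =>
    Integrable.of_bound (C := 2) (hfm a b).aestronglyMeasurable (Eventually.of_forall fun u => by
      rw [Real.norm_of_nonneg (by linarith [hf1 a b u])]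
      exact hf2 a b u)
  have hfE : ∀ a b, ∫ u, f a b u ∂(ν a b) ≤ if (a, b) ∈ E then Real.exp (2 * p) else 1 := by
    intro a b
    simp only [hf]
    split_ifs
    · rw [integral_add (integrable_const _) ((integrable_const _).indicator hmeas),
        integral_indicator_const _ hmeas]
      have := (hν a b).measure_ne_zero
      have := Real.add_one_le_exp (2 * p)
      simp only [integral_const, probReal_univ, smul_eq_mul, mul_one]
      linarith
    · simp
  set F : (ι → κ → ℝ) → ℝ := fun A => ∏ a, ∏ b, f a b (A a b) with hF
  have hFint : Integrable F (matMeasure ν) :=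
    Integrable.fintype_prod (f := fun a (x : κ → ℝ) => ∏ b, f a b (x b)) fun a =>
      Integrable.fintype_prod (f := fun b (x : ℝ) => f a b x) fun b => hfint a b
  have hFE : ∫ A, F A ∂(matMeasure ν) ≤ Real.exp (2 * (N * p)) := by
    have h1 : ∫ A, F A ∂(matMeasure ν) = ∏ a, ∏ b, ∫ u, f a b u ∂(ν a b) := by
      unfold matMeasure
      rw [hF, integral_fintype_prod_eq_prod (fun a (x : κ → ℝ) => ∏ b, f a b (x b))]
      refine Finset.prod_congr rfl fun a _ => ?_
      rw [integral_fintype_prod_eq_prod (fun b (x : ℝ) => f a b x)]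
    rw [h1]
    have h0 : ∀ a b, 0 ≤ ∫ u, f a b u ∂(ν a b) := fun a b =>
      integral_nonneg fun u => zero_le_one.trans (hf1 a b u)
    calc _ ≤ ∏ a, ∏ b, (if (a, b) ∈ E then Real.exp (2 * p) else 1) :=
          Finset.prod_le_prod (fun a _ => Finset.prod_nonneg fun b _ => h0 a b) fun a _ =>
            Finset.prod_le_prod (fun b _ => h0 a b) fun b _ => hfE a b
      _ = Real.exp (E.card * (2 * p)) := by
          rw [← Fintype.prod_prod_type' (fun a b => if (a, b) ∈ E then Real.exp (2 * p) else 1),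
            Finset.prod_ite_mem_eq, Finset.prod_const, Real.exp_nat_mul]
      _ ≤ _ := by
          refine Real.exp_le_exp.2 ?_
          have : (E.card : ℝ) * (2 * p) ≤ N * (2 * p) := by gcongr
          linarith
  have hlow : ∀ A, (2 : ℝ) ^ (E.filter fun e => A e.1 e.2 ≠ 0).card ≤ F A := by
    intro A
    rw [hF]
    simp only
    rw [← Fintype.prod_prod_type' (fun a b => f a b (A a b)), ← Finset.prod_const,
      ← Finset.prod_ite_mem_eq (E.filter fun e => A e.1 e.2 ≠ 0)]
    refine Finset.prod_le_prod (fun e _ => by split_ifs <;> norm_num) fun e _ => ?_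
    split_ifs with h
    · rw [Finset.mem_filter] at h
      simp only [hf]
      rw [if_pos h.1, Set.indicator_of_mem (by exact h.2)]
      norm_num
    · exact hf1 _ _ _
  -- Chernoff with base 2: the mean of F is at most e^{2Np}, while more than 8Np nonzero entries
  -- force F ≥ 2^{8Np} ≥ e^{5Np}.
  have hmk := mul_meas_ge_le_integral_of_nonneg (μ := matMeasure ν)
    (Eventually.of_forall fun A => (by positivity : (0 : ℝ) ≤
      2 ^ (E.filter fun e => A e.1 e.2 ≠ 0).card).trans (hlow A)) hFint (Real.exp (5 * (N * p)))
  have hsub : {A : ι → κ → ℝ | 8 * (N * p) < (E.filter fun e => A e.1 e.2 ≠ 0).card} ⊆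
      {A | Real.exp (5 * (N * p)) ≤ F A} := by
    intro A hA
    refine le_trans ?_ (hlow A)
    have hA' : 8 * (N * p) < (E.filter fun e => A e.1 e.2 ≠ 0).card := hA
    rw [← Real.exp_log (show (0 : ℝ) < 2 by norm_num), ← Real.exp_nat_mul]
    refine Real.exp_le_exp.2 ?_
    have h2 := Real.log_two_gt_d9
    have h3 : (0 : ℝ) ≤ (E.filter fun e => A e.1 e.2 ≠ 0).card := Nat.cast_nonneg _
    nlinarith
  refine (measure_mono hsub).trans ?_
  rw [← ofReal_measureReal]
  refine ENNReal.ofReal_le_ofReal ?_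
  have h4 := hmk.trans hFE
  rw [mul_comm, ← le_div_iff₀ (Real.exp_pos _), ← Real.exp_sub] at h4
  refine h4.trans (le_of_eq ?_)
  congr 1
  ring

theorem matMeasure_degree_gt_le {ν : ι → κ → Measure ℝ} [∀ j k, IsProbabilityMeasure (ν j k)]
    {N p b M : ℝ} (hν : ∀ j k, SparseLaw (ν j k) N p b M) (hp : 0 ≤ p)
    (hι : (Fintype.card ι : ℝ) ≤ N) (hκ : (Fintype.card κ : ℝ) ≤ N) :
    matMeasure ν {A | ¬ ((∀ j, ((Finset.univ.filter fun k => A j k ≠ 0).card : ℝ) ≤ 8 * (N * p)) ∧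
      ∀ k, ((Finset.univ.filter fun j => A j k ≠ 0).card : ℝ) ≤ 8 * (N * p))} ≤
      ENNReal.ofReal (2 * N * Real.exp (-(3 * (N * p)))) := by
  have hN : 0 ≤ N := (Nat.cast_nonneg _).trans hι
  set q := ENNReal.ofReal (Real.exp (-(3 * (N * p)))) with hq
  have hrow : ∀ j, matMeasure ν
      {A | 8 * (N * p) < (Finset.univ.filter fun k => A j k ≠ 0).card} ≤ q := by
    intro j
    refine le_trans (le_of_eq ?_) (matMeasure_card_ne_zero_gt_le hν hp
      (Finset.univ.map (Function.Embedding.sectR j κ)) (by simpa using hκ))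
    congr 1
    ext A
    rw [Set.mem_ofPred_eq, Set.mem_ofPred_eq, Finset.filter_map, Finset.card_map]
    rfl
  have hcol : ∀ k, matMeasure ν
      {A | 8 * (N * p) < (Finset.univ.filter fun j => A j k ≠ 0).card} ≤ q := by
    intro k
    refine le_trans (le_of_eq ?_) (matMeasure_card_ne_zero_gt_le hν hp
      (Finset.univ.map (Function.Embedding.sectL ι k)) (by simpa using hι))
    congr 1
    ext A
    rw [Set.mem_ofPred_eq, Set.mem_ofPred_eq, Finset.filter_map, Finset.card_map]
    rfl
  have hsub : {A : ι → κ → ℝ |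
      ¬ ((∀ j, ((Finset.univ.filter fun k => A j k ≠ 0).card : ℝ) ≤ 8 * (N * p)) ∧
      ∀ k, ((Finset.univ.filter fun j => A j k ≠ 0).card : ℝ) ≤ 8 * (N * p))} ⊆
      (⋃ j, {A | 8 * (N * p) < (Finset.univ.filter fun k => A j k ≠ 0).card}) ∪
      ⋃ k, {A | 8 * (N * p) < (Finset.univ.filter fun j => A j k ≠ 0).card} := by
    intro A hA
    rw [Set.mem_ofPred_eq, not_and_or] at hA
    rcases hA with h | h
    · push Not at h
      exact Or.inl (Set.mem_iUnion.2 h)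
    · push Not at h
      exact Or.inr (Set.mem_iUnion.2 h)
  refine (measure_mono hsub).trans ((measure_union_le _ _).trans ?_)
  calc _ ≤ ∑ _j : ι, q + ∑ _k : κ, q := by
        refine add_le_add ?_ ?_
        · exact (measure_iUnion_fintype_le _ _).trans (Finset.sum_le_sum fun j _ => hrow j)
        · exact (measure_iUnion_fintype_le _ _).trans (Finset.sum_le_sum fun k _ => hcol k)
    _ = ENNReal.ofReal ((Fintype.card ι + Fintype.card κ) * Real.exp (-(3 * (N * p)))) := by
        rw [Finset.sum_const, Finset.sum_const, Finset.card_univ, Finset.card_univ, nsmul_eq_mul,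
          nsmul_eq_mul, ← add_mul, ENNReal.ofReal_mul (by positivity),
          ENNReal.ofReal_add (by positivity) (by positivity)]
        simp [hq]
    _ ≤ _ := by
        refine ENNReal.ofReal_le_ofReal ?_
        refine mul_le_mul_of_nonneg_right (by linarith) (Real.exp_pos _).le

end Degrees

/-! ### Flat bounds for all sets of coordinates -/

section FlatUnion

/-- By the binomial theorem, a failure probability y^|J| with Ny ≤ 1 survives a union bound over all
nonempty J. -/
theorem sum_nonempty_pow_card_le {κ : Type*} [Fintype κ] [DecidableEq κ] {y N : ℝ} (hy : 0 ≤ y)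
    (hκ : (Fintype.card κ : ℝ) ≤ N) (hNy : N * y ≤ 1) :
    ∑ J ∈ Finset.univ.filter (fun J : Finset κ => J.Nonempty), y ^ J.card ≤ 2 * N * y := by
  have h1 : ∑ J : Finset κ, y ^ J.card = (y + 1) ^ Fintype.card κ := by
    have := Finset.sum_pow_mul_eq_add_pow y 1 (Finset.univ : Finset κ)
    simpa using this
  have h2 : ∑ J ∈ Finset.univ.filter (fun J : Finset κ => J.Nonempty), y ^ J.card + 1 =
      (y + 1) ^ Fintype.card κ := by
    rw [← h1, ← Finset.sum_filter_add_sum_filter_not Finset.univ (fun J : Finset κ => J.Nonempty)]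
    congr 1
    have : Finset.univ.filter (fun J : Finset κ => ¬ J.Nonempty) = {∅} := by
      ext J; simp
    rw [this]
    simp
  have h3 : (y + 1) ^ Fintype.card κ ≤ Real.exp (N * y) := by
    calc _ ≤ Real.exp y ^ Fintype.card κ := by
          gcongr
          exact Real.add_one_le_exp y
      _ = Real.exp (Fintype.card κ * y) := by rw [Real.exp_nat_mul]
      _ ≤ _ := by gcongr
  have hN0 : 0 ≤ N := (Nat.cast_nonneg _).trans hκ
  have hNy0 : 0 ≤ N * y := by positivity
  have h4 := (abs_le.1 (Real.abs_exp_sub_one_sub_id_le (by rwa [abs_of_nonneg hNy0]))).2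
  nlinarith

theorem exists_matMeasure_flat_union_le :
    ∃ c : ℝ, 0 < c ∧ ∀ {ι κ : Type} [Fintype ι] [Fintype κ] [DecidableEq ι] [DecidableEq κ]
      {ν : ι → κ → Measure ℝ} [∀ j k, IsProbabilityMeasure (ν j k)] {N p b M : ℝ},
      (∀ j k, SparseLaw (ν j k) N p b M) → 0 < p → 0 < M → ∀ {η : ℝ}, 0 < η → 4 ≤ η * N →
      (Fintype.card ι : ℝ) ≤ N → Fintype.card κ + η * N ≤ (Fintype.card ι : ℝ) →
      ∀ {σ R ε Z G X : ℝ}, 0 < σ → σ ≤ c * η ^ 2 → 0 < ε → ε ≤ 1 / 2 → 0 ≤ R →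
      R * ε ^ 2 ≤ σ * (N * p) → 0 < Z → X * (G + 1 + 3 / ε) ≤ c * η * N →
      256 * M * Z * (G + 1 + 3 / ε) ≤ c * η * (N * p) → N * Real.exp (-G) ≤ 1 → 0 ≤ G →
      matMeasure ν {A | (∀ w : κ → ℝ, ∑ j, (∑ k, A j k * w k) ^ 2 ≤ R * ∑ k, w k ^ 2) ∧
        ¬ ∀ J : Finset κ, J.Nonempty → (J.card : ℝ) ≤ X →
          FlatBound A J (Z / J.card) (σ * (N * p))} ≤
      ENNReal.ofReal (2 * N * Real.exp (-G)) := by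
  obtain ⟨c, hc, hmain⟩ := exists_matMeasure_not_flatBound_le
  refine ⟨c, hc, ?_⟩
  intro ι κ _ _ _ _ ν _ N p b M hν hp hM η hη hηN hι hκι σ R ε Z G X hσ hση hε0 hε hR hRε hZ
    hX hG hNG hG0
  have hN : 0 < N := by
    by_contra h
    push Not at h
    nlinarith
  have hκN : (Fintype.card κ : ℝ) ≤ N := by nlinarith
  set S := Finset.univ.filter (fun J : Finset κ => J.Nonempty ∧ (J.card : ℝ) ≤ X) with hS
  have hsub : {A : ι → κ → ℝ | (∀ w : κ → ℝ, ∑ j, (∑ k, A j k * w k) ^ 2 ≤ R * ∑ k, w k ^ 2) ∧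
        ¬ ∀ J : Finset κ, J.Nonempty → (J.card : ℝ) ≤ X →
          FlatBound A J (Z / J.card) (σ * (N * p))} ⊆
      ⋃ J ∈ S, {A | (∀ w : κ → ℝ, ∑ j, (∑ k, A j k * w k) ^ 2 ≤ R * ∑ k, w k ^ 2) ∧
        ¬ FlatBound A J (Z / J.card) (σ * (N * p))} := by
    rintro A ⟨hop, hA⟩
    push Not at hA
    obtain ⟨J, hJ, hJX, hfl⟩ := hA
    simp only [Set.mem_iUnion]
    exact ⟨J, by rw [hS, Finset.mem_filter_univ]; exact ⟨hJ, hJX⟩, hop, hfl⟩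
  have hJ : ∀ J ∈ S, matMeasure ν
      {A | (∀ w : κ → ℝ, ∑ j, (∑ k, A j k * w k) ^ 2 ≤ R * ∑ k, w k ^ 2) ∧
        ¬ FlatBound A J (Z / J.card) (σ * (N * p))} ≤ ENNReal.ofReal (Real.exp (-G) ^ J.card) := by
    intro J hJS
    rw [hS, Finset.mem_filter_univ] at hJS
    have hm : (0 : ℝ) < J.card := by exact_mod_cast Finset.card_pos.2 hJS.1
    set m : ℝ := (J.card : ℝ) with hmdef
    -- The largest v permitted by both constraints of the one-set bound. In either case the exponent
    -- cηpvN dominates m(G + 1 + 3/ε), which pays for the net and leaves e^{-G} per element of J.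
    set v := min (1 / p) (m / (256 * M * Z)) with hv
    have hv0 : 0 < v := lt_min (by positivity) (by positivity)
    refine (hmain hν hp hM.le hη hηN hι hκι hσ hση hε0 hε hR hRε (ζ := Z / m) (v := v) hv0 ?_ ?_ J
      hJS.1).trans (ENNReal.ofReal_le_ofReal ?_)
    · calc p * v ≤ p * (1 / p) := by gcongr; exact min_le_left _ _
        _ = 1 := by field_simp
    · calc 256 * M * (Z / m) * v ≤ 256 * M * (Z / m) * (m / (256 * M * Z)) := by
            gcongr; exact min_le_right _ _
        _ = 1 := by field_simp
    · have h1 : m * (G + 1 + 3 / ε) ≤ c * η * (p * v * N) := by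
        rcases min_choice (1 / p) (m / (256 * M * Z)) with h | h
        · rw [hv, h, show p * (1 / p) * N = N by field_simp]
          refine le_trans ?_ hX
          have : 0 < 3 / ε := by positivity
          gcongr
          exact hJS.2
        · rw [hv, h]
          have h2 : c * η * (p * (m / (256 * M * Z)) * N) =
              m * (c * η * (N * p) / (256 * M * Z)) := by ring
          rw [h2]
          refine mul_le_mul_of_nonneg_left ?_ hm.le
          rw [le_div_iff₀ (by positivity)]
          linarith
      have h3 : (1 + 3 / ε) ^ J.card ≤ Real.exp (m * (3 / ε)) := by
        rw [hmdef, Real.exp_nat_mul]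
        gcongr
        linarith [Real.add_one_le_exp (3 / ε)]
      calc _ ≤ Real.exp m * Real.exp (m * (3 / ε)) * Real.exp (-(c * η * (p * v * N))) := by
            gcongr
        _ ≤ Real.exp (m * -G) := by
            rw [← Real.exp_add, ← Real.exp_add]
            refine Real.exp_le_exp.2 ?_
            linarith
        _ = _ := by rw [hmdef, Real.exp_nat_mul]
  refine (measure_mono hsub).trans ((measure_biUnion_finset_le _ _).trans ?_)
  calc _ ≤ ∑ J ∈ S, ENNReal.ofReal (Real.exp (-G) ^ J.card) := Finset.sum_le_sum hJ
    _ = ENNReal.ofReal (∑ J ∈ S, Real.exp (-G) ^ J.card) :=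
        (ENNReal.ofReal_sum_of_nonneg fun J _ => by positivity).symm
    _ ≤ _ := by
        refine ENNReal.ofReal_le_ofReal (le_trans ?_
          (sum_nonempty_pow_card_le (κ := κ) (Real.exp_pos _).le hκN hNG))
        refine Finset.sum_le_sum_of_subset_of_nonneg ?_ fun J _ _ => by positivity
        intro J hJS
        rw [hS, Finset.mem_filter_univ] at hJS
        rw [Finset.mem_filter_univ]
        exact hJS.1

/-- The entropy is now of order N, so the row factor q has to be small. With ε = c₀/K and w = 1/c₀²
one gets q ≤ 5c₀ and (1 + 3/ε)q ≤ 20K, a bound free of c₀. The surplus of at least ηN/4 factors q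
then beats all remaining exponentials once c₀ is small, which is `hsmall`. -/
theorem matMeasure_flat_last_union_le {ι κ : Type} [Fintype ι] [Fintype κ] [DecidableEq ι]
    [DecidableEq κ] {ν : ι → κ → Measure ℝ} [∀ j k, IsProbabilityMeasure (ν j k)] {N p b M : ℝ}
    (hν : ∀ j k, SparseLaw (ν j k) N p b M) (hp : 0 < p) (hM : 0 < M) {η : ℝ} (hη : 0 < η)
    (hηN : 4 ≤ η * N) (hι : (Fintype.card ι : ℝ) ≤ N)
    (hκι : Fintype.card κ + η * N ≤ (Fintype.card ι : ℝ)) {c₀ K ζ X : ℝ} (hc₀ : 0 < c₀)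
    (hK : 2 * c₀ ≤ K) (hK1 : 1 ≤ K) (hζ : 0 < ζ) (hζ' : 64 * M * ζ ≤ c₀ ^ 3 * p)
    (hX : X ≤ η * N / 4)
    (hsmall : (5 * c₀) ^ (η / 4) * Real.exp (3 + 8 / η + 20 * K) ≤ 1) :
    matMeasure ν {A | (∀ w : κ → ℝ, ∑ j, (∑ k, A j k * w k) ^ 2 ≤
        K ^ 2 * (N * p) * ∑ k, w k ^ 2) ∧
      ¬ ∀ J : Finset κ, (Jᶜ.card : ℝ) ≤ X → FlatBound A J ζ (c₀ ^ 2 * (N * p))} ≤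
      ENNReal.ofReal (Real.exp (-N)) := by
  have hN : 0 < N := by
    by_contra h
    push Not at h
    nlinarith
  have hκN : (Fintype.card κ : ℝ) ≤ N := by nlinarith
  have hK0 : 0 < K := by linarith
  have h5 : 5 * c₀ ≤ 1 := by
    by_contra h
    push Not at h
    have h1 : 1 < (5 * c₀) ^ (η / 4) := Real.one_lt_rpow h (by positivity)
    have h2 : 1 ≤ Real.exp (3 + 8 / η + 20 * K) := Real.one_le_exp (by positivity)
    nlinarith
  set ε := c₀ / K with hε
  have hε0 : 0 < ε := by positivity
  have hε2 : ε ≤ 1 / 2 := by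
    rw [hε, div_le_iff₀ hK0]; linarith
  set q : ℝ := 4 / √(1 / c₀ ^ 2) + 64 * M * ζ * (1 / c₀ ^ 2) / p with hq
  have hq0 : 0 ≤ q := by positivity
  have hq5 : q ≤ 5 * c₀ := by
    have h1 : √(1 / c₀ ^ 2) = 1 / c₀ := by
      rw [Real.sqrt_div zero_le_one, Real.sqrt_one, Real.sqrt_sq hc₀.le]
    have h2 : 64 * M * ζ * (1 / c₀ ^ 2) / p ≤ c₀ := by
      rw [div_le_iff₀ hp, mul_one_div, div_le_iff₀ (by positivity)]
      calc _ ≤ c₀ ^ 3 * p := hζ'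
        _ = _ := by ring
    rw [hq, h1]
    have h3 : 4 / (1 / c₀) = 4 * c₀ := by field_simp
    linarith
  have hbound : Real.exp N * (Real.exp N * (1 + 3 / ε) ^ Fintype.card κ *
      (Real.exp (8 * (1 / c₀ ^ 2) * c₀ ^ 2 * N / η) *
        q ^ (Fintype.card κ + ⌊η * N / 2⌋₊))) ≤ Real.exp (-N) := by
    set n := Fintype.card κ
    set t := ⌊η * N / 2⌋₊ with ht
    have ht4 : η / 4 * N ≤ t := by
      have := Nat.lt_floor_add_one (η * N / 2)
      rw [← ht] at this
      linarith
    have e1 : (1 + 3 / ε) ^ n * q ^ n ≤ Real.exp (20 * K * N) := by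
      rw [← mul_pow]
      have h1 : (1 + 3 / ε) * q ≤ 20 * K := by
        have h2 : 1 + 3 / ε ≤ 4 / ε := by
          rw [← sub_nonneg]
          have : 4 / ε - (1 + 3 / ε) = (1 - ε) / ε := by field_simp; ring
          rw [this]
          exact div_nonneg (by linarith) hε0.le
        calc _ ≤ 4 / ε * (5 * c₀) := by gcongr
          _ = _ := by rw [hε]; field_simp; norm_num
      have h3 : 0 ≤ (1 + 3 / ε) * q := by positivity
      calc _ ≤ Real.exp (20 * K) ^ n := by
            gcongr
            linarith [Real.add_one_le_exp (20 * K)]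
        _ = Real.exp (n * (20 * K)) := by rw [Real.exp_nat_mul]
        _ ≤ _ := by
            refine Real.exp_le_exp.2 ?_
            rw [mul_comm]
            gcongr
    have e2 : q ^ t ≤ ((5 * c₀) ^ (η / 4)) ^ N := by
      calc q ^ t ≤ (5 * c₀) ^ t := by gcongr
        _ = (5 * c₀) ^ (t : ℝ) := (Real.rpow_natCast _ _).symm
        _ ≤ (5 * c₀) ^ (η / 4 * N) :=
            Real.rpow_le_rpow_of_exponent_ge (by positivity) h5 ht4
        _ = _ := Real.rpow_mul (by positivity) _ _
    have e3 : ((5 * c₀) ^ (η / 4)) ^ N ≤ Real.exp (-(3 + 8 / η + 20 * K) * N) := by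
      rw [Real.exp_mul]
      refine Real.rpow_le_rpow (by positivity) ?_ hN.le
      rw [Real.exp_neg, ← one_div, le_div_iff₀ (Real.exp_pos _)]
      exact hsmall
    have e4 : 8 * (1 / c₀ ^ 2) * c₀ ^ 2 * N / η = 8 / η * N := by field_simp
    rw [e4, pow_add]
    calc _ = Real.exp N * Real.exp N * Real.exp (8 / η * N) *
          ((1 + 3 / ε) ^ n * q ^ n) * q ^ t := by ring
      _ ≤ Real.exp N * Real.exp N * Real.exp (8 / η * N) *
          Real.exp (20 * K * N) * Real.exp (-(3 + 8 / η + 20 * K) * N) := by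
          gcongr
          exact e2.trans e3
      _ = Real.exp (-N) := by
          simp only [← Real.exp_add]
          congr 1
          ring
  set S := Finset.univ.filter (fun J : Finset κ => (Jᶜ.card : ℝ) ≤ X) with hS
  have hsub : {A : ι → κ → ℝ | (∀ w : κ → ℝ, ∑ j, (∑ k, A j k * w k) ^ 2 ≤
        K ^ 2 * (N * p) * ∑ k, w k ^ 2) ∧
      ¬ ∀ J : Finset κ, (Jᶜ.card : ℝ) ≤ X → FlatBound A J ζ (c₀ ^ 2 * (N * p))} ⊆
      ⋃ J ∈ S, {A | (∀ w : κ → ℝ, ∑ j, (∑ k, A j k * w k) ^ 2 ≤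
        K ^ 2 * (N * p) * ∑ k, w k ^ 2) ∧ ¬ FlatBound A J ζ (c₀ ^ 2 * (N * p))} := by
    rintro A ⟨hop, hA⟩
    push Not at hA
    obtain ⟨J, hJX, hfl⟩ := hA
    simp only [Set.mem_iUnion]
    exact ⟨J, by rw [hS, Finset.mem_filter_univ]; exact hJX, hop, hfl⟩
  refine (measure_mono hsub).trans ((measure_biUnion_finset_le _ _).trans ?_)
  calc _ ≤ ∑ J ∈ S, ENNReal.ofReal (Real.exp N * (1 + 3 / ε) ^ Fintype.card κ *
          (Real.exp (8 * (1 / c₀ ^ 2) * c₀ ^ 2 * N / η) *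
            q ^ (Fintype.card κ + ⌊η * N / 2⌋₊))) := by
        refine Finset.sum_le_sum fun J hJ => ?_
        rw [hS, Finset.mem_filter_univ] at hJ
        exact matMeasure_not_flatBound_last_le hν hp hM hη hN hι hκι (by positivity) hε0 hε2
          (by positivity) (by rw [hε, div_pow]; exact le_of_eq (by field_simp))
          (by positivity) hζ J (hJ.trans hX)
    _ = ENNReal.ofReal (S.card * (Real.exp N * (1 + 3 / ε) ^ Fintype.card κ *
          (Real.exp (8 * (1 / c₀ ^ 2) * c₀ ^ 2 * N / η) *
            q ^ (Fintype.card κ + ⌊η * N / 2⌋₊)))) := by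
        rw [Finset.sum_const, nsmul_eq_mul, ENNReal.ofReal_mul (Nat.cast_nonneg _),
          ENNReal.ofReal_natCast]
    _ ≤ _ := by
        refine ENNReal.ofReal_le_ofReal (le_trans ?_ hbound)
        have hScard : (S.card : ℝ) ≤ Real.exp N := by
          have h1 : S.card ≤ 2 ^ Fintype.card κ := by
            rw [← Fintype.card_finset]
            exact Finset.card_le_univ _
          calc (S.card : ℝ) ≤ 2 ^ Fintype.card κ := by exact_mod_cast h1
            _ ≤ Real.exp 1 ^ Fintype.card κ := by
                gcongr
                linarith [Real.add_one_le_exp (1 : ℝ)]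
            _ = Real.exp (Fintype.card κ) := by rw [Real.exp_one_pow]
            _ ≤ _ := Real.exp_le_exp.2 hκN
        gcongr

end FlatUnion

/-! ### The smallest singular value for bounded entries -/

section SmallestSingularValue

theorem ae_matMeasure_abs_le {ι κ : Type*} [Fintype ι] [Fintype κ] {ν : ι → κ → Measure ℝ}
    [∀ j k, IsProbabilityMeasure (ν j k)] {N p b M : ℝ} (hν : ∀ j k, SparseLaw (ν j k) N p b M) :
    ∀ᵐ A ∂(matMeasure ν), ∀ j k, |A j k| ≤ b := by
  rw [ae_all_iff]
  intro j
  rw [ae_all_iff]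
  intro k
  have h1 := (measurePreserving_eval (fun k => ν j k) k).quasiMeasurePreserving.ae (hν j k).abs_le
  exact (measurePreserving_eval (fun j => Measure.pi fun k => ν j k) j).quasiMeasurePreserving.ae h1

theorem exists_flat_constant {c η K : ℝ} (hc : 0 < c) (hη : 0 < η) (hK : 1 ≤ K) :
    ∃ c₀ : ℝ, 0 < c₀ ∧ c₀ ^ 2 ≤ c * η ^ 2 ∧ 2 * c₀ ≤ K ∧
      (5 * c₀) ^ (η / 4) * Real.exp (3 + 8 / η + 20 * K) ≤ 1 := by
  set E := 3 + 8 / η + 20 * K with hE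
  have hE0 : 0 < E := by positivity
  refine ⟨min (√c * η) (1 / 5 * Real.exp (-(4 / η * E))), lt_min (by positivity) (by positivity),
    ?_, ?_, ?_⟩
  · have h1 : 0 ≤ min (√c * η) (1 / 5 * Real.exp (-(4 / η * E))) :=
      le_min (by positivity) (by positivity)
    calc _ ≤ (√c * η) ^ 2 := by gcongr; exact min_le_left _ _
      _ = _ := by rw [mul_pow, Real.sq_sqrt hc.le]
  · have h1 : min (√c * η) (1 / 5 * Real.exp (-(4 / η * E))) ≤ 1 / 5 := by
      refine (min_le_right _ _).trans (mul_le_of_le_one_right (by norm_num) ?_)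
      exact Real.exp_le_one_iff.2 (by
        have : 0 < 4 / η * E := by positivity
        linarith)
    linarith
  · have h1 : 0 ≤ min (√c * η) (1 / 5 * Real.exp (-(4 / η * E))) :=
      le_min (by positivity) (by positivity)
    have h2 : 5 * min (√c * η) (1 / 5 * Real.exp (-(4 / η * E))) ≤ Real.exp (-(4 / η * E)) := by
      have := min_le_right (√c * η) (1 / 5 * Real.exp (-(4 / η * E)))
      linarith
    calc _ ≤ Real.exp (-(4 / η * E)) ^ (η / 4) * Real.exp E := by gcongr
      _ = 1 := by
        rw [← Real.exp_mul, ← Real.exp_add, Real.exp_eq_one_iff]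
        field_simp
        ring

set_option maxHeartbeats 1600000 in
/-- A sparse random matrix with more rows than columns has a large smallest singular value. -/
theorem exists_matMeasure_small_image_le {η : ℝ} (hη : 0 < η) :
    ∃ τ : ℝ, 0 < τ ∧ ∀ M : ℝ, 0 < M → ∀ Q : ℝ, 0 < Q → ∃ lam₀ : ℝ,
      ∀ {ι κ : Type} [Fintype ι] [Fintype κ] [DecidableEq ι] [DecidableEq κ]
      {ν : ι → κ → Measure ℝ} [∀ j k, IsProbabilityMeasure (ν j k)] {N p b lam : ℝ},
      (∀ j k, SparseLaw (ν j k) N p b M) → 0 < p → p ≤ 1 → 1 ≤ b → 0 < N → lam₀ ≤ lam →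
      N * p = lam ^ 16 → Real.log N ≤ lam ^ 6 → b ^ 2 ≤ lam ^ 16 →
      2 * ((Q + 3) * Real.log N) * b ^ 2 ≤ lam ^ 16 →
      (Fintype.card ι : ℝ) ≤ N → Fintype.card κ + η * N ≤ (Fintype.card ι : ℝ) →
      matMeasure ν {A | ∃ x : κ → ℝ, ∑ k, x k ^ 2 = 1 ∧
        ∑ j, (∑ k, A j k * x k) ^ 2 ≤ τ * (N * p)} ≤
      ENNReal.ofReal (7 * Real.exp (-(Q * Real.log N))) := by
  obtain ⟨c, hc, hunion⟩ := exists_matMeasure_flat_union_le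
  set K : ℝ := 144 * Real.exp 3 + 1 with hK
  have hK1 : 1 ≤ K := by
    have := Real.exp_pos 3
    rw [hK]; linarith
  have hK0 : 0 < K := by linarith
  obtain ⟨c₀, hc₀, hc₀η, hc₀K, hsmall⟩ := exists_flat_constant hc hη hK1
  -- With d = 64, R = K²Np and s = c₀²Np, this makes the near-level error 8d³R/a at most s/64. The
  -- width a is independent of N, hence so is τ.
  obtain ⟨a, ha⟩ := exists_nat_gt (8 * 64 ^ 3 * K ^ 2 * 64 / c₀ ^ 2)
  have ha0 : (0 : ℝ) < a := lt_trans (by positivity) ha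
  have haN : 0 < a := by exact_mod_cast ha0
  refine ⟨c₀ ^ 2 / (512 * a), by positivity, ?_⟩
  intro M hM Q hQ
  set ε := c₀ / K with hε
  have hε0 : 0 < ε := by positivity
  have hε2 : ε ≤ 1 / 2 := by rw [hε, div_le_iff₀ hK0]; linarith
  set C := Q + 4 + 3 / ε with hC
  have hC0 : 0 < C := by positivity
  refine ⟨3 + (4 * a + 2) + 2048 * 64 / c₀ ^ 2 + C / (c * η) + 4096 * M * C / (c * η) +
    1024 * M / c₀ ^ 3 + 4 / η + (Q + 1), ?_⟩
  intro ι κ _ _ _ _ ν _ N p b lam hν hp hp1 hb hN hlam hD hlog hbD hQb hι hκι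
  have hlams : 3 ≤ lam ∧ 4 * a + 2 ≤ lam ∧ 2048 * 64 / c₀ ^ 2 ≤ lam ∧ C / (c * η) ≤ lam ∧
      4096 * M * C / (c * η) ≤ lam ∧ 1024 * M / c₀ ^ 3 ≤ lam ∧ 4 / η ≤ lam ∧ Q + 1 ≤ lam := by
    have h1 : 0 < 2048 * 64 / c₀ ^ 2 := by positivity
    have h2 : 0 < C / (c * η) := by positivity
    have h3 : 0 < 4096 * M * C / (c * η) := by positivity
    have h4 : 0 < 1024 * M / c₀ ^ 3 := by positivity
    have h5 : 0 < 4 / η := by positivity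
    refine ⟨?_, ?_, ?_, ?_, ?_, ?_, ?_, ?_⟩ <;> linarith
  obtain ⟨l3, la, lc₀, lC, lMC, lM, lη, lQ⟩ := hlams
  have l1 : 1 ≤ lam := by linarith
  have l0 : 0 < lam := by linarith
  have hNlam : lam ^ 16 ≤ N := by
    rw [← hD]; exact mul_le_of_le_one_right hN.le hp1
  have hlamN : lam ≤ N := le_trans (le_self_pow₀ l1 (by norm_num)) hNlam
  have hloglam : 1 ≤ Real.log lam := by
    rw [Real.le_log_iff_exp_le l0]
    linarith [Real.exp_one_lt_d9]
  set ℓ := Real.log N with hℓ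
  have hℓ1 : 1 ≤ ℓ := hloglam.trans (Real.log_le_log l0 hlamN)
  have hexpℓ : Real.exp ℓ = N := Real.exp_log hN
  have hηN : 4 ≤ η * N := by
    rw [div_le_iff₀ hη] at lη
    refine lη.trans ?_
    rw [mul_comm]
    gcongr
  have hκN : (Fintype.card κ : ℝ) ≤ N := by linarith
  have hDpos : 0 < N * p := by positivity
  -- the number of levels
  have hX1 : 1 ≤ N / (lam * ℓ) := by
    rw [le_div_iff₀ (by positivity), one_mul]
    calc lam * ℓ ≤ lam * lam ^ 6 := by gcongr
      _ = lam ^ 7 := by ring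
      _ ≤ lam ^ 16 := pow_le_pow_right₀ l1 (by norm_num)
      _ ≤ N := hNlam
  -- The cut-off lam^L ≈ N/(lam · log N) balances two demands: for |J| ≤ lam^L the entropy |J| log N
  -- must stay below a small multiple of N, and the top level must have squares at most lam⁸/N.
  obtain ⟨L, hL1, hL2⟩ := exists_nat_pow_near hX1 (by linarith : 1 < lam)
  set X := N / (lam * ℓ) with hX
  have hXN : X ≤ N / lam := by
    rw [hX]
    exact div_le_div_of_nonneg_left hN.le l0 (le_mul_of_one_le_right l0.le hℓ1)
  have hLℓ : (L : ℝ) ≤ lam ^ 6 := by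
    have h1 : lam ^ L ≤ N := hL1.trans (hXN.trans (div_le_self hN.le l1))
    have h2 : L * Real.log lam ≤ ℓ := by
      rw [← Real.log_pow]
      exact Real.log_le_log (by positivity) h1
    exact (le_mul_of_one_le_right (Nat.cast_nonneg _) hloglam).trans (h2.trans hlog)
  set n := L + 2 * (2 * a) + 1 with hn
  have hn7 : (n : ℝ) ≤ lam ^ 7 := by
    rw [hn]
    push_cast
    have h1 : (1 : ℝ) ≤ lam ^ 6 := one_le_pow₀ l1
    have h2 : (4 * a + 2) * lam ^ 6 ≤ lam * lam ^ 6 := by gcongr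
    have h3 : (4 * (a : ℝ) + 1) * 1 ≤ (4 * a + 1) * lam ^ 6 := by gcongr
    calc (L : ℝ) + 2 * (2 * a) + 1 ≤ lam ^ 6 + (4 * a + 1) * lam ^ 6 := by linarith
      _ = (4 * a + 2) * lam ^ 6 := by ring
      _ ≤ lam * lam ^ 6 := h2
      _ = lam ^ 7 := by ring
  have hn0 : (0 : ℝ) < n := by rw [hn]; positivity
  -- the operator norm
  obtain ⟨r, hr1, hr2⟩ := exists_nat_pow_near (x := (Q + 3) * ℓ) (y := (2 : ℝ))
    (one_le_mul_of_one_le_of_one_le (by linarith) hℓ1) (by norm_num)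
  have hop := matMeasure_opNorm_gt_le hν hp (by linarith : 0 < b)
    (hp1.trans (one_le_pow₀ hb)) hN hι hκN (r := r) (by
      rw [← mul_div_assoc, le_div_iff₀ (by positivity), hD]
      refine le_trans ?_ hQb
      gcongr
      rw [pow_succ]
      linarith)
  have hop' : 2 * N * (b ^ 2 / p) * Real.exp (-(2 : ℝ) ^ (r + 1)) ≤ 2 * Real.exp (-(Q * ℓ)) := by
    have h1 : b ^ 2 / p ≤ N := by rw [div_le_iff₀ hp, hD]; exact hbD
    have h2 : Real.exp (-(2 : ℝ) ^ (r + 1)) ≤ Real.exp (-((Q + 3) * ℓ)) :=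
      Real.exp_le_exp.2 (by linarith)
    calc _ ≤ 2 * N * N * Real.exp (-((Q + 3) * ℓ)) := by gcongr
      _ = 2 * (Real.exp ℓ * Real.exp ℓ * Real.exp (-((Q + 3) * ℓ))) := by rw [hexpℓ]; ring
      _ = 2 * Real.exp (-((Q + 1) * ℓ)) := by
          rw [← Real.exp_add, ← Real.exp_add]; congr 2; ring
      _ ≤ _ := by
          have : Real.exp (-((Q + 1) * ℓ)) ≤ Real.exp (-(Q * ℓ)) :=
            Real.exp_le_exp.2 (by linarith)
          linarith
  -- the degrees
  have hdeg := matMeasure_degree_gt_le hν hp.le hι hκN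
  have hQD : (Q + 1) * ℓ ≤ lam ^ 16 := by
    calc (Q + 1) * ℓ ≤ lam * lam ^ 6 := by gcongr
      _ = lam ^ 7 := by ring
      _ ≤ lam ^ 16 := pow_le_pow_right₀ l1 (by norm_num)
  have hdeg' : 2 * N * Real.exp (-(3 * (N * p))) ≤ 2 * Real.exp (-(Q * ℓ)) := by
    have h1 : Real.exp (-(3 * (N * p))) ≤ Real.exp (-((Q + 1) * ℓ)) := by
      refine Real.exp_le_exp.2 ?_
      rw [hD]
      have : 0 < lam ^ 16 := by positivity
      linarith
    calc _ ≤ 2 * N * Real.exp (-((Q + 1) * ℓ)) := by gcongr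
      _ = 2 * (Real.exp ℓ * Real.exp (-((Q + 1) * ℓ))) := by rw [hexpℓ]; ring
      _ = _ := by rw [← Real.exp_add]; congr 2; ring
  -- the spread out vectors
  have hG : (Q + 3) * ℓ + 1 + 3 / ε ≤ C * ℓ := by
    have : 0 < 3 / ε := by positivity
    rw [hC]
    calc (Q + 3) * ℓ + 1 + 3 / ε ≤ (Q + 3) * ℓ + 1 * ℓ + 3 / ε * ℓ := by
          have := le_mul_of_one_le_right this.le hℓ1
          linarith
      _ = _ := by ring
  have h3 := hunion hν hp hM hη hηN hι hκι (σ := c₀ ^ 2) (R := K ^ 2 * (N * p)) (ε := ε)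
    (Z := 16 * n * lam) (G := (Q + 3) * ℓ) (X := X) (by positivity) hc₀η hε0 hε2 (by positivity)
    (by rw [hε, div_pow]; exact le_of_eq (by field_simp)) (by positivity)
    (by
      have hX0 : 0 < X := by linarith
      calc X * ((Q + 3) * ℓ + 1 + 3 / ε) ≤ X * (C * ℓ) := by gcongr
        _ = N * (C / lam) := by rw [hX]; field_simp
        _ ≤ N * (c * η) := by
            rw [div_le_iff₀ (by positivity)] at lC
            gcongr
            rw [div_le_iff₀ l0]
            linarith
        _ = _ := by ring)
    (by
      rw [div_le_iff₀ (by positivity)] at lMC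
      calc 256 * M * (16 * n * lam) * ((Q + 3) * ℓ + 1 + 3 / ε)
          ≤ 256 * M * (16 * lam ^ 7 * lam) * (C * lam ^ 6) := by
            gcongr
            exact hG.trans (by gcongr)
        _ = 4096 * M * C * lam ^ 14 := by ring
        _ ≤ lam * (c * η) * lam ^ 14 := by gcongr
        _ = c * η * lam ^ 15 := by ring
        _ ≤ c * η * lam ^ 16 := by
            have := pow_le_pow_right₀ l1 (show 15 ≤ 16 by norm_num)
            gcongr
        _ = _ := by rw [hD])
    (by
      rw [← hexpℓ, ← Real.exp_add]
      refine Real.exp_le_one_iff.2 ?_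
      have : 0 ≤ (Q + 2) * ℓ := by positivity
      linarith)
    (by positivity)
  have h3' : 2 * N * Real.exp (-((Q + 3) * ℓ)) ≤ 2 * Real.exp (-(Q * ℓ)) := by
    calc _ = 2 * (Real.exp ℓ * Real.exp (-((Q + 3) * ℓ))) := by rw [hexpℓ]; ring
      _ = 2 * Real.exp (-((Q + 2) * ℓ)) := by rw [← Real.exp_add]; congr 2; ring
      _ ≤ _ := by
          have : Real.exp (-((Q + 2) * ℓ)) ≤ Real.exp (-(Q * ℓ)) :=
            Real.exp_le_exp.2 (by linarith)
          linarith
  -- the vectors that are spread out over most coordinates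
  have hζ : 16 * n * (lam ^ L)⁻¹ ≤ 16 * lam ^ 15 / N := by
    have h1 : (lam ^ L)⁻¹ ≤ lam ^ 8 / N := by
      rw [inv_le_comm₀ (by positivity) (by positivity), inv_div]
      have h2 : X / lam ≤ lam ^ L := by
        rw [div_le_iff₀ l0, ← pow_succ]; exact hL2.le
      refine le_trans ?_ h2
      rw [hX, div_div]
      refine div_le_div_of_nonneg_left hN.le (by positivity) ?_
      calc lam * ℓ * lam ≤ lam * lam ^ 6 * lam := by gcongr
        _ = lam ^ 8 := by ring
    calc _ ≤ 16 * lam ^ 7 * (lam ^ 8 / N) := by gcongr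
      _ = _ := by ring
  have h4 := matMeasure_flat_last_union_le hν hp hM hη hηN hι hκι (c₀ := c₀) (K := K)
    (ζ := 16 * n * (lam ^ L)⁻¹) (X := X) hc₀ hc₀K hK1 (by positivity)
    (by
      rw [div_le_iff₀ (by positivity)] at lM
      calc 64 * M * (16 * n * (lam ^ L)⁻¹) ≤ 64 * M * (16 * lam ^ 15 / N) := by gcongr
        _ = 1024 * M * (lam ^ 15 / N) := by ring
        _ ≤ lam * c₀ ^ 3 * (lam ^ 15 / N) := by gcongr
        _ = c₀ ^ 3 * (lam ^ 16 / N) := by ring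
        _ = c₀ ^ 3 * p := by rw [← hD]; field_simp)
    (by
      refine hXN.trans ?_
      rw [div_le_iff₀ l0]
      rw [div_le_iff₀ hη] at lη
      have : N * 4 ≤ N * (lam * η) := by gcongr
      linarith)
    hsmall
  have h4' : Real.exp (-N) ≤ Real.exp (-(Q * ℓ)) := by
    refine Real.exp_le_exp.2 ?_
    linarith
  -- the exceptional events
  set B1 := {A : ι → κ → ℝ | ∃ x : κ → ℝ, K ^ 2 * (N * p) * ∑ k, x k ^ 2 <
      ∑ j, (∑ k, A j k * x k) ^ 2} with hB1
  set B2 := {A : ι → κ → ℝ |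
    ¬ ((∀ j, ((Finset.univ.filter fun k => A j k ≠ 0).card : ℝ) ≤ 8 * (N * p)) ∧
      ∀ k, ((Finset.univ.filter fun j => A j k ≠ 0).card : ℝ) ≤ 8 * (N * p))} with hB2
  set B3 := {A : ι → κ → ℝ |
    (∀ w : κ → ℝ, ∑ j, (∑ k, A j k * w k) ^ 2 ≤ K ^ 2 * (N * p) * ∑ k, w k ^ 2) ∧
        ¬ ∀ J : Finset κ, J.Nonempty → (J.card : ℝ) ≤ X →
          FlatBound A J (16 * n * lam / J.card) (c₀ ^ 2 * (N * p))} with hB3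
  set B4 := {A : ι → κ → ℝ |
    (∀ w : κ → ℝ, ∑ j, (∑ k, A j k * w k) ^ 2 ≤ K ^ 2 * (N * p) * ∑ k, w k ^ 2) ∧
      ¬ ∀ J : Finset κ, (Jᶜ.card : ℝ) ≤ X →
        FlatBound A J (16 * n * (lam ^ L)⁻¹) (c₀ ^ 2 * (N * p))} with hB4
  set B5 := {A : ι → κ → ℝ | ¬ ∀ j k, |A j k| ≤ b} with hB5
  have hsub : {A : ι → κ → ℝ | ∃ x : κ → ℝ, ∑ k, x k ^ 2 = 1 ∧
      ∑ j, (∑ k, A j k * x k) ^ 2 ≤ c₀ ^ 2 / (512 * a) * (N * p)} ⊆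
      B1 ∪ B2 ∪ B3 ∪ B4 ∪ B5 := by
    rintro A ⟨x, hx, hAx⟩
    by_contra hnot
    simp only [Set.mem_union, not_or] at hnot
    obtain ⟨⟨⟨⟨n1, n2⟩, n3⟩, n4⟩, n5⟩ := hnot
    have hop : ∀ w : κ → ℝ, ∑ j, (∑ k, A j k * w k) ^ 2 ≤ K ^ 2 * (N * p) * ∑ k, w k ^ 2 := by
      simpa [hB1] using n1
    have hdg := not_not.1 n2
    have hf3 := not_not.1 (fun h => n3 ⟨hop, h⟩)
    have hf4 := not_not.1 (fun h => n4 ⟨hop, h⟩)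
    have hab := not_not.1 n5
    have hfl := le_sum_sq_of_flatBound (A := A) (R := K ^ 2 * (N * p)) (s := c₀ ^ 2 * (N * p))
      (lam := lam) (b := b) (L := L) (a := a) (d := 64) (Δ := ⌊8 * (N * p)⌋₊) (n := n)
      (by positivity) (by positivity) haN (by norm_num) hn hop l1 hab
      (fun j => Nat.le_floor (hdg.1 j)) (fun k => Nat.le_floor (hdg.2 k))
      (fun J hJ hJc => hf3 J hJ (hJc.trans hL1)) (fun J hJc => hf4 J (hJc.trans hL1)) hx
    have hΔ : (⌊8 * (N * p)⌋₊ : ℝ) ≤ 8 * lam ^ 16 := by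
      rw [← hD]; exact Nat.floor_le (by positivity)
    have f1 : 8 * ((64 : ℕ) : ℝ) ^ 3 / a * (K ^ 2 * (N * p)) ≤ c₀ ^ 2 * (N * p) / 64 := by
      rw [div_lt_iff₀ (by positivity)] at ha
      have : 8 * ((64 : ℕ) : ℝ) ^ 3 / a * (K ^ 2 * (N * p)) =
          (8 * 64 ^ 3 * K ^ 2 * 64) * (N * p) / (64 * a) := by
        push_cast
        field_simp
      rw [this, div_le_div_iff₀ (by positivity) (by norm_num)]
      have h1 : 8 * 64 ^ 3 * K ^ 2 * 64 * (N * p) ≤ a * c₀ ^ 2 * (N * p) := by gcongr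
      linarith
    -- The powers of lam add up to 7 + 6 + 48 + 16 + 1 − 64 = 14, against the 16 of D; this is what
    -- the distance d = 64 is for.
    have f2 : 4 * n * (L * ((⌊8 * (N * p)⌋₊ : ℝ) ^ 3 * b ^ 2 * lam * (lam ^ 64)⁻¹)) ≤
        c₀ ^ 2 * (N * p) / 64 := by
      calc _ ≤ 4 * lam ^ 7 * (lam ^ 6 * ((8 * lam ^ 16) ^ 3 * lam ^ 16 * lam * (lam ^ 64)⁻¹)) := by
            gcongr
        _ = 2048 * lam ^ 14 := by
            have : lam ^ 64 ≠ 0 := by positivity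
            field_simp
            ring
        _ ≤ c₀ ^ 2 * lam ^ 16 / 64 := by
            rw [div_le_iff₀ (by positivity)] at lc₀
            have h1 : 2048 * 64 ≤ c₀ ^ 2 * lam ^ 2 := by
              refine lc₀.trans ?_
              rw [mul_comm]
              gcongr
              exact le_self_pow₀ l1 (by norm_num)
            have h2 : 2048 * 64 * lam ^ 14 ≤ c₀ ^ 2 * lam ^ 2 * lam ^ 14 := by gcongr
            have h3 : c₀ ^ 2 * lam ^ 2 * lam ^ 14 = c₀ ^ 2 * lam ^ 16 := by ring
            linarith
        _ = _ := by rw [hD]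
    have f3 : 8 * a * ∑ j, (∑ k, A j k * x k) ^ 2 ≤ c₀ ^ 2 * (N * p) / 64 := by
      calc _ ≤ 8 * a * (c₀ ^ 2 / (512 * a) * (N * p)) := by gcongr
        _ = _ := by field_simp; norm_num
    -- The three terms are at most s/64 each, contradicting the lower bound s/16.
    have f4 : 0 < c₀ ^ 2 * (N * p) := by positivity
    linarith
  have hB5' : matMeasure ν B5 = 0 := ae_matMeasure_abs_le hν
  calc _ ≤ matMeasure ν (B1 ∪ B2 ∪ B3 ∪ B4 ∪ B5) := measure_mono hsub
    _ ≤ matMeasure ν B1 + matMeasure ν B2 + matMeasure ν B3 + matMeasure ν B4 +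
        matMeasure ν B5 := by
        refine (measure_union_le _ _).trans (add_le_add ?_ le_rfl)
        refine (measure_union_le _ _).trans (add_le_add ?_ le_rfl)
        refine (measure_union_le _ _).trans (add_le_add ?_ le_rfl)
        exact measure_union_le _ _
    _ ≤ ENNReal.ofReal (2 * Real.exp (-(Q * ℓ))) + ENNReal.ofReal (2 * Real.exp (-(Q * ℓ))) +
        ENNReal.ofReal (2 * Real.exp (-(Q * ℓ))) + ENNReal.ofReal (Real.exp (-(Q * ℓ))) + 0 := by
        gcongr
        · exact hop.trans (ENNReal.ofReal_le_ofReal hop')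
        · exact hdeg.trans (ENNReal.ofReal_le_ofReal hdeg')
        · exact h3.trans (ENNReal.ofReal_le_ofReal h3')
        · exact h4.trans (ENNReal.ofReal_le_ofReal h4')
        · exact hB5'.le
    _ = _ := by
        rw [add_zero, ← ENNReal.ofReal_add (by positivity) (by positivity),
          ← ENNReal.ofReal_add (by positivity) (by positivity),
          ← ENNReal.ofReal_add (by positivity) (by positivity)]
        congr 1
        ring

end SmallestSingularValue

/-! ### Truncation of heavy-tailed entries -/

section Truncation

/-- Mean zero, second moment `p`, moment of order `4 + δ` at most `p * m`, and mass at most `p`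
outside the origin. -/
structure HeavyLaw (ν : Measure ℝ) (δ m p : ℝ) : Prop where
  integrable_moment : Integrable (fun u => |u| ^ (4 + δ)) ν
  moment_le : ∫ u, |u| ^ (4 + δ) ∂ν ≤ p * m
  mean_eq : ∫ u, u ∂ν = 0
  second_moment_eq : ∫ u, u ^ 2 ∂ν = p
  measure_ne_zero : ν.real {u | u ≠ 0} ≤ p

theorem abs_pow_le_one_add_rpow {r : ℝ} {k : ℕ} (hk : (k : ℝ) ≤ r) (u : ℝ) :
    |u| ^ k ≤ 1 + |u| ^ r := by
  have h0 : 0 ≤ |u| ^ r := Real.rpow_nonneg (abs_nonneg u) r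
  rcases le_or_gt |u| 1 with h | h
  · linarith [pow_le_one₀ (n := k) (abs_nonneg u) h]
  · have := Real.rpow_le_rpow_of_exponent_le h.le hk
    rw [Real.rpow_natCast] at this
    linarith

variable {ν : Measure ℝ} [IsProbabilityMeasure ν] {δ m p : ℝ}

theorem HeavyLaw.integrable_pow (h : HeavyLaw ν δ m p) {k : ℕ} (hk : (k : ℝ) ≤ 4 + δ) :
    Integrable (fun u => u ^ k) ν := by
  refine ((integrable_const 1).add h.integrable_moment).mono' (by fun_prop)
    (ae_of_all _ fun u => ?_)
  rw [Real.norm_eq_abs, abs_pow]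
  exact abs_pow_le_one_add_rpow hk u

theorem HeavyLaw.setIntegral_abs_pow_le (h : HeavyLaw ν δ m p) {k : ℕ} (hk : (k : ℝ) ≤ 4 + δ)
    {b D : ℝ} (hb : 0 < b) (hbD : b ^ (4 + δ) = D ^ 2) :
    ∫ u in (Set.Icc (-b) b)ᶜ, |u| ^ k ∂ν ≤ b ^ k * (p * m / D ^ 2) := by
  have hD : 0 < D ^ 2 := hbD ▸ Real.rpow_pos_of_pos hb _
  have hpt : ∀ u ∈ (Set.Icc (-b) b)ᶜ, |u| ^ k ≤ b ^ k / D ^ 2 * |u| ^ (4 + δ) := by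
    intro u hu
    have hu' : b < |u| := by
      by_contra hc
      exact hu (abs_le.1 (not_lt.1 hc))
    have h1 : 1 ≤ |u| / b := by rw [le_div_iff₀ hb]; linarith
    have h2 := Real.rpow_le_rpow_of_exponent_le h1 hk
    rw [Real.rpow_natCast, div_pow, Real.div_rpow (abs_nonneg u) hb.le, hbD,
      div_le_iff₀ (by positivity)] at h2
    calc _ ≤ _ := h2
      _ = _ := by ring
  have hint : IntegrableOn (fun u => |u| ^ k) (Set.Icc (-b) b)ᶜ ν := by
    have := (h.integrable_pow hk).abs.integrableOn (s := (Set.Icc (-b) b)ᶜ)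
    simpa only [abs_pow] using this
  calc _ ≤ ∫ u in (Set.Icc (-b) b)ᶜ, b ^ k / D ^ 2 * |u| ^ (4 + δ) ∂ν :=
        setIntegral_mono_on hint (h.integrable_moment.const_mul _).integrableOn
          measurableSet_Icc.compl hpt
    _ ≤ ∫ u, b ^ k / D ^ 2 * |u| ^ (4 + δ) ∂ν :=
        setIntegral_le_integral (h.integrable_moment.const_mul _)
          (ae_of_all _ fun u => mul_nonneg (by positivity) (Real.rpow_nonneg (abs_nonneg u) _))
    _ ≤ b ^ k / D ^ 2 * (p * m) := by
        rw [integral_const_mul]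
        exact mul_le_mul_of_nonneg_left h.moment_le (by positivity)
    _ = _ := by ring

theorem HeavyLaw.measure_compl_le (h : HeavyLaw ν δ m p) (hδ : 0 < δ) {b D : ℝ} (hb : 0 < b)
    (hbD : b ^ (4 + δ) = D ^ 2) : ν.real (Set.Icc (-b) b)ᶜ ≤ p * m / D ^ 2 := by
  have := h.setIntegral_abs_pow_le (k := 0) (by push_cast; linarith) hb hbD
  simpa using this

omit [IsProbabilityMeasure ν] in
theorem setIntegral_cond (G : Set ℝ) (f : ℝ → ℝ) :
    ∫ u, f u ∂(ProbabilityTheory.cond ν G) = (ν.real G)⁻¹ * ∫ u in G, f u ∂ν := by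
  rw [ProbabilityTheory.cond, integral_smul_measure, ENNReal.toReal_inv, smul_eq_mul]
  rfl

/-- Conditioning on a moderate range turns a heavy law into a bounded one. -/
theorem HeavyLaw.sparseLaw_cond (h : HeavyLaw ν δ m p) (hδ : 0 < δ) {N b : ℝ} (hm : 1 ≤ m)
    (hp : 0 < p) (hp1 : p ≤ 1) (hb : 1 ≤ b) (hN : 1 ≤ N) (hbD : b ^ (4 + δ) = (N * p) ^ 2)
    (hb2 : b ^ 2 ≤ N * p) (hmD : 4 * m ≤ N * p) :
    SparseLaw (ProbabilityTheory.cond ν (Set.Icc (-b) b)) N p b (2 * (1 + m)) := by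
  have hb0 : 0 < b := by linarith
  set D := N * p with hD
  set G := Set.Icc (-b) b with hG
  have hGm : MeasurableSet G := measurableSet_Icc
  have hD0 : 0 < D := by positivity
  have hmD2 : p * m / D ^ 2 ≤ 1 / 4 := by
    rw [div_le_iff₀ (by positivity)]
    nlinarith
  have hg1 : ν.real Gᶜ = 1 - ν.real G := probReal_compl_eq_one_sub hGm
  have hg : 3 / 4 ≤ ν.real G := by
    have := h.measure_compl_le hδ hb0 hbD
    rw [hg1] at this
    linarith
  have hgle : ν.real G ≤ 1 := measureReal_le_one
  have hg0 : 0 < ν.real G := by linarith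
  have hgi : (ν.real G)⁻¹ ≤ 4 / 3 := by
    rw [inv_le_comm₀ hg0 (by norm_num)]; linarith
  have hgi1 : 1 ≤ (ν.real G)⁻¹ := (one_le_inv₀ hg0).2 hgle
  have i1 : Integrable (fun u : ℝ => u) ν := by
    simpa using h.integrable_pow (k := 1) (by push_cast; linarith)
  have i2 := h.integrable_pow (k := 2) (by push_cast; linarith)
  have i4 := h.integrable_pow (k := 4) (by push_cast; linarith)
  have s1 : |∫ u in G, u ∂ν| ≤ b * (p * m / D ^ 2) := by
    have e := integral_add_compl hGm i1
    rw [h.mean_eq] at e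
    have e2 : ∫ u in G, u ∂ν = -∫ u in Gᶜ, u ∂ν := by linarith
    rw [e2, abs_neg]
    have := h.setIntegral_abs_pow_le (k := 1) (by push_cast; linarith) hb0 hbD
    simp only [pow_one] at this
    exact abs_integral_le_integral_abs.trans this
  have s2 : 3 / 4 * p ≤ ∫ u in G, u ^ 2 ∂ν := by
    have e := integral_add_compl hGm i2
    rw [h.second_moment_eq] at e
    have := h.setIntegral_abs_pow_le (k := 2) (by push_cast; linarith) hb0 hbD
    simp only [sq_abs] at this
    have h3 : b ^ 2 * (p * m / D ^ 2) ≤ p / 4 := by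
      calc _ ≤ D * (p * m / D ^ 2) := by gcongr
        _ = p * m / D := by field_simp
        _ ≤ p / 4 := by
          rw [div_le_div_iff₀ hD0 (by norm_num)]
          nlinarith
    linarith
  have s4 : ∫ u in G, u ^ 4 ∂ν ≤ p * (1 + m) := by
    calc ∫ u in G, u ^ 4 ∂ν ≤ ∫ u, u ^ 4 ∂ν :=
          setIntegral_le_integral i4 (ae_of_all _ fun u => by positivity)
      _ ≤ ∫ u, (u ^ 2 + |u| ^ (4 + δ)) ∂ν := by
          refine integral_mono i4 (i2.add h.integrable_moment) fun u => ?_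
          have h0 : 0 ≤ |u| ^ (4 + δ) := Real.rpow_nonneg (abs_nonneg u) _
          rcases le_or_gt |u| 1 with hu | hu
          · have : u ^ 2 ≤ 1 := by rw [← sq_abs]; exact pow_le_one₀ (abs_nonneg u) hu
            simp only
            nlinarith [sq_nonneg u]
          · have := Real.rpow_le_rpow_of_exponent_le hu.le
              (show ((4 : ℕ) : ℝ) ≤ 4 + δ by push_cast; linarith)
            rw [Real.rpow_natCast] at this
            have e : u ^ 4 = |u| ^ 4 := by rw [← abs_pow, abs_of_nonneg (by positivity)]
            simp only [e]
            nlinarith [sq_nonneg u]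
      _ = ∫ u, u ^ 2 ∂ν + ∫ u, |u| ^ (4 + δ) ∂ν := integral_add i2 h.integrable_moment
      _ ≤ p + p * m := by
          rw [h.second_moment_eq]
          exact add_le_add le_rfl h.moment_le
      _ = _ := by ring
  -- The truncated mean is at most (4/3)b·pm/D²; the bound p/9 then uses b² ≤ D and 16m² ≤ D².
  have hmean : (∫ u, u ∂(ProbabilityTheory.cond ν G)) ^ 2 * N ≤ p / 9 := by
    rw [setIntegral_cond, ← sq_abs, abs_mul, abs_of_pos (by positivity : 0 < (ν.real G)⁻¹)]
    calc _ ≤ (4 / 3 * (b * (p * m / D ^ 2))) ^ 2 * N := by gcongr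
      _ = 16 / 9 * b ^ 2 * (p * m ^ 2 * D / D ^ 4) := by
          rw [hD]
          field_simp
          norm_num
      _ ≤ 16 / 9 * D * (p * m ^ 2 * D / D ^ 4) := by gcongr
      _ = p * (16 / 9 * m ^ 2 / D ^ 2) := by field_simp
      _ ≤ p * (1 / 9) := by
          refine mul_le_mul_of_nonneg_left ?_ hp.le
          rw [div_le_div_iff₀ (by positivity) (by norm_num)]
          nlinarith
      _ = _ := by ring
  have hac : ∀ᵐ u ∂(ProbabilityTheory.cond ν G), u ∈ G := ae_cond_mem hGm
  refine ⟨?_, ?_, hmean.trans (by linarith), ?_, ?_, ?_⟩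
  · filter_upwards [hac] with u hu
    exact abs_le.2 hu
  · have e : (ProbabilityTheory.cond ν G).real {u | u ≠ 0} =
        (ν.real G)⁻¹ * ν.real (G ∩ {u | u ≠ 0}) := by
      rw [measureReal_def, cond_apply hGm, ENNReal.toReal_mul, ENNReal.toReal_inv]
      rfl
    rw [e]
    calc _ ≤ 4 / 3 * ν.real {u | u ≠ 0} :=
          mul_le_mul hgi (measureReal_mono Set.inter_subset_right) measureReal_nonneg (by norm_num)
      _ ≤ 4 / 3 * p := mul_le_mul_of_nonneg_left h.measure_ne_zero (by norm_num)
      _ ≤ 2 * p := by linarith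
  · rw [setIntegral_cond G fun u => u ^ 2]
    have h1 : (∫ u, u ∂(ProbabilityTheory.cond ν G)) ^ 2 ≤ p / 9 :=
      (le_mul_of_one_le_right (sq_nonneg _) hN).trans hmean
    have h2 : 3 / 4 * p ≤ (ν.real G)⁻¹ * ∫ u in G, u ^ 2 ∂ν :=
      s2.trans (le_mul_of_one_le_left (by linarith [s2]) hgi1)
    linarith
  · rw [setIntegral_cond G fun u => u ^ 2]
    have h1 : ∫ u in G, u ^ 2 ∂ν ≤ p :=
      h.second_moment_eq ▸ setIntegral_le_integral i2 (ae_of_all _ fun u => sq_nonneg u)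
    calc _ ≤ 4 / 3 * p := mul_le_mul hgi h1 (by linarith [s2]) (by norm_num)
      _ ≤ 2 * p := by linarith
  · rw [setIntegral_cond G fun u => u ^ 4]
    have h0 : 0 ≤ ∫ u in G, u ^ 4 ∂ν := integral_nonneg fun u => by positivity
    calc _ ≤ 4 / 3 * (p * (1 + m)) := mul_le_mul hgi s4 h0 (by norm_num)
      _ ≤ 2 * (p * (1 + m)) := by
          have : 0 < p * (1 + m) := by positivity
          linarith
      _ = _ := by ring

end Truncation

/-! ### Conditioning on the set of exceptional coordinates -/

section ConditioningOnProducts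

theorem cond_pi {ι : Type*} [Fintype ι] {α : ι → Type*} [∀ i, MeasurableSpace (α i)]
    (ρ : ∀ i, Measure (α i)) [∀ i, IsProbabilityMeasure (ρ i)] {G : ∀ i, Set (α i)}
    (hG : ∀ i, MeasurableSet (G i)) (h0 : ∀ i, ρ i (G i) ≠ 0) :
    ProbabilityTheory.cond (Measure.pi ρ) (Set.univ.pi G) =
      Measure.pi fun i => ProbabilityTheory.cond (ρ i) (G i) := by
  have : ∀ i, IsProbabilityMeasure (ProbabilityTheory.cond (ρ i) (G i)) := fun i =>
    cond_isProbabilityMeasure (h0 i)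
  refine (Measure.pi_eq fun s _ => ?_).symm
  rw [cond_apply (MeasurableSet.univ_pi hG), ← Set.pi_inter_distrib, Measure.pi_pi,
    Measure.pi_pi, ENNReal.prod_inv_distrib, ← Finset.prod_mul_distrib]
  · exact Finset.prod_congr rfl fun i _ => (cond_apply (hG i) _ _).symm
  · exact fun i _ j _ _ => Or.inl (h0 i)

variable {ι R : Type*} [Fintype ι] [DecidableEq ι] [MeasurableSpace R]

/-- Given that S is exactly the set of coordinates outside G, the remaining coordinates are still
independent, each with its law conditioned on G. -/
theorem pi_inter_exceptional_le (ρ : ι → Measure R) [∀ i, IsProbabilityMeasure (ρ i)] {G : Set R}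
    (hG : MeasurableSet G) (h0 : ∀ i, ρ i G ≠ 0) (S : Finset ι) {E : Set (ι → R)}
    {E' : Set ({j // j ∉ S} → R)} (hE : ∀ A ∈ E, (fun j : {j // j ∉ S} => A j) ∈ E') :
    Measure.pi ρ (E ∩ {A | ∀ j, A j ∉ G ↔ j ∈ S}) ≤
      Measure.pi ρ {A | ∀ j, A j ∉ G ↔ j ∈ S} *
        Measure.pi (fun j : {j // j ∉ S} => ProbabilityTheory.cond (ρ j) G) E' := by
  have he := measurePreserving_piEquivPiSubtypeProd ρ (fun j => j ∈ S)
  set e := MeasurableEquiv.piEquivPiSubtypeProd (fun _ : ι => R) (fun j => j ∈ S) with hedef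
  have hbad : {A : ι → R | ∀ j, A j ∉ G ↔ j ∈ S} =
      e ⁻¹' ((Set.univ.pi fun _ => Gᶜ) ×ˢ (Set.univ.pi fun _ => G)) := by
    ext A
    simp only [Set.mem_ofPred_eq, Set.mem_preimage, Set.mem_prod, Set.mem_univ_pi]
    constructor
    · intro h
      exact ⟨fun j => (h j).2 j.2, fun j => not_not.1 fun hc => j.2 ((h j).1 hc)⟩
    · rintro ⟨h1, h2⟩ j
      refine ⟨fun hj => by_contra fun hc => hj (h2 ⟨j, hc⟩), fun hj => h1 ⟨j, hj⟩⟩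
  have hsub : E ∩ {A : ι → R | ∀ j, A j ∉ G ↔ j ∈ S} ⊆
      e ⁻¹' ((Set.univ.pi fun _ => Gᶜ) ×ˢ ((Set.univ.pi fun _ => G) ∩ E')) := by
    rw [hbad]
    rintro A ⟨hA, h1, h2⟩
    exact ⟨h1, h2, hE A hA⟩
  refine (measure_mono hsub).trans ?_
  rw [hbad, he.measure_preimage_equiv, he.measure_preimage_equiv, Measure.prod_prod,
    Measure.prod_prod, mul_assoc,
    ← cond_pi (fun j : {j // j ∉ S} => ρ j) (fun _ => hG) (fun j => h0 j),
    mul_comm (Measure.pi _ (Set.univ.pi fun _ => G)),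
    cond_mul_eq_inter (MeasurableSet.univ_pi fun _ => hG)]

theorem pi_exceptional_le (ρ : ι → Measure R) [∀ i, IsProbabilityMeasure (ρ i)] {G : Set R}
    {β : ENNReal} (hβ : ∀ i, ρ i Gᶜ ≤ β) (S : Finset ι) :
    Measure.pi ρ {A | ∀ j, A j ∉ G ↔ j ∈ S} ≤ β ^ S.card := by
  have hsub : {A : ι → R | ∀ j, A j ∉ G ↔ j ∈ S} ⊆
      Set.univ.pi fun j => if j ∈ S then Gᶜ else Set.univ := by
    intro A hA j _
    by_cases hj : j ∈ S
    · simpa [hj] using (hA j).2 hj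
    · simp [hj]
  refine (measure_mono hsub).trans ?_
  rw [Measure.pi_pi]
  calc _ ≤ ∏ j, (if j ∈ S then β else 1) := by
        refine Finset.prod_le_prod' fun j _ => ?_
        split_ifs
        · exact hβ j
        · exact prob_le_one
    _ = _ := by
        rw [Finset.prod_ite_mem, Finset.univ_inter, Finset.prod_const]

/-- A bound for a product measure, by conditioning on the set of coordinates outside `G`. -/
theorem pi_le_of_cond_le (ρ : ι → Measure R) [∀ i, IsProbabilityMeasure (ρ i)] {G : Set R}
    (hG : MeasurableSet G) (h0 : ∀ i, ρ i G ≠ 0) {E : Set (ι → R)}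
    {E' : ∀ S : Finset ι, Set ({j // j ∉ S} → R)}
    (hE : ∀ S, ∀ A ∈ E, (fun j : {j // j ∉ S} => A j) ∈ E' S) {K : ℝ} {ε ε' : ENNReal}
    (h1 : ∀ S : Finset ι, (S.card : ℝ) ≤ K →
      Measure.pi (fun j : {j // j ∉ S} => ProbabilityTheory.cond (ρ j) G) (E' S) ≤ ε)
    (h2 : ∀ S : Finset ι, K < (S.card : ℝ) →
      Measure.pi ρ {A | ∀ j, A j ∉ G ↔ j ∈ S} ≤ ε') :
    Measure.pi ρ E ≤ ε + 2 ^ Fintype.card ι * ε' := by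
  classical
  set bad : Finset ι → Set (ι → R) := fun S => {A | ∀ j, A j ∉ G ↔ j ∈ S} with hbad
  have hbm : ∀ S, MeasurableSet (bad S) := fun S => by
    have : bad S = Set.univ.pi fun j => if j ∈ S then Gᶜ else G := by
      ext A
      simp only [hbad, Set.mem_ofPred_eq, Set.mem_univ_pi]
      refine forall_congr' fun j => ?_
      by_cases hj : j ∈ S <;> simp [hj]
    rw [this]
    refine MeasurableSet.univ_pi fun j => ?_
    split_ifs
    exacts [hG.compl, hG]
  have hdisj : Pairwise (Function.onFun Disjoint bad) := by
    intro S T hST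
    refine Set.disjoint_left.2 fun A hA hA' => hST ?_
    ext j
    exact (hA j).symm.trans (hA' j)
  -- The events `bad S` are disjoint, so ε enters as an average with total weight at most one; only
  -- ε' has to be multiplied by the number of sets.
  have hsum : ∑ S, Measure.pi ρ (bad S) ≤ 1 := by
    rw [← tsum_fintype (L := .unconditional _), ← measure_iUnion hdisj hbm]
    exact prob_le_one
  have hcov : E ⊆ ⋃ S, E ∩ bad S := fun A hA =>
    Set.mem_iUnion.2 ⟨Finset.univ.filter fun j => A j ∉ G, hA, fun j => by simp⟩
  calc Measure.pi ρ E ≤ ∑ S, Measure.pi ρ (E ∩ bad S) :=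
        (measure_mono hcov).trans (measure_iUnion_fintype_le _ _)
    _ ≤ ∑ S, (Measure.pi ρ (bad S) * ε + ε') := by
        refine Finset.sum_le_sum fun S _ => ?_
        rcases le_or_gt (S.card : ℝ) K with h | h
        · refine (pi_inter_exceptional_le ρ hG h0 S (hE S)).trans ?_
          exact (mul_le_mul_right (h1 S h) _).trans le_self_add
        · exact ((measure_mono Set.inter_subset_right).trans (h2 S h)).trans le_add_self
    _ = (∑ S, Measure.pi ρ (bad S)) * ε + 2 ^ Fintype.card ι * ε' := by
        rw [Finset.sum_add_distrib, Finset.sum_mul, Finset.sum_const, Finset.card_univ,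
          Fintype.card_finset, nsmul_eq_mul]
        push_cast
        rfl
    _ ≤ 1 * ε + 2 ^ Fintype.card ι * ε' := by gcongr
    _ = _ := by rw [one_mul]

end ConditioningOnProducts

/-! ### The smallest singular value for heavy-tailed entries -/

section HeavyTails

theorem pi_compl_univ_pi_le {κ : Type*} [Fintype κ] {α : κ → Type*} [∀ k, MeasurableSpace (α k)]
    (ν : ∀ k, Measure (α k)) [∀ k, IsProbabilityMeasure (ν k)] {G : ∀ k, Set (α k)}
    (hG : ∀ k, MeasurableSet (G k)) :
    Measure.pi ν (Set.univ.pi G)ᶜ ≤ ∑ k, ν k (G k)ᶜ := by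
  have hsub : (Set.univ.pi G)ᶜ ⊆ ⋃ k, Function.eval k ⁻¹' (G k)ᶜ := by
    intro x hx
    simp only [Set.mem_compl_iff, Set.mem_univ_pi, not_forall] at hx
    simpa using hx
  refine (measure_mono hsub).trans ((measure_iUnion_fintype_le _ _).trans ?_)
  refine Finset.sum_le_sum fun k _ => ?_
  rw [(measurePreserving_eval ν k).measure_preimage (hG k).compl.nullMeasurableSet]

/-- The smallest singular value of a sparse random matrix whose entries have slightly more than
four moments. -/
theorem exists_matMeasure_heavy_small_image_le {η δ : ℝ} (hη : 0 < η) (hδ : 0 < δ) :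
    ∃ τ : ℝ, 0 < τ ∧ ∀ m : ℝ, 1 ≤ m → ∀ Q : ℝ, 0 < Q → ∃ lam₀ : ℝ,
      ∀ {ι κ : Type} [Fintype ι] [Fintype κ] [DecidableEq ι] [DecidableEq κ]
        {ν : ι → κ → Measure ℝ} [∀ j k, IsProbabilityMeasure (ν j k)] {N p b lam : ℝ},
        (∀ j k, HeavyLaw (ν j k) δ m p) → 0 < p → p ≤ 1 → 1 ≤ b → 1 ≤ N →
        b ^ (4 + δ) = (N * p) ^ 2 → lam₀ ≤ lam → N * p = lam ^ 16 → Real.log N ≤ lam ^ 6 →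
        b ^ 2 ≤ lam ^ 16 → 2 * ((Q + 3) * Real.log N) * b ^ 2 ≤ lam ^ 16 →
        Q * Real.log N ≤ N → (Fintype.card ι : ℝ) ≤ N →
        Fintype.card κ + 2 * η * N ≤ (Fintype.card ι : ℝ) →
        matMeasure ν {A | ∃ x : κ → ℝ, ∑ k, x k ^ 2 = 1 ∧
          ∑ j, (∑ k, A j k * x k) ^ 2 ≤ τ * (N * p)} ≤
        ENNReal.ofReal (8 * Real.exp (-(Q * Real.log N))) := by
  obtain ⟨τ, hτ, hcore⟩ := exists_matMeasure_small_image_le hη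
  refine ⟨τ, hτ, fun m hm Q hQ => ?_⟩
  obtain ⟨lam₁, hcore⟩ := hcore (2 * (1 + m)) (by positivity) Q hQ
  refine ⟨max (max lam₁ 1) (max (4 * m) (m * Real.exp (2 / η))), ?_⟩
  intro ι κ _ _ _ _ ν _ N p b lam hν hp hp1 hb hN hbD hlam hD hlog hb2 hb3 hQN hι hκ
  have l1 : lam₁ ≤ lam := (le_max_left _ _).trans ((le_max_left _ _).trans hlam)
  have l2 : 1 ≤ lam := (le_max_right _ _).trans ((le_max_left _ _).trans hlam)
  have l3 : 4 * m ≤ lam := (le_max_left _ _).trans ((le_max_right _ _).trans hlam)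
  have l4 : m * Real.exp (2 / η) ≤ lam := (le_max_right _ _).trans ((le_max_right _ _).trans hlam)
  have l5 : lam ≤ N * p := hD ▸ le_self_pow₀ l2 (by norm_num)
  have hb0 : 0 < b := by linarith
  have hN0 : 0 < N := by linarith
  have hNp : 0 < N * p := by positivity
  set G := Set.Icc (-b) b with hG
  have hGm : MeasurableSet G := measurableSet_Icc
  have hGc : ∀ j k, (ν j k).real Gᶜ ≤ p * m / (N * p) ^ 2 := fun j k =>
    (hν j k).measure_compl_le hδ hb0 hbD
  have hG0 : ∀ j k, ν j k G ≠ 0 := by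
    intro j k h0
    have h1 : (ν j k).real Gᶜ = 1 := by
      rw [probReal_compl_eq_one_sub hGm, measureReal_def, h0]; simp
    have h2 := hGc j k
    rw [h1, le_div_iff₀ (by positivity)] at h2
    nlinarith
  have hprob : ∀ j k, IsProbabilityMeasure (ProbabilityTheory.cond (ν j k) G) := fun j k =>
    cond_isProbabilityMeasure (hG0 j k)
  have hlaw : ∀ j k, SparseLaw (ProbabilityTheory.cond (ν j k) G) N p b (2 * (1 + m)) := fun j k =>
    (hν j k).sparseLaw_cond hδ hm hp hp1 hb hN hbD (hD ▸ hb2) (l3.trans l5)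
  -- A row contains a large entry with probability at most N · pm/D² = m/D, which is at most
  -- e^{-2/η} by the choice of the threshold for lam.
  have hrow : ∀ j, Measure.pi (ν j) (Set.univ.pi fun _ => G)ᶜ ≤
      ENNReal.ofReal (Real.exp (-(2 / η))) := by
    intro j
    refine (pi_compl_univ_pi_le (ν j) fun _ => hGm).trans ?_
    calc ∑ k, ν j k Gᶜ ≤ ∑ _k : κ, ENNReal.ofReal (p * m / (N * p) ^ 2) := by
          refine Finset.sum_le_sum fun k _ => ?_
          rw [← ofReal_measureReal]
          exact ENNReal.ofReal_le_ofReal (hGc j k)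
      _ = ENNReal.ofReal (Fintype.card κ * (p * m / (N * p) ^ 2)) := by
          rw [Finset.sum_const, Finset.card_univ, nsmul_eq_mul,
            ENNReal.ofReal_mul (by positivity), ENNReal.ofReal_natCast]
      _ ≤ _ := by
          refine ENNReal.ofReal_le_ofReal ?_
          have hκN : (Fintype.card κ : ℝ) ≤ N := by
            have : 0 < 2 * η * N := by positivity
            linarith
          calc _ ≤ N * (p * m / (N * p) ^ 2) := by gcongr
            _ = m / (N * p) := by field_simp
            _ ≤ m / (m * Real.exp (2 / η))  :=
              div_le_div_of_nonneg_left (by linarith) (by positivity) (l4.trans l5)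
            _ = _ := by
              rw [Real.exp_neg]
              have : m ≠ 0 := by positivity
              field_simp
  have hR0 : ∀ j, Measure.pi (ν j) (Set.univ.pi fun _ => G) ≠ 0 := by
    intro j
    rw [Measure.pi_pi]
    exact Finset.prod_ne_zero_iff.2 fun k _ => hG0 j k
  have hRm : MeasurableSet (Set.univ.pi fun _ : κ => G) := MeasurableSet.univ_pi fun _ => hGm
  -- Conditioning is by whole rows. Deleting at most ηN of them uses up half of the surplus 2ηN, and
  -- the sum over the remaining rows is no larger. More than ηN exceptional rows have probability at
  -- most e^{-2N} for each set, which outweighs the at most e^N sets.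
  have key := pi_le_of_cond_le (fun j => Measure.pi (ν j)) hRm hR0 (K := η * N)
    (E := {A | ∃ x : κ → ℝ, ∑ k, x k ^ 2 = 1 ∧ ∑ j, (∑ k, A j k * x k) ^ 2 ≤ τ * (N * p)})
    (E' := fun S => {A | ∃ x : κ → ℝ, ∑ k, x k ^ 2 = 1 ∧
      ∑ j, (∑ k, A j k * x k) ^ 2 ≤ τ * (N * p)})
    (ε := ENNReal.ofReal (7 * Real.exp (-(Q * Real.log N))))
    (ε' := ENNReal.ofReal (Real.exp (-(2 * N)))) ?_ ?_ ?_
  · refine key.trans ?_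
    have h2 : (2 : ENNReal) ^ Fintype.card ι ≤ ENNReal.ofReal (Real.exp N) := by
      have : (2 : ENNReal) = ENNReal.ofReal 2 := by simp
      rw [this, ← ENNReal.ofReal_pow (by norm_num)]
      refine ENNReal.ofReal_le_ofReal ?_
      calc (2 : ℝ) ^ Fintype.card ι ≤ Real.exp 1 ^ Fintype.card ι := by
            gcongr
            have := Real.add_one_le_exp (1 : ℝ)
            linarith
        _ = Real.exp (Fintype.card ι) := by rw [← Real.exp_nat_mul, mul_one]
        _ ≤ _ := Real.exp_le_exp.2 hι
    calc _ ≤ ENNReal.ofReal (7 * Real.exp (-(Q * Real.log N))) +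
          ENNReal.ofReal (Real.exp N) * ENNReal.ofReal (Real.exp (-(2 * N))) := by gcongr
      _ = ENNReal.ofReal (7 * Real.exp (-(Q * Real.log N)) + Real.exp (-N)) := by
          rw [← ENNReal.ofReal_mul (by positivity), ← Real.exp_add,
            ← ENNReal.ofReal_add (by positivity) (by positivity)]
          congr 3
          ring
      _ ≤ _ := by
          refine ENNReal.ofReal_le_ofReal ?_
          have : Real.exp (-N) ≤ Real.exp (-(Q * Real.log N)) :=
            Real.exp_le_exp.2 (by linarith)
          linarith
  · rintro S A ⟨x, hx, hAx⟩
    refine ⟨x, hx, le_trans ?_ hAx⟩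
    have h1 := Fintype.sum_subtype_add_sum_subtype (fun j => j ∈ S)
      (fun j => (∑ k, A j k * x k) ^ 2)
    rw [← h1]
    exact le_add_of_nonneg_left (Finset.sum_nonneg fun j _ => sq_nonneg _)
  · intro S hS
    simp only [cond_pi (ν _) (fun _ => hGm) (hG0 _)]
    have hc : (Fintype.card {j // j ∉ S} : ℝ) = Fintype.card ι - S.card := by
      rw [Fintype.card_subtype_compl, Fintype.card_coe, Nat.cast_sub (Finset.card_le_univ S)]
    exact hcore (fun (j : {j // j ∉ S}) k => hlaw j k) hp hp1 hb hN0 l1 hD hlog hb2 hb3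
      (by rw [hc]; have : (0 : ℝ) ≤ S.card := by positivity
          linarith) (by rw [hc]; linarith)
  · intro S hS
    refine (pi_exceptional_le _ hrow S).trans ?_
    rw [← ENNReal.ofReal_pow (Real.exp_pos _).le, ← Real.exp_nat_mul]
    refine ENNReal.ofReal_le_ofReal (Real.exp_le_exp.2 ?_)
    have : η * N * (2 / η) ≤ S.card * (2 / η) := by gcongr
    have e : η * N * (2 / η) = 2 * N := by field_simp
    linarith

end HeavyTails

/-! ### From the random matrix model to product measures -/

section SparseModel

/-- The witness is a normalized eigenvector of MᵀM for its smallest eigenvalue, the square of `sLast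
M`. -/
theorem exists_unit_of_sLast_le {N n : ℕ} (hn : 0 < n) {M : Matrix (Fin N) (Fin n) ℝ} {t : ℝ}
    (h : sLast M ≤ t) :
    ∃ x : Fin n → ℝ, ∑ k, x k ^ 2 = 1 ∧ ∑ j, (∑ k, M j k * x k) ^ 2 ≤ t ^ 2 := by
  set T := Matrix.toEuclideanLin M with hT
  have hfin : n - 1 < Module.finrank ℝ (EuclideanSpace ℝ (Fin n)) := by
    rw [finrank_euclideanSpace_fin]; omega
  obtain ⟨v, hv⟩ := (T.hasEigenvalue_adjoint_comp_self_sq_singularValues hfin).exists_hasEigenvector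
  have hs0 : 0 ≤ sLast M := T.singularValues_nonneg _
  have hv1 := hv.apply_eq_smul
  have hv0 : 0 < ‖v‖ := norm_pos_iff.2 hv.2
  have hnorm : ‖T v‖ ^ 2 = sLast M ^ 2 * ‖v‖ ^ 2 := by
    have h1 : inner ℝ ((LinearMap.adjoint T ∘ₗ T) v) v = ‖T v‖ ^ 2 := by
      rw [LinearMap.comp_apply, LinearMap.adjoint_inner_left, real_inner_self_eq_norm_sq]
    rw [← h1, hv1, real_inner_smul_left, real_inner_self_eq_norm_sq]
    rfl
  have hTv : ∀ j, T v j = ∑ k, M j k * v k := fun j => rfl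
  rw [EuclideanSpace.norm_sq_eq, EuclideanSpace.norm_sq_eq] at hnorm
  simp only [Real.norm_eq_abs, sq_abs, hTv] at hnorm
  have hvs : ‖v‖ ^ 2 = ∑ k, v k ^ 2 := by
    rw [EuclideanSpace.norm_sq_eq]; simp
  refine ⟨fun k => v k / ‖v‖, ?_, ?_⟩
  · simp only [div_pow]
    rw [← Finset.sum_div, ← hvs, div_self (by positivity)]
  · have e : ∀ j, (∑ k, M j k * (v k / ‖v‖)) ^ 2 = (∑ k, M j k * v k) ^ 2 / ‖v‖ ^ 2 := by
      intro j
      rw [← div_pow, Finset.sum_div]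
      simp only [mul_div_assoc]
    simp only [e]
    rw [← Finset.sum_div, hnorm, ← hvs, mul_div_assoc, div_self (by positivity), mul_one]
    gcongr

variable {Ω : Type*} [MeasurableSpace Ω] {P : Measure Ω} [IsProbabilityMeasure P]

omit [IsProbabilityMeasure P] in
-- As ξ is 0 or 1 and f(0) = 0, one has f(ξX) = ξ f(X) almost surely.
theorem integral_map_mul_bernoulli {X ξ : Ω → ℝ} (hX : Measurable X) (hξ : Measurable ξ)
    (hind : IndepFun X ξ P) (hb : ∀ᵐ ω ∂P, ξ ω = 0 ∨ ξ ω = 1) {f : ℝ → ℝ} (hf : Measurable f)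
    (hf0 : f 0 = 0) :
    ∫ u, f u ∂(P.map fun ω => ξ ω * X ω) = (∫ ω, ξ ω ∂P) * ∫ ω, f (X ω) ∂P := by
  rw [integral_map (by fun_prop) hf.aestronglyMeasurable]
  have h1 : ∫ ω, f (ξ ω * X ω) ∂P = ∫ ω, ξ ω * f (X ω) ∂P := by
    refine integral_congr_ae ?_
    filter_upwards [hb] with ω hω
    rcases hω with h | h <;> simp [h, hf0]
  rw [h1]
  exact (hind.symm.comp measurable_id hf).integral_fun_mul_eq_mul_integral
    hξ.aestronglyMeasurable (hf.comp hX).aestronglyMeasurable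

theorem heavyLaw_map_mul_bernoulli {X ξ : Ω → ℝ} {δ m p : ℝ} (hX : Measurable X)
    (hξ : Measurable ξ) (hind : IndepFun X ξ P) (hb : ∀ᵐ ω ∂P, ξ ω = 0 ∨ ξ ω = 1)
    (hδ : 0 < δ) (hp : ∫ ω, ξ ω ∂P = p) (hp0 : 0 ≤ p) (hm : ∫ ω, X ω ∂P = 0)
    (hv : ∫ ω, X ω ^ 2 ∂P = 1) (hi : Integrable (fun ω => |X ω| ^ (4 + δ)) P)
    (hle : ∫ ω, |X ω| ^ (4 + δ) ∂P ≤ m) :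
    HeavyLaw (P.map fun ω => ξ ω * X ω) δ m p := by
  have hmeas : Measurable fun u : ℝ => |u| ^ (4 + δ) := by fun_prop
  have hz : |(0 : ℝ)| ^ (4 + δ) = 0 := by rw [abs_zero, Real.zero_rpow (by linarith)]
  refine ⟨?_, ?_, ?_, ?_, ?_⟩
  · rw [integrable_map_measure hmeas.aestronglyMeasurable (by fun_prop)]
    refine hi.mono' (hmeas.comp (hξ.mul hX)).aestronglyMeasurable ?_
    filter_upwards [hb] with ω hω
    have h0 : 0 ≤ |X ω| ^ (4 + δ) := Real.rpow_nonneg (abs_nonneg _) _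
    rcases hω with h | h
    · simpa [h, hz, Real.zero_rpow (show 4 + δ ≠ 0 by linarith)] using h0
    · simp [h, abs_of_nonneg h0]
  · rw [integral_map_mul_bernoulli hX hξ hind hb hmeas hz, hp]
    exact mul_le_mul_of_nonneg_left hle hp0
  · rw [integral_map_mul_bernoulli (f := fun u => u) hX hξ hind hb measurable_id rfl, hm, mul_zero]
  · rw [integral_map_mul_bernoulli (f := fun u => u ^ 2) hX hξ hind hb (by fun_prop) (by simp), hp,
      hv, mul_one]
  · have hs : MeasurableSet {u : ℝ | u ≠ 0} := (measurableSet_singleton 0).compl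
    have := integral_map_mul_bernoulli (f := Set.indicator {u : ℝ | u ≠ 0} 1) hX hξ hind hb
      (measurable_one.indicator hs) (by simp)
    rw [integral_indicator_one hs, hp] at this
    rw [this]
    refine mul_le_of_le_one_right hp0 ?_
    refine (integral_mono_of_nonneg (g := fun _ => (1 : ℝ)) (ae_of_all _ fun ω => ?_)
      (integrable_const _) (ae_of_all _ fun ω => ?_)).trans (by simp)
    · exact Set.indicator_nonneg (fun _ _ => zero_le_one) _
    · exact Set.indicator_le_self' (fun _ _ => zero_le_one) _

/-- The joint law of the two families is a product of products; regrouping it by index shows that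
the pairs, and hence the products ξX, are mutually independent. -/
theorem iIndepFun_prodMk {ι α β : Type*} [Fintype ι] [MeasurableSpace α] [MeasurableSpace β]
    {X : ι → Ω → α} {Y : ι → Ω → β} (hX : ∀ i, Measurable (X i)) (hY : ∀ i, Measurable (Y i))
    (iX : iIndepFun X P) (iY : iIndepFun Y P)
    (h : IndepFun (fun ω i => X i ω) (fun ω i => Y i ω) P) :
    iIndepFun (fun i ω => (X i ω, Y i ω)) P := by
  have pX : ∀ i, IsProbabilityMeasure (P.map (X i)) := fun i =>
    Measure.isProbabilityMeasure_map (hX i).aemeasurable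
  have pY : ∀ i, IsProbabilityMeasure (P.map (Y i)) := fun i =>
    Measure.isProbabilityMeasure_map (hY i).aemeasurable
  rw [iIndepFun_iff_map_fun_eq_pi_map fun i => ((hX i).prodMk (hY i)).aemeasurable]
  have h1 : ∀ i, P.map (fun ω => (X i ω, Y i ω)) = (P.map (X i)).prod (P.map (Y i)) := fun i =>
    (indepFun_iff_map_prod_eq_prod_map_map (hX i).aemeasurable (hY i).aemeasurable).1
      (h.comp (measurable_pi_apply i) (measurable_pi_apply i))
  have h2 := (indepFun_iff_map_prod_eq_prod_map_map (by fun_prop) (by fun_prop)).1 h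
  rw [(iIndepFun_iff_map_fun_eq_pi_map fun i => (hX i).aemeasurable).1 iX,
    (iIndepFun_iff_map_fun_eq_pi_map fun i => (hY i).aemeasurable).1 iY] at h2
  simp only [h1]
  have h3 := (measurePreserving_arrowProdEquivProdArrow α β ι (fun i => P.map (X i))
    fun i => P.map (Y i)).symm.map_eq
  rw [← h3, ← h2, Measure.map_map (MeasurableEquiv.measurable _) (by fun_prop)]
  rfl

theorem map_sparseMatrix_eq {N n : ℕ} {X ξ : Fin N → Fin n → Ω → ℝ} {δ m p : ℝ}
    (h : IsSparseModel P δ m p X ξ) :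
    P.map (fun ω j k => ξ j k ω * X j k ω) =
      matMeasure fun j k => P.map fun ω => ξ j k ω * X j k ω := by
  have hmX := h.measurable_X
  have hmξ := h.measurable_ξ
  have hpr : ∀ j k, IsProbabilityMeasure (P.map fun ω => ξ j k ω * X j k ω) := fun j k =>
    Measure.isProbabilityMeasure_map (by fun_prop)
  have h1 := iIndepFun_prodMk (fun i : Fin N × Fin n => hmX i.1 i.2) (fun i => hmξ i.1 i.2)
    h.indep_X h.indep_ξ h.indep_X_ξ
  have h2 := h1.comp (fun _ z => z.2 * z.1) fun _ => by fun_prop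
  rw [iIndepFun_iff_map_fun_eq_pi_map (fun i => by
    exact ((hmξ i.1 i.2).mul (hmX i.1 i.2)).aemeasurable)] at h2
  have h3 := Measure.infinitePi_map_curry (fun j k => P.map fun ω => ξ j k ω * X j k ω)
  simp only [Measure.infinitePi_eq_pi] at h3
  unfold matMeasure
  rw [← h3]
  have h4 : P.map (fun ω (i : Fin N × Fin n) => ξ i.1 i.2 ω * X i.1 i.2 ω) =
      Measure.pi fun i : Fin N × Fin n => P.map fun ω => ξ i.1 i.2 ω * X i.1 i.2 ω := h2
  rw [← h4, Measure.map_map (MeasurableEquiv.measurable _) (by fun_prop)]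
  rfl

omit [IsProbabilityMeasure P] in
theorem IsSparseModel.nonneg {N n : ℕ} {X ξ : Fin N → Fin n → Ω → ℝ} {δ m p : ℝ}
    (h : IsSparseModel P δ m p X ξ) (j : Fin N) (k : Fin n) : 0 ≤ p := by
  rw [← h.mean_ξ j k]
  refine integral_nonneg_of_ae ?_
  filter_upwards [h.bernoulli_ξ j k] with ω hω
  rcases hω with h | h <;> simp [h]

theorem IsSparseModel.le_one {N n : ℕ} {X ξ : Fin N → Fin n → Ω → ℝ} {δ m p : ℝ}
    (h : IsSparseModel P δ m p X ξ) (j : Fin N) (k : Fin n) : p ≤ 1 := by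
  rw [← h.mean_ξ j k]
  have h0 : 0 ≤ᵐ[P] ξ j k := by
    filter_upwards [h.bernoulli_ξ j k] with ω hω
    rcases hω with h | h <;> simp [h]
  refine (integral_mono_of_nonneg (g := fun _ => (1 : ℝ)) h0 (integrable_const _) ?_).trans
    (by simp)
  filter_upwards [h.bernoulli_ξ j k] with ω hω
  rcases hω with h | h <;> simp [h]

theorem IsSparseModel.heavyLaw {N n : ℕ} {X ξ : Fin N → Fin n → Ω → ℝ} {δ m p : ℝ}
    (h : IsSparseModel P δ m p X ξ) (hδ : 0 < δ) (j : Fin N) (k : Fin n) :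
    HeavyLaw (P.map fun ω => ξ j k ω * X j k ω) δ m p :=
  heavyLaw_map_mul_bernoulli (h.measurable_X j k) (h.measurable_ξ j k)
    (h.indep_X_ξ.comp (measurable_pi_apply (j, k)) (measurable_pi_apply (j, k)))
    (h.bernoulli_ξ j k) hδ (h.mean_ξ j k) (h.nonneg j k) (h.mean_X j k) (h.variance_X j k)
    (h.integrable_moment j k) (h.moment_le j k)

theorem HeavyLaw.mono {ν : Measure ℝ} {δ m m' p : ℝ} (h : HeavyLaw ν δ m p) (hp : 0 ≤ p)
    (hm : m ≤ m') : HeavyLaw ν δ m' p :=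
  { h with moment_le := h.moment_le.trans (mul_le_mul_of_nonneg_left hm hp) }

end SparseModel

/-! ### Choice of the truncation level and of the scale -/

section Parameters

/-- A choice of the truncation level `b` and of the scale `lam` for which all requirements of the
estimate for heavy laws hold. -/
theorem exists_truncation_level {δ B : ℝ} (hδ : 0 < δ) (hB : 0 < B) (Q lam₀ : ℝ) :
    ∃ L : ℝ, ∀ ℓ : ℝ, L ≤ ℓ → ∀ D : ℝ, B * ℓ ^ (3 / (2 * kappa δ)) ≤ D →
      ∃ lam b : ℝ, 1 ≤ b ∧ b ^ (4 + δ) = D ^ 2 ∧ lam₀ ≤ lam ∧ D = lam ^ 16 ∧ ℓ ≤ lam ^ 6 ∧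
        b ^ 2 ≤ lam ^ 16 ∧ 2 * ((Q + 3) * ℓ) * b ^ 2 ≤ lam ^ 16 := by
  -- θ equals 2ϰ, so the hypothesis says that D^θ is at least B^θ ℓ³.
  set θ := δ / (4 + δ) with hθ
  have hθ0 : 0 < θ := by positivity
  have hθ1 : θ ≤ 1 := by rw [hθ, div_le_one (by positivity)]; linarith
  have hκ : 3 / (2 * kappa δ) = 3 / θ := by rw [kappa, hθ]; field_simp
  set a := max lam₀ 1 with ha
  have ha1 : 1 ≤ a := le_max_right _ _
  refine ⟨max (max 1 ((B ^ 3)⁻¹)) (max (2 * (Q + 3) / B ^ θ) (a ^ 16 / B)), ?_⟩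
  intro ℓ hL D hD
  have l1 : 1 ≤ ℓ := (le_max_left _ _).trans ((le_max_left _ _).trans hL)
  have l2 : (B ^ 3)⁻¹ ≤ ℓ := (le_max_right _ _).trans ((le_max_left _ _).trans hL)
  have l3 : 2 * (Q + 3) / B ^ θ ≤ ℓ := (le_max_left _ _).trans ((le_max_right _ _).trans hL)
  have l4 : a ^ 16 / B ≤ ℓ := (le_max_right _ _).trans ((le_max_right _ _).trans hL)
  have l0 : 0 < ℓ := by linarith
  rw [hκ] at hD
  have hD3 : B * ℓ ^ 3 ≤ D := by
    refine le_trans ?_ hD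
    have h3 : (3 : ℝ) ≤ 3 / θ := by rw [le_div_iff₀ hθ0]; linarith
    have := Real.rpow_le_rpow_of_exponent_le l1 h3
    rw [show (3 : ℝ) = ((3 : ℕ) : ℝ) by norm_num, Real.rpow_natCast] at this
    exact mul_le_mul_of_nonneg_left (by exact_mod_cast this) hB.le
  have hDa : a ^ 16 ≤ D := by
    rw [div_le_iff₀ hB] at l4
    refine l4.trans (le_trans ?_ hD3)
    rw [mul_comm]
    exact mul_le_mul_of_nonneg_left (le_self_pow₀ l1 (by norm_num)) hB.le
  have hD1 : 1 ≤ D := (one_le_pow₀ ha1).trans hDa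
  have hD0 : 0 < D := by linarith
  set lam := D ^ (1 / 16 : ℝ) with hlam
  have hlam0 : 0 < lam := Real.rpow_pos_of_pos hD0 _
  have hlam16 : D = lam ^ 16 := by
    rw [hlam, ← Real.rpow_natCast, ← Real.rpow_mul hD0.le]; norm_num
  -- Then b² = D^{1−θ}, and the requirement 2(Q + 3)ℓb² ≤ D becomes 2(Q + 3)ℓ ≤ D^θ, which the lower
  -- bound by ℓ³ supplies for large ℓ.
  set b := D ^ (2 / (4 + δ)) with hb
  have hb1 : 1 ≤ b := Real.one_le_rpow hD1 (by positivity)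
  have hbD : b ^ 2 * D ^ θ = D := by
    rw [hb, ← Real.rpow_natCast, ← Real.rpow_mul hD0.le, ← Real.rpow_add hD0]
    have : 2 / (4 + δ) * ((2 : ℕ) : ℝ) + θ = 1 := by rw [hθ]; push_cast; field_simp; ring
    rw [this, Real.rpow_one]
  have hDθ : B ^ θ * ℓ ^ 3 ≤ D ^ θ := by
    have := Real.rpow_le_rpow (by positivity) hD hθ0.le
    rw [Real.mul_rpow hB.le (by positivity), ← Real.rpow_mul l0.le, div_mul_cancel₀ _ hθ0.ne'] at this
    exact_mod_cast this
  refine ⟨lam, b, hb1, ?_, ?_, hlam16, ?_, ?_, ?_⟩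
  · rw [hb, ← Real.rpow_mul hD0.le, div_mul_cancel₀ _ (by positivity)]
    exact_mod_cast Real.rpow_natCast D 2
  · refine (le_max_left lam₀ 1).trans (le_of_pow_le_pow_left₀ (n := 16) (by norm_num) hlam0.le ?_)
    rw [← hlam16]
    exact hDa
  -- The claim is ℓ ≤ D^{3/8}, that is ℓ⁸ ≤ D³; it follows from D ≥ Bℓ³ once B³ℓ ≥ 1.
  · refine le_of_pow_le_pow_left₀ (n := 8) (by norm_num) (by positivity) ?_
    calc ℓ ^ 8 = (B ^ 3)⁻¹ * (B ^ 3 * ℓ ^ 8) := by field_simp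
      _ ≤ ℓ * (B ^ 3 * ℓ ^ 8) := by gcongr
      _ = (B * ℓ ^ 3) ^ 3 := by ring
      _ ≤ D ^ 3 := by gcongr
      _ = _ := by rw [hlam16]; ring
  · rw [← hlam16]
    calc b ^ 2 = b ^ 2 * 1 := (mul_one _).symm
      _ ≤ b ^ 2 * D ^ θ := by
          gcongr
          exact Real.one_le_rpow hD1 hθ0.le
      _ = D := hbD
  · rw [← hlam16]
    have hBθ : 0 < B ^ θ := Real.rpow_pos_of_pos hB _
    rw [div_le_iff₀ hBθ] at l3
    calc 2 * ((Q + 3) * ℓ) * b ^ 2 = b ^ 2 * (2 * (Q + 3) * ℓ) := by ring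
      _ ≤ b ^ 2 * (ℓ * B ^ θ * ℓ) := by gcongr
      _ = b ^ 2 * (B ^ θ * ℓ ^ 2) := by ring
      _ ≤ b ^ 2 * (B ^ θ * ℓ ^ 3) := by
          gcongr
          norm_num
      _ ≤ b ^ 2 * D ^ θ := by gcongr
      _ = D := hbD

end Parameters

theorem mainTheorem3 (δ m B y₀ : ℝ) (hδ : 0 < δ) (hB : 0 < B) (hy₀ : y₀ < 1) :
    ∃ τ₀ : ℝ, 0 < τ₀ ∧
      ∀ n : ℕ → ℕ, Tendsto (fun N : ℕ => (n N : ℝ) / (N : ℝ)) atTop (𝓝 y₀) →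
      ∀ Q : ℝ, 1 ≤ Q → ∀ A : ℝ, 0 < A →
      ∃ C : ℝ, 0 < C ∧
        ∀ (N : ℕ) (hn : 0 < n N) (hN : n N < N) (p : ℝ),
        B * Real.log N ^ (3 / (2 * kappa δ)) ≤ N * p →
        ∀ (Ω : Type*) [MeasurableSpace Ω] (P : Measure Ω) [IsProbabilityMeasure P]
          (X ξ : Fin N → Fin (n N) → Ω → ℝ), IsSparseModel P δ m p X ξ →
        ∀ τ : ℝ, τ ≤ τ₀ →
          P.real {ω | sLast (sparseMatrix X ξ ω) ≤ τ * √(N * p)} ≤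
            C * (N : ℝ) ^ (-Q) +
              (N : ℝ) ^ 2 * p *
                P.real {ω | A * ((N : ℝ) * p) ^ (1 / 2 - kappa δ) * Real.log N <
                  |X ⟨0, hn.trans hN⟩ ⟨0, hn⟩ ω|} := by
  -- Then 1 − 2η = (1 + y₀)/2 > y₀, so n + 2ηN ≤ N for all large N.
  set η := (1 - y₀) / 4 with hη
  have hη0 : 0 < η := by rw [hη]; linarith
  obtain ⟨τ₁, hτ₁, H⟩ := exists_matMeasure_heavy_small_image_le hη0 hδ
  refine ⟨√τ₁, Real.sqrt_pos.2 hτ₁, fun n hn Q hQ A hA => ?_⟩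
  have hQ0 : 0 < Q := by linarith
  obtain ⟨lam₀, H⟩ := H (max m 1) (le_max_right _ _) Q hQ0
  obtain ⟨L, hL⟩ := exists_truncation_level hδ hB Q lam₀
  have e1 : ∀ᶠ N : ℕ in atTop, (n N : ℝ) / N < 1 - 2 * η :=
    hn.eventually_lt_const (by rw [hη]; linarith)
  have e2 : ∀ᶠ N : ℕ in atTop, L ≤ Real.log N :=
    (Real.tendsto_log_atTop.comp tendsto_natCast_atTop_atTop).eventually_ge_atTop L
  have e3 : ∀ᶠ N : ℕ in atTop, Q * Real.log N ≤ N := by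
    have h := (Real.isLittleO_log_id_atTop.bound (inv_pos.2 hQ0))
    filter_upwards [tendsto_natCast_atTop_atTop.eventually h] with N hN
    simp only [id, Real.norm_eq_abs, Nat.abs_cast] at hN
    have h1 := (le_abs_self _).trans hN
    rw [inv_mul_eq_div, le_div_iff₀ hQ0] at h1
    linarith
  obtain ⟨N₀, hN₀⟩ := eventually_atTop.1 (e1.and (e2.and e3))
  -- The summand N₀^Q makes the bound exceed 1 for N < N₀.
  refine ⟨8 + (N₀ : ℝ) ^ Q, by positivity, ?_⟩
  intro N hnN hN p hp Ω _ P _ X ξ hX τ hτ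
  have hN0 : 0 < N := hnN.trans hN
  have hNr : (0 : ℝ) < N := by exact_mod_cast hN0
  have hN1 : (1 : ℝ) ≤ N := by exact_mod_cast hN0
  have hp0 : 0 ≤ p := hX.nonneg ⟨0, hN0⟩ ⟨0, hnN⟩
  have hp1 : p ≤ 1 := hX.le_one ⟨0, hN0⟩ ⟨0, hnN⟩
  have hlog : 0 < Real.log N := Real.log_pos (by exact_mod_cast (show 1 < N by omega))
  have hNp : 0 < N * p := lt_of_lt_of_le (mul_pos hB (Real.rpow_pos_of_pos hlog _)) hp
  have hp' : 0 < p := pos_of_mul_pos_right hNp hNr.le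
  -- The tail term is dropped: large entries are dealt with by deleting their rows, so the bound C
  -- N^{-Q} holds alone.
  refine le_trans ?_ (le_add_of_nonneg_right (by positivity))
  rcases lt_or_ge N N₀ with hlt | hge
  · have h1 : (1 : ℝ) ≤ (N₀ : ℝ) ^ Q * (N : ℝ) ^ (-Q) := by
      rw [Real.rpow_neg hNr.le, ← div_eq_mul_inv, one_le_div (Real.rpow_pos_of_pos hNr _)]
      exact Real.rpow_le_rpow hNr.le (by exact_mod_cast hlt.le) hQ0.le
    have h2 : 0 ≤ (N : ℝ) ^ (-Q) := (Real.rpow_pos_of_pos hNr _).le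
    calc _ ≤ (1 : ℝ) := measureReal_le_one
      _ ≤ _ := by rw [add_mul]; linarith
  obtain ⟨h1, h2, h3⟩ := hN₀ N hge
  obtain ⟨lam, b, hb, hbD, hlam, hD, hl6, hb2, hb3⟩ := hL _ h2 _ hp
  have hmX := hX.measurable_X
  have hmξ := hX.measurable_ξ
  have hpr : ∀ j k, IsProbabilityMeasure (P.map fun ω => ξ j k ω * X j k ω) := fun j k =>
    Measure.isProbabilityMeasure_map (by fun_prop)
  have key := H (ν := fun j k => P.map fun ω => ξ j k ω * X j k ω)
    (fun j k => (hX.heavyLaw hδ j k).mono hp0 (le_max_left m 1)) hp' hp1 hb hN1 hbD hlam hD hl6 hb2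
    hb3 h3 (by simp) (by
      rw [div_lt_iff₀ hNr] at h1
      simp only [Fintype.card_fin]
      linarith)
  rw [← map_sparseMatrix_eq hX] at key
  have hsub : {ω | sLast (sparseMatrix X ξ ω) ≤ τ * √(N * p)} ⊆
      (fun ω j k => ξ j k ω * X j k ω) ⁻¹' {A | ∃ x : Fin (n N) → ℝ, ∑ k, x k ^ 2 = 1 ∧
        ∑ j, (∑ k, A j k * x k) ^ 2 ≤ τ₁ * (N * p)} := by
    intro ω hω
    have h4 : sLast (sparseMatrix X ξ ω) ≤ √τ₁ * √(N * p) :=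
      le_trans hω (mul_le_mul_of_nonneg_right hτ (Real.sqrt_nonneg _))
    obtain ⟨x, hx, hx'⟩ := exists_unit_of_sLast_le hnN h4
    rw [mul_pow, Real.sq_sqrt hτ₁.le, Real.sq_sqrt hNp.le] at hx'
    exact ⟨x, hx, hx'⟩
  have hle : P {ω | sLast (sparseMatrix X ξ ω) ≤ τ * √(N * p)} ≤
      ENNReal.ofReal (8 * Real.exp (-(Q * Real.log N))) :=
    (measure_mono hsub).trans ((Measure.le_map_apply
      (f := fun ω (j : Fin N) (k : Fin (n N)) => ξ j k ω * X j k ω) (by fun_prop) _).trans key)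
  calc _ ≤ 8 * Real.exp (-(Q * Real.log N)) :=
        ENNReal.toReal_le_of_le_ofReal (by positivity) hle
    _ = 8 * (N : ℝ) ^ (-Q) := by
        rw [Real.rpow_def_of_pos hNr]
        congr 2
        ring
    _ ≤ _ := by
        gcongr
        exact le_add_of_nonneg_right (by positivity)
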